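/- Let $p$ be a prime, $e\geq 1$ an integer and $G$ a finite group. Let $\mathfrak g=\mathbb G_a^e[1]\times G_{\mathbb F_p}$, a finite group scheme over $\mathbb F_p$, where $\mathbb G_a[1]$ is the kernel of Frobenius on the additive group. A $\mathfrak g$-field is a field $K$ of characteristic $p$ with derivations $D_1,\dots,D_e$ which commute with each other and satisfy $D_i^{(p)}=0$ ($p$-fold composition), together with an action $(\sigma_g)_{g\in G}$ of $G$ on $K$ by field automorphisms commuting with all the $D_i$. Let $L_{\mathfrak g}$ be the language of rings with unary function symbols $D_1,\dots,D_e$ and $\sigma_g$ $(g\in G)$, and let $\mathfrak g\text{-}\mathrm{DF}$ be the $L_{\mathfrak g}$-theory of $\mathfrak g$-fields. Put $\Theta=\{0,\dots,p-1\}^e\times G$ and $\partial_{(\alpha,g)}=D_1^{\alpha_1}\cdots D_e^{\alpha_e}\sigma_g$. For a $\mathfrak g$-field $K$ and a polynomial ring $K[X_j: j\in J]$, extend the $\mathfrak g$-structure of $K$ to $K[\partial_\theta X_j: j\in J,\theta\in\Theta]$ by $D_i(\partial_{(\alpha,g)}X_j)=\partial_{(\alpha+\varepsilon_i,g)}X_j$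 ($0$ if $\alpha_i=p-1$), where $\varepsilon_i$ is the $i$-th unit vector, and $\sigma_h(\partial_{(\alpha,g)}X_j)=\partial_{(\alpha,hg)}X_j$; here $X_j$ is identified with $\partial_{(0,1)}X_j$. For an affine $K$-scheme $V\subseteq\mathbb A^J$ with ideal $I$, the prolongation $\nabla(V)\subseteq\mathbb A^{J\times\Theta}$ is the closed subscheme with ideal generated by all $\partial_\theta f$ with $f\in I$, $\theta\in\Theta$. The morphism $c:\mathbb A^{J\times\Theta}\to\mathbb A^{J\times\Theta\times\Theta}$ is given on coordinate rings by $\partial_{(\beta,h)}(\partial_{(\alpha,g)}X_j)\mapsto\partial_{(\alpha+\beta,hg)}X_j$ ($0$ if some $\alpha_i+\beta_i\geq p$), and $c_V:\nabla(V)\to\nabla(\nabla(V))$ is its restriction. For $a\in V(K)$ let $\partial_V(a)=(\partial_\theta a_j)_{j,\theta}\in\nabla(V)(K)$. A $K$-variety is a reduced, $K$-irreducible closed subscheme of an affine space over $K$. The $\mathfrak g$-field $K$ satisfies the geometric axioms if for every $n\geq 1$ and all $K$-varieties $V\subseteq\mathbb A^n$ and $W\subseteq\nabla(V)$ with $c_V(W)\subseteq\nabla(W)$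 there is $a\in V(K)$ with $\partial_V(a)\in W(K)$. Let $\mathfrak g\text{-}\mathrm{DCF}$ be the $L_{\mathfrak g}$-theory of the $\mathfrak g$-fields satisfying the geometric axioms. Let $\mathfrak g\text{-}\mathrm{DF}_b$ and $\mathfrak g\text{-}\mathrm{DCF}_b$ be the theories, in the language $L_{\mathfrak g}$ with extra constant symbols $b_1,\dots,b_e$, obtained from $\mathfrak g\text{-}\mathrm{DF}$ and $\mathfrak g\text{-}\mathrm{DCF}$ by adding axioms which say that $\{b_1,\dots,b_e\}$ is a $p$-basis (the monomials $b^\alpha$, $\alpha\in\{0,\dots,p-1\}^e$, form a basis of $K$ over $K^p$), that $\sigma_g(b_j)=b_j$ for all $g\in G$ and all $j$, and that $D_i(b_j)=\delta_{ij}$ for all $i,j$. **Proposition.** The models of $\mathfrak g\text{-}\mathrm{DCF}$ are exactly the $\mathfrak g$-fields satisfying the geometric axioms, and the theory $\mathfrak g\text{-}\mathrm{DCF}_b$ is a model companion of the theory $\mathfrak g\text{-}\mathrm{DF}_b$: every model of either theory embeds into a model of the other, and every embedding between models of $\mathfrak g\text{-}\mathrm{DCF}_b$ is elementary. -/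

import Mathlib

open FirstOrder FirstOrder.Language

universe u v w

namespace FiniteGroupSchemeDCF

/-! ### Model complete theories and model companions -/

/-- `T` is model complete: every embedding between models of `T` is elementary. -/
def IsModelComplete {L : FirstOrder.Language.{u, v}} (T : L.Theory) : Prop :=
  ∀ (M N : Theory.ModelType.{u, v, w} T) (f : M ↪[L] N) (n : ℕ) (φ : L.Formula (Fin n))
    (x : Fin n → M), φ.Realize (fun i => f (x i)) ↔ φ.Realize x

/-- Every model of `T` embeds into a model of `T'`. -/
def EmbedsIntoModels {L : FirstOrder.Language.{u, v}} (T T' : L.Theory) : Prop :=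
  ∀ M : Theory.ModelType.{u, v, w} T, ∃ N : Theory.ModelType.{u, v, w} T', Nonempty (M ↪[L] N)

/-- `T'` is a model companion of `T`. -/
def IsModelCompanion {L : FirstOrder.Language.{u, v}} (T' T : L.Theory) : Prop :=
  EmbedsIntoModels.{u, v, w} T T' ∧ EmbedsIntoModels.{u, v, w} T' T ∧ IsModelComplete.{u, v, w} T'

/-! ### The language and the theory of `𝔤`-fields, for `𝔤 = 𝔾ₐᵉ[1] × G` over `𝔽_p` -/

/-- The unary symbols `D_1, …, D_e` and `σ_g` for `g ∈ G`. -/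
inductive OpFunc (e : ℕ) (G : Type u) : ℕ → Type u
  | der (i : Fin e) : OpFunc e G 1
  | act (g : G) : OpFunc e G 1

/-- The language with the unary symbols `D_1, …, D_e` and `σ_g` for `g ∈ G`. -/
def opLang (e : ℕ) (G : Type u) : FirstOrder.Language.{u, 0} where
  Functions := OpFunc e G
  Relations := fun _ => Empty

/-- The language of rings together with unary symbols `D_1, …, D_e` and `σ_g` for `g ∈ G`.
(The elements of the prime field are closed terms, so they get no extra constant symbols.) -/
abbrev gLang (e : ℕ) (G : Type u) : FirstOrder.Language.{u, 0} :=
  FirstOrder.Language.ring.sum (opLang e G)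

section Syn

variable {e : ℕ} {G : Type u}

/-- The symbol `+`. -/
def addSym : (gLang e G).Functions 2 := Sum.inl Ring.addFunc
/-- The symbol `*`. -/
def mulSym : (gLang e G).Functions 2 := Sum.inl Ring.mulFunc
/-- The symbol `-`. -/
def negSym : (gLang e G).Functions 1 := Sum.inl Ring.negFunc
/-- The symbol `0`. -/
def zeroSym : (gLang e G).Functions 0 := Sum.inl Ring.zeroFunc
/-- The symbol `1`. -/
def oneSym : (gLang e G).Functions 0 := Sum.inl Ring.oneFunc
/-- The symbol `D_i`. -/
def derSym (i : Fin e) : (gLang e G).Functions 1 := Sum.inr (OpFunc.der i)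
/-- The symbol `σ_g`. -/
def actSym (g : G) : (gLang e G).Functions 1 := Sum.inr (OpFunc.act g)

variable {α : Type*}

/-- The term `t + s`. -/
def tAdd (t s : (gLang e G).Term α) : (gLang e G).Term α := addSym.apply₂ t s
/-- The term `t * s`. -/
def tMul (t s : (gLang e G).Term α) : (gLang e G).Term α := mulSym.apply₂ t s
/-- The term `0`. -/
def tZero : (gLang e G).Term α := Constants.term zeroSym
/-- The term `1`. -/
def tOne : (gLang e G).Term α := Constants.term oneSym
/-- The term `D_i t`. -/
def tDer (i : Fin e) (t : (gLang e G).Term α) : (gLang e G).Term α := (derSym i).apply₁ t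
/-- The term `σ_g t`. -/
def tAct (g : G) (t : (gLang e G).Term α) : (gLang e G).Term α := (actSym g).apply₁ t

end Syn

/-- The axioms saying that `D_1, …, D_e` are commuting derivations whose `p`-fold iterates vanish,
and that `(σ_g)_{g ∈ G}` is an action of `G` by ring endomorphisms (hence automorphisms) which
commutes with the derivations. -/
inductive OpAxiom (p e : ℕ) (G : Type u) [Group G] : (gLang e G).Sentence → Prop
  | der_add (i : Fin e) :
      OpAxiom p e G (∀' ∀' (tDer i (tAdd &0 &1) =' tAdd (tDer i &0) (tDer i &1)))
  | der_mul (i : Fin e) :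
      OpAxiom p e G
        (∀' ∀' (tDer i (tMul &0 &1) =' tAdd (tMul &0 (tDer i &1)) (tMul &1 (tDer i &0))))
  | der_comm (i j : Fin e) :
      OpAxiom p e G (∀' (tDer i (tDer j &0) =' tDer j (tDer i &0)))
  | der_pow (i : Fin e) :
      OpAxiom p e G (∀' ((tDer i)^[p] &0 =' tZero))
  | act_add (g : G) :
      OpAxiom p e G (∀' ∀' (tAct g (tAdd &0 &1) =' tAdd (tAct g &0) (tAct g &1)))
  | act_mul (g : G) :
      OpAxiom p e G (∀' ∀' (tAct g (tMul &0 &1) =' tMul (tAct g &0) (tAct g &1)))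
  | act_one (g : G) :
      OpAxiom p e G (tAct g tOne =' tOne)
  | one_act :
      OpAxiom p e G (∀' (tAct 1 &0 =' &0))
  | mul_act (g h : G) :
      OpAxiom p e G (∀' (tAct (g * h) &0 =' tAct g (tAct h &0)))
  | act_der (g : G) (i : Fin e) :
      OpAxiom p e G (∀' (tAct g (tDer i &0) =' tDer i (tAct g &0)))

/-- The theory `𝔤-DF` of `𝔤`-fields. -/
def gDF (p e : ℕ) (G : Type u) [Group G] : (gLang e G).Theory :=
  (LHom.sumInl : FirstOrder.Language.ring →ᴸ gLang e G).onTheory (Theory.fieldOfChar p) ∪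
    {φ | OpAxiom p e G φ}

/-! ### `𝔤`-fields, prolongations, and the geometric axioms -/

/-- A `𝔤`-field structure on a field `K` (of characteristic `p`). -/
structure GFieldStructure (p e : ℕ) (G : Type u) [Group G] (K : Type w) [Field K] where
  charP : CharP K p
  /-- the derivations -/
  D : Fin e → Derivation ℤ K K
  /-- the group action -/
  σ : G →* RingAut K
  D_comm : ∀ i j x, D i (D j x) = D j (D i x)
  D_pow : ∀ i x, (D i)^[p] x = 0
  σ_D : ∀ g i x, σ g (D i x) = D i (σ g x)

/-- The index set `Θ` of a basis of the Hopf algebra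
`H = 𝔽_p[v_1, …, v_e]/(v_1^p, …, v_e^p) ⊗ Func(G, 𝔽_p)` of `𝔤`: the pair `(α, g)` stands for
`v^α/α! ⊗ δ_g`. With respect to this basis, the `(α, g)`-coordinate of a `𝔤`-ring structure
`∂ : R → R ⊗ H` is the operator `∂_{(α, g)} = D_1^{α_1} ⋯ D_e^{α_e} σ_g`. -/
abbrev Idx (p e : ℕ) (G : Type u) : Type u := (Fin e → Fin p) × G

/-- The composition `D_1^{α_1} ⋯ D_e^{α_e}`. -/
def iterD {p e : ℕ} {R : Type w} (D : Fin e → R → R) (α : Fin e → Fin p) (x : R) : R :=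
  (List.finRange e).foldr (fun i y => (D i)^[(α i : ℕ)] y) x

namespace GFieldStructure

variable {p e : ℕ} {G : Type u} [Group G] {K : Type w} [Field K]

/-- The operator `∂_θ` on `K`. -/
def op (S : GFieldStructure p e G K) (θ : Idx p e G) (x : K) : K :=
  iterD (fun i => S.D i) θ.1 (S.σ θ.2 x)

section Prolongation

variable {ι : Type*}

/-- `D_i (∂_{(α, g)} X_j) = ∂_{(α + ε_i, g)} X_j`, which is `0` if `α_i = p - 1`. -/
noncomputable def derVar (K : Type w) [Field K] (i : Fin e) :
    ι × Idx p e G → MvPolynomial (ι × Idx p e G) K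
  | (j, (α, g)) =>
    if h : (α i : ℕ) + 1 < p then
      MvPolynomial.X (j, (Function.update α i ⟨(α i : ℕ) + 1, h⟩, g))
    else 0

/-- The derivation `D_i` on `K{X} = K[∂_θ X_j : j ∈ ι, θ ∈ Θ]` which extends `D_i` on `K`; it is
the sum of `D_i` applied to the coefficients and of the `K`-linear derivation with the prescribed
values on the variables. -/
noncomputable def polyD (S : GFieldStructure p e G K) (i : Fin e)
    (f : MvPolynomial (ι × Idx p e G) K) : MvPolynomial (ι × Idx p e G) K :=
  ∑ m ∈ f.support, MvPolynomial.monomial m (S.D i (f.coeff m)) +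
    MvPolynomial.mkDerivation K (derVar K i) f

/-- The ring endomorphism `σ_g` of `K{X}` which extends `σ_g` on `K` and maps
`∂_{(α, h)} X_j` to `∂_{(α, g * h)} X_j`. -/
noncomputable def polyσ (S : GFieldStructure p e G K) (g : G) :
    MvPolynomial (ι × Idx p e G) K →+* MvPolynomial (ι × Idx p e G) K :=
  MvPolynomial.eval₂Hom (MvPolynomial.C.comp (S.σ g : K →+* K))
    (fun v => MvPolynomial.X (v.1, (v.2.1, g * v.2.2)))

variable [NeZero p]

/-- The coordinates `∂_θ : K[X] → K{X}` of the `H`-operator `K[X] → K{X} ⊗ H` which extends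
the one on `K` and maps `X_j` to the generic element with coordinates `∂_θ X_j`. -/
noncomputable def polyOp (S : GFieldStructure p e G K) (θ : Idx p e G) (f : MvPolynomial ι K) :
    MvPolynomial (ι × Idx p e G) K :=
  iterD (fun i => S.polyD i) θ.1
    (S.polyσ θ.2 (MvPolynomial.rename (fun j => (j, ((fun _ => 0, 1) : Idx p e G))) f))

/-- The ideal of the prolongation `∇(V)`, where `V` is the affine scheme with ideal `I`: it is
generated by the polynomials `∂_θ f` for `f ∈ I`. -/
noncomputable def nabla (S : GFieldStructure p e G K) (I : Ideal (MvPolynomial ι K)) :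
    Ideal (MvPolynomial (ι × Idx p e G) K) :=
  Ideal.span {q | ∃ θ, ∃ f ∈ I, q = S.polyOp θ f}

end Prolongation

/-- The comorphism of `c : ∇(𝔸^ι) → ∇(∇(𝔸^ι))`, which is induced by the comultiplication of `H`:
the variable `∂_{(β, h)} (∂_{(α, g)} X_j)` is mapped to `∂_{(α + β, h * g)} X_j`, and to `0`
if `α + β` has an entry `≥ p`. -/
noncomputable def comulPoly (p e : ℕ) (G : Type u) [Group G] (K : Type w) [Field K]
    (ι : Type*) :
    MvPolynomial ((ι × Idx p e G) × Idx p e G) K →ₐ[K] MvPolynomial (ι × Idx p e G) K :=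
  open scoped Classical in
  MvPolynomial.aeval fun
    | ((j, (α, g)), (β, h)) =>
      if hlt : ∀ i, (α i : ℕ) + (β i : ℕ) < p then
        MvPolynomial.X (j, (fun i => ⟨(α i : ℕ) + (β i : ℕ), hlt i⟩, h * g))
      else 0

/-- The geometric axioms: for all `K`-varieties `V ⊆ 𝔸ⁿ` and `W ⊆ ∇(V)` (reduced and irreducible
over `K`, so given by prime ideals `I` and `P`) with `c_V(W) ⊆ ∇(W)` there is `a ∈ V(K)` such that
`∂_V(a) ∈ W(K)`. -/
def Geometric [NeZero p] (S : GFieldStructure p e G K) : Prop :=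
  ∀ (n : ℕ), 0 < n →
    ∀ (I : Ideal (MvPolynomial (Fin n) K)) (P : Ideal (MvPolynomial (Fin n × Idx p e G) K)),
      I.IsPrime → P.IsPrime → S.nabla I ≤ P →
      S.nabla P ≤ P.comap (comulPoly p e G K (Fin n)) →
      ∃ a : Fin n → K,
        (∀ f ∈ I, MvPolynomial.eval a f = 0) ∧
        ∀ f ∈ P, MvPolynomial.eval (fun v => S.op v.2 (a v.1)) f = 0

end GFieldStructure

/-- The `gLang e G`-structure on `K` is the one given by the `𝔤`-field `(K, S)`. -/
structure Interprets {p e : ℕ} {G : Type u} [Group G] (K : Type w) [(gLang e G).Structure K]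
    [Field K] (S : GFieldStructure p e G K) : Prop where
  add : ∀ x : Fin 2 → K, Structure.funMap (addSym : (gLang e G).Functions 2) x = x 0 + x 1
  mul : ∀ x : Fin 2 → K, Structure.funMap (mulSym : (gLang e G).Functions 2) x = x 0 * x 1
  neg : ∀ x : Fin 1 → K, Structure.funMap (negSym : (gLang e G).Functions 1) x = -x 0
  zero : ∀ x : Fin 0 → K, Structure.funMap (zeroSym : (gLang e G).Functions 0) x = 0
  one : ∀ x : Fin 0 → K, Structure.funMap (oneSym : (gLang e G).Functions 0) x = 1
  der : ∀ i (x : Fin 1 → K),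
    Structure.funMap (derSym i : (gLang e G).Functions 1) x = S.D i (x 0)
  act : ∀ g (x : Fin 1 → K),
    Structure.funMap (actSym g : (gLang e G).Functions 1) x = S.σ g (x 0)

/-- The structure `K` is a `𝔤`-field which satisfies the geometric axioms. -/
def IsGeometricGField (p e : ℕ) [NeZero p] (G : Type u) [Group G] (K : Type w)
    [(gLang e G).Structure K] : Prop :=
  ∃ (_ : Field K) (S : GFieldStructure p e G K), Interprets K S ∧ S.Geometric

/-- The theory `𝔤-DCF` of the `𝔤`-fields satisfying the geometric axioms. -/
def gDCF (p e : ℕ) [NeZero p] (G : Type u) [Group G] : (gLang e G).Theory :=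
  {φ | ∀ (K : Type w) [(gLang e G).Structure K], IsGeometricGField p e G K → K ⊨ φ}

/-! ### The theories with a fixed `p`-basis -/

/-- The formula in the variables `b_1, …, b_e` which says that they form a `p`-basis: every `x` is
`∑_α y_α^p b^α`, the sum over `α ∈ {0, …, p-1}^e`, for a unique family `(y_α)`; in other words, the
monomials `b^α` are a linear basis of the field over its subfield of `p`-th powers. -/
noncomputable def pBasisFormula (p e : ℕ) : FirstOrder.Language.ring.Formula (Fin e) :=
  Formula.iAlls Unit <| Formula.iExsUnique (Fin e → Fin p) <|
    Term.equal
      (Term.var (Sum.inl (Sum.inr ())))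
      (Ring.termOfFreeCommRing
        (∑ α : Fin e → Fin p,
          FreeCommRing.of (Sum.inr α) ^ p *
            ∏ i, FreeCommRing.of (Sum.inl (Sum.inl i)) ^ (α i : ℕ)))

/-- The conditions on `b_1, …, b_e` as formulas in the variables `b_1, …, b_e`: they form
a `p`-basis, they are `G`-invariant, and `D_i b_j` is the Kronecker delta. -/
inductive BasisAxiom (p e : ℕ) (G : Type u) : (gLang e G).Formula (Fin e) → Prop
  | pBasis : BasisAxiom p e G
      ((LHom.sumInl : FirstOrder.Language.ring →ᴸ gLang e G).onFormula (pBasisFormula p e))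
  | invariant (g : G) (j : Fin e) :
      BasisAxiom p e G (Term.equal (tAct g (Term.var j)) (Term.var j))
  | delta (i j : Fin e) :
      BasisAxiom p e G (Term.equal (tDer i (Term.var j)) (if i = j then tOne else tZero))

/-- The language with the extra constant symbols `b_1, …, b_e`. -/
abbrev gLangB (e : ℕ) (G : Type u) : FirstOrder.Language.{u, 0} := (gLang e G)[[Fin e]]

/-- The expansion of a theory of `𝔤`-fields by the conditions on the constants `b_1, …, b_e`. -/
def withBasis (p e : ℕ) (G : Type u) (T : (gLang e G).Theory) : (gLangB e G).Theory :=
  ((gLang e G).lhomWithConstants (Fin e)).onTheory T ∪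
    {φ | ∃ ψ, BasisAxiom p e G ψ ∧ φ = Formula.equivSentence ψ}

/-- The theory `𝔤-DF_b`. -/
def gDFb (p e : ℕ) (G : Type u) [Group G] : (gLangB e G).Theory :=
  withBasis p e G (gDF p e G)

/-- The theory `𝔤-DCF_b`. -/
def gDCFb (p e : ℕ) [NeZero p] (G : Type u) [Group G] : (gLangB e G).Theory :=
  withBasis p e G (gDCF.{u, w} p e G)

end FiniteGroupSchemeDCF

namespace FiniteGroupSchemeDCF

/-! ### Rings with an action of `𝔤` -/

section Leibniz

variable {R : Type*} [CommRing R]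

/-! By definition `gDCF` consists of all sentences true in the 𝔤-fields satisfying the geometric
axioms, so a model of it need not obviously satisfy these axioms. The crux is to replace them by
three conditions which are visibly first-order. There are `IsDual` elements b_j; there is an
`IsFreePoint` y, which rigidifies the action of G; and `HypersurfacePoints` holds. The last is a
PAC-like condition on the field C of constants of K: a hypersurface f = 0 over C which is
irreducible over K has a C-point outside h = 0 whenever h is over C and not divisible by f.

The geometric axioms imply the three conditions. Indeed c_V(W) ⊆ ∇(W) says that the ideal of W is
stable under the D_i and σ_g (`comulPoly_polyOp`), so the axioms say that finitely many equations in
the operators which have a solution in a 𝔤-extension have one in K (`Geometric.exists_point`). Each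
of the three conditions can be realised in a suitable extension.

Conversely (`geometric_of_hypersurfacePoints`), W has a generic point in a 𝔤-field L over K. Taylor
expansion in b and a Vandermonde argument on the conjugates of y show that L is generated as a ring
by K and the constants of L. So the generic point is polynomial in finitely many constants of L, and
it is enough to specialise these to constants of K (`HypersurfacePoints.exists_specialization`).
Constants of L are linearly disjoint from K over C. By `HypersurfacePoints` for X^p - c, every
element of C is a p-th power in K, so MacLane's criterion makes the field generated over C by the
given constants separable, hence the function field of a hypersurface. That hypersurface stays
irreducible over K by linear disjointness, and a C-point of it avoiding the denominators is the
specialisation.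

The same criterion produces geometric extensions (`exists_geometric_extension`): adjoin b and y,
then close off under solutions of hypersurface problems. Dual elements stay dual in extensions, and
in a geometric 𝔤-field dual elements automatically form a p-basis (`IsDual.exists_pBasis`,
`IsDual.pBasis_unique`); this embeds models of `gDFb` into models of `gDCFb`. For model
completeness, finite parts of an extension N of a geometric M map back to M over M, so N embeds over
M into an ultrapower of M, and Robinson's test applies. -/

theorem iterate_leibniz (D : Derivation ℤ R R) (n : ℕ) (x y : R) :
    D^[n] (x * y) =
      ∑ ij ∈ Finset.HasAntidiagonal.antidiagonal n, n.choose ij.1 • (D^[ij.1] x * D^[ij.2] y) := by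
  induction n with
  | zero => simp
  | succ n ih =>
    rw [Finset.sum_antidiagonal_choose_succ_nsmul
      (fun i j => D^[i] x * D^[j] y) n, Function.iterate_succ_apply', ih, map_sum,
      ← Finset.sum_add_distrib]
    refine Finset.sum_congr rfl fun ij hij => ?_
    rw [← Nat.choose_symm_of_eq_add (Finset.HasAntidiagonal.mem_antidiagonal.1 hij).symm, map_nsmul,
      Derivation.leibniz, ← smul_add, Function.iterate_succ_apply', Function.iterate_succ_apply',
      smul_eq_mul, smul_eq_mul, mul_comm (D^[ij.2] y)]

/-- All binomial coefficients strictly between the two ends are divisible by p. Thus D^p is again a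
derivation, which allows its vanishing to be tested on generators. -/
theorem iterate_leibniz_charP (p : ℕ) [Fact p.Prime] [CharP R p] (D : Derivation ℤ R R) (x y : R) :
    D^[p] (x * y) = x * D^[p] y + y * D^[p] x := by
  have hp : p.Prime := Fact.out
  rw [iterate_leibniz, Finset.Nat.sum_antidiagonal_eq_sum_range_succ_mk, Finset.sum_range_succ,
    Finset.sum_range_eq_add_Ico _ hp.pos, Finset.sum_eq_zero (s := Finset.Ico 1 p)]
  · simp [mul_comm]
  · intro i hi
    rw [Finset.mem_Ico] at hi
    rw [nsmul_eq_mul, (CharP.cast_eq_zero_iff R p _).2 (hp.dvd_choose_self (by omega) hi.2),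
      zero_mul]

theorem iterate_map_add (D : Derivation ℤ R R) (n : ℕ) (x y : R) :
    D^[n] (x + y) = D^[n] x + D^[n] y := by
  induction n generalizing x y with
  | zero => rfl
  | succ n ih => simp [Function.iterate_succ_apply, ih]

theorem derivation_pow_charP (p : ℕ) [CharP R p] (D : Derivation ℤ R R) (x : R) :
    D (x ^ p) = 0 := by
  simp [Derivation.leibniz_pow]

/-- A `p`-th power acts as a constant for every iterate of a derivation. -/
theorem iterate_mul_of_eq_zero (D : Derivation ℤ R R) {c : R} (hc : D c = 0) (n : ℕ) (x : R) :
    D^[n] (c * x) = c * D^[n] x := by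
  induction n generalizing x with
  | zero => rfl
  | succ n ih => simp [Function.iterate_succ_apply, Derivation.leibniz, hc, ih]

end Leibniz

/-- A `𝔤`-structure on a commutative ring. -/
structure GRing (p e : ℕ) (G : Type u) [Group G] (R : Type w) [CommRing R] where
  D : Fin e → Derivation ℤ R R
  σ : G → R →+* R
  σ_one : ∀ x, σ 1 x = x
  σ_mul : ∀ g h x, σ (g * h) x = σ g (σ h x)
  D_comm : ∀ i j x, D i (D j x) = D j (D i x)
  D_pow : ∀ i x, (D i)^[p] x = 0
  σ_D : ∀ g i x, σ g (D i x) = D i (σ g x)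

/-- The `𝔤`-ring underlying a `𝔤`-field. -/
def GFieldStructure.toGRing {p e : ℕ} {G : Type u} [Group G] {K : Type w} [Field K]
    (S : GFieldStructure p e G K) : GRing p e G K where
  D := S.D
  σ g := (S.σ g : K →+* K)
  σ_one := by simp
  σ_mul := by simp
  D_comm := S.D_comm
  D_pow := S.D_pow
  σ_D := S.σ_D

section Iter

variable {p e : ℕ} {R : Type*} {R' : Type*}

theorem iterD_map {D : Fin e → R → R} {D' : Fin e → R' → R'} {φ : R → R'}
    (h : ∀ i x, φ (D i x) = D' i (φ x)) (α : Fin e → Fin p) (x : R) :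
    φ (iterD D α x) = iterD D' α (φ x) := by
  unfold iterD
  induction List.finRange e with
  | nil => rfl
  | cons i l ih =>
    rw [List.foldr_cons, List.foldr_cons, ← ih]
    exact (Function.Semiconj.iterate_right (h i) _).eq _

theorem iterD_induction {D : Fin e → R → R} {s : Set R} (h : ∀ i, ∀ x ∈ s, D i x ∈ s)
    (α : Fin e → Fin p) {x : R} (hx : x ∈ s) : iterD D α x ∈ s := by
  unfold iterD
  induction List.finRange e with
  | nil => exact hx
  | cons i l ih => exact Set.MapsTo.iterate (h i) _ ih

/-- The composition of the iterates `D_i^{n_i}` along a list of indices. -/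
def iterList (D : Fin e → R → R) (l : List (Fin e)) (n : Fin e → ℕ) (x : R) : R :=
  l.foldr (fun i y => (D i)^[n i] y) x

variable {D : Fin e → R → R}

theorem iterList_update (i : Fin e) (l : List (Fin e)) (hl : i ∉ l) (n : Fin e → ℕ) (k : ℕ)
    (x : R) : iterList D l (Function.update n i k) x = iterList D l n x := by
  induction l with
  | nil => rfl
  | cons j l ih =>
    rw [List.mem_cons, not_or] at hl
    change (D j)^[Function.update n i k j] (iterList D l (Function.update n i k) x) = _
    rw [ih hl.2, Function.update_of_ne (Ne.symm hl.1)]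
    rfl

/-- Commutativity lets the power of `D i` move to the front, wherever i occurs in the list. Setting
the remaining exponent to 0 isolates that power completely. -/
theorem iterList_update_mem (hD : ∀ i j x, D i (D j x) = D j (D i x)) (i : Fin e)
    (l : List (Fin e)) (hl : l.Nodup) (hi : i ∈ l) (n : Fin e → ℕ) (k : ℕ) (x : R) :
    iterList D l (Function.update n i k) x =
      (D i)^[k] (iterList D l (Function.update n i 0) x) := by
  induction l with
  | nil => simp at hi
  | cons j l ih =>
    rw [List.nodup_cons] at hl
    rcases eq_or_ne i j with rfl | hij
    · change (D i)^[Function.update n i k i] (iterList D l (Function.update n i k) x) =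
        (D i)^[k] ((D i)^[Function.update n i 0 i] (iterList D l (Function.update n i 0) x))
      rw [iterList_update _ _ hl.1, iterList_update _ _ hl.1]
      simp
    · have hi' : i ∈ l := by simpa [hij] using hi
      change (D j)^[Function.update n i k j] (iterList D l (Function.update n i k) x) =
        (D i)^[k] ((D j)^[Function.update n i 0 j] (iterList D l (Function.update n i 0) x))
      rw [ih hl.2 hi', Function.update_of_ne hij.symm, Function.update_of_ne hij.symm]
      exact (Function.Commute.iterate_iterate (f := D j) (g := D i) (fun y => hD j i y) _ _) _

theorem D_iterList (hD : ∀ i j x, D i (D j x) = D j (D i x)) (i : Fin e) (n : Fin e → ℕ) (x : R) :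
    D i (iterList D (List.finRange e) n x) =
      iterList D (List.finRange e) (Function.update n i (n i + 1)) x := by
  rw [iterList_update_mem hD i _ (List.nodup_finRange e) (List.mem_finRange i) n (n i + 1),
    Function.iterate_succ_apply', ← iterList_update_mem hD i _ (List.nodup_finRange e)
      (List.mem_finRange i), Function.update_eq_self]

theorem iterD_eq_iterList (α : Fin e → Fin p) (x : R) :
    iterD D α x = iterList D (List.finRange e) (fun i => (α i : ℕ)) x := rfl

theorem D_iterD (hD : ∀ i j x, D i (D j x) = D j (D i x)) (i : Fin e) (α : Fin e → Fin p)
    (h : (α i : ℕ) + 1 < p) (x : R) :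
    D i (iterD D α x) = iterD D (Function.update α i ⟨(α i : ℕ) + 1, h⟩) x := by
  rw [iterD_eq_iterList, D_iterList hD, iterD_eq_iterList]
  congr 1
  funext j
  rcases eq_or_ne j i with rfl | hj
  · simp
  · simp [Function.update_of_ne hj]

theorem D_iterD_of_le [Zero R] (hD : ∀ i j x, D i (D j x) = D j (D i x))
    (hp : ∀ i x, (D i)^[p] x = 0) (i : Fin e) (α : Fin e → Fin p)
    (h : ¬ (α i : ℕ) + 1 < p) (x : R) : D i (iterD D α x) = 0 := by
  have h' : (α i : ℕ) + 1 = p := by have := (α i).2; omega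
  rw [iterD_eq_iterList, D_iterList hD, iterList_update_mem hD i _ (List.nodup_finRange e)
    (List.mem_finRange i), h', hp]

theorem iterList_zero (l : List (Fin e)) (n : Fin e → ℕ) (hn : ∀ i, n i = 0) (x : R) :
    iterList D l n x = x := by
  induction l with
  | nil => rfl
  | cons j l ih =>
    change (D j)^[n j] (iterList D l n x) = x
    rw [ih, hn]; rfl

theorem iterD_zero (α : Fin e → Fin p) (hα : ∀ i, (α i : ℕ) = 0) (x : R) : iterD D α x = x :=
  iterList_zero _ _ hα _

end Iter

namespace GRing

variable {p e : ℕ} {G : Type u} [Group G] {R : Type*} [CommRing R] {R' : Type*} [CommRing R']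
  {R'' : Type*} [CommRing R'']

/-- A homomorphism of `𝔤`-rings. -/
structure IsHom (S : GRing p e G R) (T : GRing p e G R') (φ : R →+* R') : Prop where
  D : ∀ i x, φ (S.D i x) = T.D i (φ x)
  σ : ∀ g x, φ (S.σ g x) = T.σ g (φ x)

theorem IsHom.comp {S : GRing p e G R} {T : GRing p e G R'} {U : GRing p e G R''} {ψ : R' →+* R''}
    {φ : R →+* R'} (hψ : IsHom T U ψ) (hφ : IsHom S T φ) : IsHom S U (ψ.comp φ) where
  D i x := by simp [hφ.D, hψ.D]
  σ i x := by simp [hφ.σ, hψ.σ]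

theorem IsHom.id (S : GRing p e G R) : IsHom S S (RingHom.id R) := ⟨fun _ _ => rfl, fun _ _ => rfl⟩

/-- The operator `∂_θ`. -/
def op (S : GRing p e G R) (θ : Idx p e G) (x : R) : R := iterD (fun i => S.D i) θ.1 (S.σ θ.2 x)

theorem IsHom.op {S : GRing p e G R} {T : GRing p e G R'} {φ : R →+* R'} (h : IsHom S T φ)
    (θ : Idx p e G) (x : R) : φ (S.op θ x) = T.op θ (φ x) := by
  unfold GRing.op
  rw [← h.σ, iterD_map (D' := fun i => T.D i) (φ := φ) h.D]

/-- The constants: the elements which are killed by the `D_i` and fixed by `G`. -/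
def IsConst (S : GRing p e G R) (x : R) : Prop := (∀ i, S.D i x = 0) ∧ ∀ g, S.σ g x = x

theorem IsHom.isConst {S : GRing p e G R} {T : GRing p e G R'} {φ : R →+* R'} (h : IsHom S T φ)
    {x : R} (hx : S.IsConst x) : T.IsConst (φ x) :=
  ⟨fun i => by rw [← h.D, hx.1, map_zero], fun g => by rw [← h.σ, hx.2]⟩

/-- The subring of constants. -/
def constants (S : GRing p e G R) : Subring R where
  carrier := {x | S.IsConst x}
  mul_mem' := fun {x y} hx hy =>
    ⟨fun i => by simp [Derivation.leibniz, hx.1, hy.1], fun g => by simp [hx.2, hy.2]⟩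
  one_mem' := ⟨fun i => by simp, fun g => by simp⟩
  add_mem' := fun {x y} hx hy => ⟨fun i => by simp [hx.1, hy.1], fun g => by simp [hx.2, hy.2]⟩
  zero_mem' := ⟨fun i => by simp, fun g => by simp⟩
  neg_mem' := fun {x} hx => ⟨fun i => by simp [hx.1], fun g => by simp [hx.2]⟩

theorem mem_constants {S : GRing p e G R} {x : R} : x ∈ S.constants ↔ S.IsConst x := Iff.rfl

theorem D_op (S : GRing p e G R) (i : Fin e) (α : Fin e → Fin p) (g : G) (x : R) :
    S.D i (S.op (α, g) x) =
      if h : (α i : ℕ) + 1 < p then S.op (Function.update α i ⟨(α i : ℕ) + 1, h⟩, g) x else 0 := by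
  split_ifs with h
  · exact D_iterD (D := fun i => S.D i) S.D_comm i α h _
  · exact D_iterD_of_le (D := fun i => S.D i) S.D_comm S.D_pow i α h _

theorem σ_op (S : GRing p e G R) (g : G) (α : Fin e → Fin p) (h : G) (x : R) :
    S.σ g (S.op (α, h) x) = S.op (α, g * h) x := by
  unfold op
  rw [iterD_map (D := fun i => S.D i) (D' := fun i => S.D i) (φ := S.σ g) (S.σ_D g), S.σ_mul]

theorem op_one [NeZero p] (S : GRing p e G R) (x : R) : S.op (fun _ => 0, 1) x = x := by
  unfold op
  rw [iterD_zero _ (by simp), S.σ_one]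

/-- The condition `D^p = 0` may be checked on generators. -/
theorem iterate_eq_zero_closure [Fact p.Prime] [CharP R p] (D : Derivation ℤ R R) {s : Set R}
    (hs : ∀ x ∈ s, D^[p] x = 0) {x : R} (hx : x ∈ Subring.closure s) : D^[p] x = 0 := by
  have hp : p ≠ 0 := (Fact.out : p.Prime).ne_zero
  have h1 : D^[p] 1 = 0 := by
    obtain ⟨k, rfl⟩ := Nat.exists_eq_succ_of_ne_zero hp
    simp [Function.iterate_succ_apply, Function.iterate_fixed]
  induction hx using Subring.closure_induction with
  | mem x hx => exact hs x hx
  | zero => exact Function.iterate_fixed (map_zero D) p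
  | one => exact h1
  | add x y _ _ hx hy => rw [iterate_map_add, hx, hy, add_zero]
  | neg x _ hx =>
    have := iterate_map_add D p x (-x)
    rw [add_neg_cancel, Function.iterate_fixed (map_zero D) p, hx, zero_add] at this
    exact this.symm
  | mul x y _ _ hx hy => rw [iterate_leibniz_charP, hx, hy]; simp

end GRing

/-- The `𝔤`-field structure given by a `𝔤`-ring structure on a field of characteristic `p`. -/
def GRing.toGField {p e : ℕ} {G : Type u} [Group G] {K : Type w} [Field K] (hp : CharP K p)
    (S : GRing p e G K) : GFieldStructure p e G K where
  charP := hp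
  D := S.D
  σ :=
    { toFun g := RingEquiv.ofRingHom (S.σ g) (S.σ g⁻¹)
        (by ext x; simp [← S.σ_mul, S.σ_one]) (by ext x; simp [← S.σ_mul, S.σ_one])
      map_one' := by ext x; simp [S.σ_one]
      map_mul' g h := by ext x; simp [S.σ_mul] }
  D_comm := S.D_comm
  D_pow := S.D_pow
  σ_D := S.σ_D

end FiniteGroupSchemeDCF

namespace FiniteGroupSchemeDCF

/-! ### Polynomial rings, quotients, fraction fields and products of `𝔤`-rings -/

/-- The additive derivation given by an additive map satisfying the Leibniz rule. -/
def mkDer {R : Type*} [CommRing R] (f : R →+ R) (h : ∀ x y, f (x * y) = x * f y + y * f x) :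
    Derivation ℤ R R :=
  Derivation.mk' f.toIntLinearMap h

@[simp]
theorem mkDer_apply {R : Type*} [CommRing R] (f : R →+ R) (h) (x : R) : mkDer f h x = f x := rfl

section Coef

variable {k τ : Type*} [CommRing k]

open MvPolynomial in
theorem coeff_sum_support (d : k →+ k) (f : MvPolynomial τ k) (m : τ →₀ ℕ) :
    coeff m (∑ m ∈ f.support, monomial m (d (f.coeff m))) = d (coeff m f) := by
  classical
  rw [coeff_sum]
  simp only [coeff_monomial]
  rw [Finset.sum_ite_eq' f.support m]
  split_ifs with h
  · rfl
  · rw [notMem_support_iff.1 h, map_zero]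

open MvPolynomial in
/-- The map of a polynomial ring which applies an additive map to the coefficients. -/
noncomputable def coefMap (d : k →+ k) : MvPolynomial τ k →+ MvPolynomial τ k where
  toFun f := ∑ m ∈ f.support, monomial m (d (f.coeff m))
  map_zero' := by simp
  map_add' f g := by
    ext m
    rw [coeff_add, coeff_sum_support, coeff_sum_support, coeff_sum_support, coeff_add, map_add]

open MvPolynomial in
theorem coeff_coefMap (d : k →+ k) (f : MvPolynomial τ k) (m : τ →₀ ℕ) :
    coeff m (coefMap d f) = d (coeff m f) :=
  coeff_sum_support d f m

open MvPolynomial in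
/-- The derivation of a polynomial ring which applies a derivation to the coefficients. -/
noncomputable def coefDer {k : Type*} [CommRing k] (d : Derivation ℤ k k) :=
  mkDer (R := MvPolynomial τ k) (coefMap (d : k →+ k)) (fun f g => by
      classical
      ext m
      rw [coeff_coefMap, coeff_add, coeff_mul, mul_comm g, coeff_mul, coeff_mul, map_sum,
        ← Finset.sum_add_distrib]
      refine Finset.sum_congr rfl fun ij _ => ?_
      rw [coeff_coefMap, coeff_coefMap, AddMonoidHom.coe_coe, Derivation.leibniz, smul_eq_mul,
        smul_eq_mul]
      ring)

open MvPolynomial in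
theorem coeff_coefDer (d : Derivation ℤ k k) (f : MvPolynomial τ k) (m : τ →₀ ℕ) :
    coeff m (coefDer d f) = d (coeff m f) :=
  coeff_sum_support (d : k →+ k) f m

open MvPolynomial in
@[simp]
theorem coefDer_C (d : Derivation ℤ k k) (a : k) :
    coefDer d (C a : MvPolynomial τ k) = C (d a) := by
  classical
  ext m
  rw [coeff_coefDer, coeff_C, coeff_C]
  split_ifs <;> simp

open MvPolynomial in
@[simp]
theorem coefDer_X (d : Derivation ℤ k k) (t : τ) : coefDer d (X t : MvPolynomial τ k) = 0 := by
  classical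
  ext m
  rw [coeff_coefDer, coeff_X, coeff_zero]
  split_ifs <;> simp

open MvPolynomial in
theorem closure_C_X : Subring.closure
    (Set.range (C : k → MvPolynomial τ k) ∪ Set.range X) = ⊤ := by
  rw [eq_top_iff]
  intro f _
  induction f using MvPolynomial.induction_on with
  | C a => exact Subring.subset_closure (Or.inl ⟨a, rfl⟩)
  | add f g hf hg => exact add_mem (hf trivial) (hg trivial)
  | mul_X f t hf => exact mul_mem (hf trivial) (Subring.subset_closure (Or.inr ⟨t, rfl⟩))

end Coef

namespace GRing

variable {p e : ℕ} {G : Type u} [Group G]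

section Poly

variable {k τ : Type*} [CommRing k]

open MvPolynomial

/-- The derivation extending `D_i` with prescribed values on the variables. -/
noncomputable def mvD (S : GRing p e G k) (v : Fin e → τ → MvPolynomial τ k) (i : Fin e) :=
  mkDer (R := MvPolynomial τ k)
    (AddMonoidHom.mk' (fun f => coefDer (τ := τ) (S.D i) f + mkDerivation k (v i) f)
      (fun f g => by rw [map_add, map_add, add_add_add_comm]))
    (fun f g => by
      simp only [AddMonoidHom.mk'_apply, Derivation.leibniz, smul_eq_mul]
      ring)

theorem mvD_apply (S : GRing p e G k) (v : Fin e → τ → MvPolynomial τ k) (i : Fin e)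
    (f : MvPolynomial τ k) : S.mvD v i f = coefDer (S.D i) f + mkDerivation k (v i) f := rfl

/-- The ring endomorphism extending `σ_g` with a prescribed action on the variables. -/
noncomputable def mvσ (S : GRing p e G k) (w : G → τ → τ) (g : G) :
    MvPolynomial τ k →+* MvPolynomial τ k :=
  eval₂Hom (C.comp (S.σ g)) (fun t => X (w g t))

variable (S : GRing p e G k) (v : Fin e → τ → MvPolynomial τ k) (w : G → τ → τ)

@[simp] theorem mvD_C (i : Fin e) (a : k) : S.mvD v i (C a) = C (S.D i a) := by
  simp [mvD_apply]

@[simp] theorem mvD_X (i : Fin e) (t : τ) : S.mvD v i (X t) = v i t := by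
  simp [mvD_apply, mkDerivation_X]

@[simp] theorem mvσ_C (g : G) (a : k) : S.mvσ w g (C a) = C (S.σ g a) := by simp [mvσ]

@[simp] theorem mvσ_X (g : G) (t : τ) : S.mvσ w g (X t) = X (w g t) := by simp [mvσ]

/-- The `𝔤`-structure on a polynomial ring given by a `𝔤`-structure on the coefficients and
prescribed values on the variables. -/
noncomputable def mvPoly [Fact p.Prime] [CharP k p]
    (w_one : ∀ t, w 1 t = t) (w_mul : ∀ g h t, w (g * h) t = w g (w h t))
    (hcomm : ∀ i j t, S.mvD v i (v j t) = S.mvD v j (v i t))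
    (hpow : ∀ i t, (S.mvD v i)^[p] (X t) = 0)
    (hσ : ∀ g i t, S.mvσ w g (v i t) = v i (w g t)) : GRing p e G (MvPolynomial τ k) where
  D := S.mvD v
  σ := S.mvσ w
  σ_one f := by
    have : S.mvσ w 1 = RingHom.id _ := by
      apply MvPolynomial.ringHom_ext <;> simp [S.σ_one, w_one]
    rw [this]; rfl
  σ_mul g h f := by
    have : S.mvσ w (g * h) = (S.mvσ w g).comp (S.mvσ w h) := by
      apply MvPolynomial.ringHom_ext <;> simp [S.σ_mul, w_mul]
    rw [this]; rfl
  D_comm i j f := by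
    induction f using MvPolynomial.induction_on with
    | C a => simp [S.D_comm i j]
    | add f g hf hg => simp [hf, hg]
    | mul_X f t hf =>
      simp only [Derivation.leibniz, smul_eq_mul, map_add, mvD_X, hf, hcomm i j]
      ring
  D_pow i f := by
    have hf : f ∈ Subring.closure (Set.range (C : k → MvPolynomial τ k) ∪ Set.range X) := by
      rw [closure_C_X]; trivial
    refine iterate_eq_zero_closure _ ?_ hf
    rintro _ (⟨a, rfl⟩ | ⟨t, rfl⟩)
    · have h : ∀ n, (S.mvD v i)^[n] (C a) = C ((S.D i)^[n] a) := fun n => by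
        induction n generalizing a with
        | zero => rfl
        | succ n ih => simp only [Function.iterate_succ_apply, mvD_C, ih]
      rw [h, S.D_pow, map_zero]
    · exact hpow i t
  σ_D g i f := by
    induction f using MvPolynomial.induction_on with
    | C a => simp [S.σ_D]
    | add f h hf hh => simp [hf, hh]
    | mul_X f t hf => simp [Derivation.leibniz, hf, hσ]

/-- Evaluation homomorphisms on a polynomial `𝔤`-ring. -/
theorem mvPoly_eval₂ [Fact p.Prime] [CharP k p] {w_one w_mul hcomm hpow hσ}
    {R : Type*} [CommRing R] {T : GRing p e G R} {φ : k →+* R} (hφ : IsHom S T φ) (x : τ → R)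
    (hD : ∀ i t, eval₂Hom φ x (v i t) = T.D i (x t)) (hx : ∀ g t, x (w g t) = T.σ g (x t)) :
    IsHom (S.mvPoly v w w_one w_mul hcomm hpow hσ) T (eval₂Hom φ x) where
  D i f := by
    change eval₂Hom φ x (S.mvD v i f) = _
    induction f using MvPolynomial.induction_on with
    | C a => simp [hφ.D]
    | add f g hf hg => simp only [map_add, hf, hg]
    | mul_X f t hf =>
      simp only [Derivation.leibniz, smul_eq_mul, map_add, map_mul, mvD_X, hf, hD]
      simp
  σ g f := by
    change eval₂Hom φ x (S.mvσ w g f) = _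
    induction f using MvPolynomial.induction_on with
    | C a => simp [hφ.σ]
    | add f g hf hg => simp only [map_add, hf, hg]
    | mul_X f t hf =>
      simp only [map_mul, hf, mvσ_X, eval₂Hom_X', hx]

theorem mvPoly_C [Fact p.Prime] [CharP k p] {w_one w_mul hcomm hpow hσ} :
    IsHom S (S.mvPoly v w w_one w_mul hcomm hpow hσ) C :=
  ⟨fun i x => (mvD_C S v i x).symm, fun g x => (mvσ_C S w g x).symm⟩

/-- There is a unique extension of a `𝔤`-structure to a polynomial ring with prescribed
values on the variables. -/
theorem exists_mvPoly [Fact p.Prime] [CharP k p]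
    (w_one : ∀ t, w 1 t = t) (w_mul : ∀ g h t, w (g * h) t = w g (w h t))
    (hcomm : ∀ i j t, S.mvD v i (v j t) = S.mvD v j (v i t))
    (hpow : ∀ i t, (S.mvD v i)^[p] (X t) = 0)
    (hσ : ∀ g i t, S.mvσ w g (v i t) = v i (w g t)) :
    ∃ T : GRing p e G (MvPolynomial τ k), IsHom S T C ∧ (∀ i t, T.D i (X t) = v i t) ∧
      ∀ g t, T.σ g (X t) = X (w g t) :=
  ⟨S.mvPoly v w w_one w_mul hcomm hpow hσ, mvPoly_C S v w, mvD_X S v, mvσ_X S w⟩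

/-- The polynomial `𝔤`-ring whose variables are constants. -/
theorem exists_constPoly [Fact p.Prime] [CharP k p] (τ : Type*) :
    ∃ T : GRing p e G (MvPolynomial τ k), IsHom S T C ∧ ∀ t, T.IsConst (X t) := by
  obtain ⟨T, hT, hD, hσ⟩ := S.exists_mvPoly (fun _ (_ : τ) => 0) (fun _ t => t) (by simp) (by simp)
    (by simp)
    (fun i t => by
      have h : ∀ n, n ≠ 0 → (S.mvD (fun _ _ => 0) i)^[n] (X t) = 0 := fun n hn => by
        obtain ⟨n, rfl⟩ := Nat.exists_eq_succ_of_ne_zero hn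
        rw [Function.iterate_succ_apply, mvD_X, Function.iterate_fixed (map_zero _)]
      exact h p (Fact.out : p.Prime).ne_zero)
    (by simp)
  exact ⟨T, hT, fun t => ⟨fun i => hD i t, fun g => hσ g t⟩⟩

/-- A polynomial in constants with constant coefficients is a constant. -/
theorem IsHom.isConst_eval₂ {S : GRing p e G k} {R : Type*} [CommRing R] {T : GRing p e G R}
    {φ : k →+* R} (hφ : IsHom S T φ) {x : τ → R} (hx : ∀ t, T.IsConst (x t)) {f : MvPolynomial τ k}
    (hf : ∀ s, S.IsConst (coeff s f)) : T.IsConst (eval₂Hom φ x f) := by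
  rw [f.as_sum, ← mem_constants, map_sum]
  refine sum_mem fun s _ => ?_
  rw [eval₂Hom_monomial]
  exact mul_mem (hφ.isConst (hf s)) (prod_mem fun t _ => pow_mem (hx t) _)

/-- Evaluation at constants is a homomorphism of `𝔤`-rings. -/
theorem IsHom.eval₂ {S : GRing p e G k} {T₀ : GRing p e G (MvPolynomial τ k)}
    (hT₀ : IsHom S T₀ C) (hX : ∀ t, T₀.IsConst (X t)) {R : Type*} [CommRing R] {T : GRing p e G R}
    {φ : k →+* R} (hφ : IsHom S T φ) {x : τ → R} (hx : ∀ t, T.IsConst (x t)) :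
    IsHom T₀ T (eval₂Hom φ x) where
  D i f := by
    induction f using MvPolynomial.induction_on with
    | C a => rw [← hT₀.D, eval₂Hom_C, eval₂Hom_C, hφ.D]
    | add f g hf hg => simp only [map_add, hf, hg]
    | mul_X f t hf =>
      simp only [Derivation.leibniz, smul_eq_mul, map_add, map_mul, (hX t).1, hf, eval₂Hom_X',
        (hx t).1, map_zero]
  σ g f := by
    induction f using MvPolynomial.induction_on with
    | C a => rw [← hT₀.σ, eval₂Hom_C, eval₂Hom_C, hφ.σ]
    | add f g hf hg => simp only [map_add, hf, hg]
    | mul_X f t hf =>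
      simp only [map_mul, hf, eval₂Hom_X', (hX t).2, (hx t).2]

end Poly

section Surj

variable {R : Type*} [CommRing R] {R' : Type*} [CommRing R']

/-- The image of a `𝔤`-structure under a surjective ring homomorphism with stable kernel. -/
noncomputable def ofSurjective (S : GRing p e G R) (π : R →+* R') (hπ : Function.Surjective π)
    (hD : ∀ i x, π x = 0 → π (S.D i x) = 0) (hσ : ∀ g x, π x = 0 → π (S.σ g x) = 0) :
    GRing p e G R' :=
  -- Stability of the kernel makes the induced operators independent of the preimages chosen by
  -- `surjInv`.
  have hD' : ∀ i x y, π x = π y → π (S.D i x) = π (S.D i y) := fun i x y h => by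
    rw [← sub_eq_zero, ← map_sub, ← map_sub]
    exact hD i _ (by rw [map_sub, h, sub_self])
  have hσ' : ∀ g x y, π x = π y → π (S.σ g x) = π (S.σ g y) := fun i x y h => by
    rw [← sub_eq_zero, ← map_sub, ← map_sub]
    exact hσ i _ (by rw [map_sub, h, sub_self])
  have hDs : ∀ i x, π (S.D i (Function.surjInv hπ (π x))) = π (S.D i x) := fun i x =>
    hD' i _ _ (Function.surjInv_eq hπ _)
  have hσs : ∀ g x, π (S.σ g (Function.surjInv hπ (π x))) = π (S.σ g x) := fun i x =>
    hσ' i _ _ (Function.surjInv_eq hπ _)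
  let D : Fin e → Derivation ℤ R' R' := fun i => Derivation.mk'
    ({ toFun := fun x => π (S.D i (Function.surjInv hπ x))
       map_zero' := by rw [← map_zero π, hDs, map_zero]
       map_add' := fun x y => by
        obtain ⟨x, rfl⟩ := hπ x
        obtain ⟨y, rfl⟩ := hπ y
        rw [← map_add, hDs, hDs, hDs, map_add, map_add] } : R' →+ R').toIntLinearMap
    (fun x y => by
        obtain ⟨x, rfl⟩ := hπ x
        obtain ⟨y, rfl⟩ := hπ y
        simp only [AddMonoidHom.coe_toIntLinearMap, AddMonoidHom.coe_mk, ZeroHom.coe_mk]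
        rw [← map_mul, hDs, hDs, hDs, Derivation.leibniz]
        simp)
  have hDπ : ∀ i x, D i (π x) = π (S.D i x) := hDs
  { D := D
    σ := fun g =>
      { toFun := fun x => π (S.σ g (Function.surjInv hπ x))
        map_zero' := by rw [← map_zero π, hσs, map_zero]
        map_one' := by rw [← map_one π, hσs, map_one]
        map_add' := fun x y => by
          obtain ⟨x, rfl⟩ := hπ x
          obtain ⟨y, rfl⟩ := hπ y
          rw [← map_add, hσs, hσs, hσs, map_add, map_add]
        map_mul' := fun x y => by
          obtain ⟨x, rfl⟩ := hπ x
          obtain ⟨y, rfl⟩ := hπ y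
          rw [← map_mul, hσs, hσs, hσs, map_mul, map_mul] }
    σ_one := fun x => by
      obtain ⟨x, rfl⟩ := hπ x
      exact (hσs 1 x).trans (by rw [S.σ_one])
    σ_mul := fun g h x => by
      obtain ⟨x, rfl⟩ := hπ x
      change π _ = π (S.σ g (Function.surjInv hπ (π (S.σ h _))))
      rw [hσs, hσs, S.σ_mul]
      exact (hσ' g _ _ (hσs h x)).symm
    D_comm := fun i j x => by
      obtain ⟨x, rfl⟩ := hπ x
      rw [hDπ, hDπ, hDπ, hDπ, S.D_comm]
    D_pow := fun i x => by
      obtain ⟨x, rfl⟩ := hπ x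
      have h : ∀ n x, (D i)^[n] (π x) = π ((S.D i)^[n] x) := fun n x => by
        induction n generalizing x with
        | zero => rfl
        | succ n ih => rw [Function.iterate_succ_apply, hDπ, ih, Function.iterate_succ_apply]
      rw [h, S.D_pow, map_zero]
    σ_D := fun g i x => by
      obtain ⟨x, rfl⟩ := hπ x
      change π (S.σ g (Function.surjInv hπ _)) = D i (π (S.σ g (Function.surjInv hπ _)))
      rw [hDπ, hDπ, hσs, S.σ_D]
      exact hD' i _ _ (hσs g x).symm }

theorem ofSurjective_isHom (S : GRing p e G R) (π : R →+* R') (hπ : Function.Surjective π)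
    (hD : ∀ i x, π x = 0 → π (S.D i x) = 0) (hσ : ∀ g x, π x = 0 → π (S.σ g x) = 0) :
    IsHom S (S.ofSurjective π hπ hD hσ) π where
  D i x := by
    change _ = π _
    rw [← sub_eq_zero, ← map_sub, ← map_sub]
    exact hD i _ (by rw [map_sub, Function.surjInv_eq hπ, sub_self])
  σ g x := by
    change _ = π _
    rw [← sub_eq_zero, ← map_sub, ← map_sub]
    exact hσ g _ (by rw [map_sub, Function.surjInv_eq hπ, sub_self])

/-- The quotient of a `𝔤`-ring by a stable ideal. -/
noncomputable def quotient (S : GRing p e G R) (I : Ideal R) (hD : ∀ i, ∀ x ∈ I, S.D i x ∈ I)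
    (hσ : ∀ g, ∀ x ∈ I, S.σ g x ∈ I) : GRing p e G (R ⧸ I) :=
  S.ofSurjective (Ideal.Quotient.mk I) Ideal.Quotient.mk_surjective
    (fun i x hx => Ideal.Quotient.eq_zero_iff_mem.2 (hD i x (Ideal.Quotient.eq_zero_iff_mem.1 hx)))
    (fun i x hx => Ideal.Quotient.eq_zero_iff_mem.2 (hσ i x (Ideal.Quotient.eq_zero_iff_mem.1 hx)))

theorem quotient_isHom (S : GRing p e G R) (I : Ideal R) (hD : ∀ i, ∀ x ∈ I, S.D i x ∈ I)
    (hσ : ∀ g, ∀ x ∈ I, S.σ g x ∈ I) : IsHom S (S.quotient I hD hσ) (Ideal.Quotient.mk I) :=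
  ofSurjective_isHom ..

end Surj

section Frac

variable [Fact p.Prime] {R : Type*} [CommRing R] [IsDomain R] [CharP R p]
  (F : Type*) [Field F] [Algebra R F] [IsFractionRing R F]

/-- Write a/b as a b^(p-1) / b^p: p-th powers are killed by every derivation. With such denominators
the D_i extend by acting on numerators only, so iterates, and hence D_i^p = 0, pass to fractions
without the quotient rule. -/
theorem exists_const_den (S : GRing p e G R) (x : F) :
    ∃ ac : R × R, ac.2 ≠ 0 ∧ (∀ i, S.D i ac.2 = 0) ∧ x = algebraMap R F ac.1 / algebraMap R F ac.2 := by
  obtain ⟨a, b, hb, rfl⟩ := IsFractionRing.div_surjective (A := R) x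
  have hb0 := nonZeroDivisors.ne_zero hb
  have hp : p ≠ 0 := (Fact.out : p.Prime).ne_zero
  refine ⟨(a * b ^ (p - 1), b ^ p), pow_ne_zero _ hb0, fun i => derivation_pow_charP p _ _, ?_⟩
  have h : algebraMap R F b ≠ 0 := by simpa using hb0
  have hbp : b ^ p = b ^ (p - 1) * b := by rw [← pow_succ, Nat.sub_add_cancel (by omega)]
  rw [hbp, map_mul, map_mul, map_pow]
  field_simp

/-- The numerator and the denominator of a fraction with constant denominator. -/
noncomputable def numDen (S : GRing p e G R) (x : F) : R × R := (exists_const_den F S x).choose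

theorem numDen_spec (S : GRing p e G R) (x : F) :
    (numDen F S x).2 ≠ 0 ∧ (∀ i, S.D i (numDen F S x).2 = 0) ∧
      x = algebraMap R F (numDen F S x).1 / algebraMap R F (numDen F S x).2 :=
  (exists_const_den F S x).choose_spec

/-- The value of the extension of `D_i` to the fraction field. -/
noncomputable def fracD (S : GRing p e G R) (i : Fin e) (x : F) : F :=
  algebraMap R F (S.D i (numDen F S x).1) / algebraMap R F (numDen F S x).2

/-- Independence of the representation: cross-multiply two fractions and apply D_i; the denominators
behave like scalars. -/
theorem fracD_div (S : GRing p e G R) (i : Fin e) (a c : R) (hc : c ≠ 0) (hDc : ∀ i, S.D i c = 0) :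
    fracD F S i (algebraMap R F a / algebraMap R F c) =
      algebraMap R F (S.D i a) / algebraMap R F c := by
  obtain ⟨h1, h2, h3⟩ := numDen_spec F S (algebraMap R F a / algebraMap R F c)
  unfold fracD
  generalize numDen F S (algebraMap R F a / algebraMap R F c) = ac at *
  have hc' : algebraMap R F c ≠ 0 := by simpa using hc
  have h1' : algebraMap R F ac.2 ≠ 0 := by simpa using h1
  rw [div_eq_div_iff hc' h1', ← map_mul, ← map_mul] at h3
  rw [div_eq_div_iff h1' hc', ← map_mul, ← map_mul]
  have h4 := IsFractionRing.injective R F h3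
  have h5 := congrArg (S.D i) h4
  simp only [Derivation.leibniz, h2, hDc, smul_eq_mul, mul_zero, zero_add] at h5
  congr 1
  linear_combination -h5

omit [Fact p.Prime] [IsDomain R] [CharP R p] in
theorem σ_injective (S : GRing p e G R) (g : G) : Function.Injective (S.σ g) := fun x y h => by
  rw [← S.σ_one x, ← S.σ_one y, ← inv_mul_cancel g, S.σ_mul, S.σ_mul, h]

omit [Fact p.Prime] [IsDomain R] [CharP R p] in
theorem algebraMap_σ_injective (S : GRing p e G R) (g : G) :
    Function.Injective ((algebraMap R F).comp (S.σ g)) :=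
  (IsFractionRing.injective R F).comp (S.σ_injective g)

/-- The extension of a `𝔤`-structure to the fraction field. -/
noncomputable def frac (S : GRing p e G R) : GRing p e G F :=
  have hinj := S.algebraMap_σ_injective F
  have hσ0 : ∀ g a, a ≠ 0 → S.σ g a ≠ 0 := fun g a ha h0 => ha (hinj g (by simp [h0]))
  have hσdiv : ∀ g a c, IsFractionRing.lift (hinj g) (algebraMap R F a / algebraMap R F c) =
      algebraMap R F (S.σ g a) / algebraMap R F (S.σ g c) := fun g a c => by
    rw [map_div₀, IsFractionRing.lift_algebraMap, IsFractionRing.lift_algebraMap]; rfl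
  have key : ∀ x : F, ∃ a c : R, c ≠ 0 ∧ (∀ i, S.D i c = 0) ∧
      x = algebraMap R F a / algebraMap R F c := fun x =>
    ⟨_, _, numDen_spec F S x⟩
  have hne : ∀ c : R, c ≠ 0 → algebraMap R F c ≠ 0 := fun c hc => by simpa using hc
  let D : Fin e → Derivation ℤ F F := fun i => Derivation.mk'
    ({ toFun := fracD F S i
       map_zero' := by
        have := fracD_div F S i 0 1 one_ne_zero (by simp)
        simpa using this
       map_add' := fun x y => by
        obtain ⟨a, c, hc, hDc, rfl⟩ := key x
        obtain ⟨a', c', hc', hDc', rfl⟩ := key y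
        rw [div_add_div _ _ (hne c hc) (hne c' hc'), ← map_mul, ← map_mul, ← map_mul, ← map_add,
          fracD_div F S i _ _ (mul_ne_zero hc hc') (by simp [Derivation.leibniz, hDc, hDc']),
          fracD_div F S i _ _ hc hDc, fracD_div F S i _ _ hc' hDc',
          div_add_div _ _ (hne c hc) (hne c' hc'), ← map_mul, ← map_mul, ← map_mul, ← map_add]
        congr 2
        simp only [map_add, Derivation.leibniz, hDc, hDc', smul_eq_mul]
        ring } : F →+ F).toIntLinearMap
    (fun x y => by
        simp only [AddMonoidHom.coe_toIntLinearMap, AddMonoidHom.coe_mk, ZeroHom.coe_mk]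
        obtain ⟨a, c, hc, hDc, rfl⟩ := key x
        obtain ⟨a', c', hc', hDc', rfl⟩ := key y
        rw [div_mul_div_comm, ← map_mul, ← map_mul,
          fracD_div F S i _ _ (mul_ne_zero hc hc') (by simp [Derivation.leibniz, hDc, hDc']),
          fracD_div F S i _ _ hc hDc, fracD_div F S i _ _ hc' hDc']
        have h1 := hne c hc
        have h2 := hne c' hc'
        simp only [Derivation.leibniz, smul_eq_mul, map_add, map_mul]
        field_simp)
  have hD : ∀ i a c, c ≠ 0 → (∀ i, S.D i c = 0) → D i (algebraMap R F a / algebraMap R F c) =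
      algebraMap R F (S.D i a) / algebraMap R F c := fracD_div F S
  { D := D
    σ := fun g => IsFractionRing.lift (hinj g)
    σ_one := fun x => by
      obtain ⟨a, c, hc, hDc, rfl⟩ := key x
      rw [hσdiv, S.σ_one, S.σ_one]
    σ_mul := fun g h x => by
      obtain ⟨a, c, hc, hDc, rfl⟩ := key x
      rw [hσdiv, hσdiv, hσdiv, S.σ_mul, S.σ_mul]
    D_comm := fun i j x => by
      obtain ⟨a, c, hc, hDc, rfl⟩ := key x
      rw [hD i _ _ hc hDc, hD j _ _ hc hDc, hD i _ _ hc hDc, hD j _ _ hc hDc, S.D_comm]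
    D_pow := fun i x => by
      obtain ⟨a, c, hc, hDc, rfl⟩ := key x
      have h : ∀ n a, (D i)^[n] (algebraMap R F a / algebraMap R F c) =
          algebraMap R F ((S.D i)^[n] a) / algebraMap R F c := fun n a => by
        induction n generalizing a with
        | zero => rfl
        | succ n ih =>
          rw [Function.iterate_succ_apply, hD i _ _ hc hDc, ih, Function.iterate_succ_apply]
      rw [h, S.D_pow, map_zero, zero_div]
    σ_D := fun g i x => by
      obtain ⟨a, c, hc, hDc, rfl⟩ := key x
      rw [hD i _ _ hc hDc, hσdiv, hσdiv, S.σ_D, hD i _ _ (hσ0 g c hc)]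
      intro j
      rw [← S.σ_D, hDc, map_zero] }

theorem frac_isHom (S : GRing p e G R) : IsHom S (S.frac F) (algebraMap R F) where
  D i x := by
    have := fracD_div F S i x 1 one_ne_zero (by simp)
    simp only [map_one, div_one] at this
    exact this.symm
  σ g x := by
    symm
    exact IsFractionRing.lift_algebraMap (S.algebraMap_σ_injective F g) x

end Frac

section Pi

variable {ι : Type*} {R : ι → Type*} [∀ s, CommRing (R s)]

/-- The product of `𝔤`-rings. -/
def pi (S : ∀ s, GRing p e G (R s)) : GRing p e G (∀ s, R s) where
  D i := Derivation.mk'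
    ({ toFun := fun x s => (S s).D i (x s)
       map_zero' := by ext; simp
       map_add' := fun x y => by ext; simp } : (∀ s, R s) →+ (∀ s, R s)).toIntLinearMap
    (fun x y => by ext s; simp [Derivation.leibniz])
  σ g := RingHom.pi fun s => ((S s).σ g).comp (Pi.evalRingHom R s)
  σ_one x := by ext s; exact (S s).σ_one _
  σ_mul g h x := by ext s; exact (S s).σ_mul g h _
  D_comm i j x := by ext s; exact (S s).D_comm i j _
  D_pow i x := by
    ext s
    refine Eq.trans ?_ ((S s).D_pow i (x s))
    exact Function.Semiconj.iterate_right (f := fun x : ∀ s, R s => x s) (fun x => rfl) p x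
  σ_D g i x := by ext s; exact (S s).σ_D g i _

theorem pi_σ_apply (S : ∀ s, GRing p e G (R s)) (g : G) (x : ∀ s, R s) (s : ι) :
    (pi S).σ g x s = (S s).σ g (x s) := rfl

theorem pi_D_apply (S : ∀ s, GRing p e G (R s)) (i : Fin e) (x : ∀ s, R s) (s : ι) :
    (pi S).D i x s = (S s).D i (x s) := rfl

end Pi

end GRing

end FiniteGroupSchemeDCF

namespace FiniteGroupSchemeDCF

/-! ### Geometric axioms and points of `𝔤`-field extensions -/

open MvPolynomial GFieldStructure

variable {p e : ℕ} {G : Type u} [Group G]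

section PolyRing

variable {K : Type w} [Field K] {ι : Type*}

omit [Group G] in
theorem derVar_apply (i : Fin e) (j : ι) (α : Fin e → Fin p) (g : G) :
    derVar K i (j, (α, g)) =
      if h : (α i : ℕ) + 1 < p then
        X (j, (Function.update α i ⟨(α i : ℕ) + 1, h⟩, g))
      else 0 := rfl

/-- The action of `G` on the variables of `K{X}`. -/
def actVar (g : G) (v : ι × Idx p e G) : ι × Idx p e G := (v.1, (v.2.1, g * v.2.2))

variable (S : GRing p e G K)

/-- For n = p the condition always fails, which gives D_i^p = 0 on the variables; for smaller n it
identifies the variables with derivatives of the X_j. -/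
theorem mvD_derVar_iterate (i : Fin e) (j : ι) (α : Fin e → Fin p) (g : G) (n : ℕ) :
    (S.mvD (derVar K) i)^[n] (X (j, (α, g))) =
      if h : (α i : ℕ) + n < p then
        X (j, (Function.update α i ⟨(α i : ℕ) + n, h⟩, g))
      else 0 := by
  induction n with
  | zero => simp
  | succ n ih =>
    rw [Function.iterate_succ_apply', ih]
    by_cases h : (α i : ℕ) + n < p
    · rw [dif_pos h, GRing.mvD_X, derVar_apply]
      simp only [Function.update_self, Function.update_idem, add_assoc]
    · rw [dif_neg h, dif_neg (by omega), map_zero]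

variable [Fact p.Prime] [CharP K p]

/-- The `𝔤`-ring `K{X}`. -/
noncomputable def polyRing (ι : Type*) : GRing p e G (MvPolynomial (ι × Idx p e G) K) :=
  S.mvPoly (derVar K) actVar
    (fun t => by simp [actVar]) (fun g h t => by simp [actVar, mul_assoc])
    (fun i j ⟨k, (α, g)⟩ => by
      rcases eq_or_ne i j with rfl | hij
      · rfl
      rw [derVar_apply, derVar_apply]
      by_cases hi : (α i : ℕ) + 1 < p <;> by_cases hj : (α j : ℕ) + 1 < p
      · simp only [hi, hj, dif_pos, GRing.mvD_X]
        rw [derVar_apply, derVar_apply]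
        simp only [Function.update_of_ne hij, Function.update_of_ne hij.symm, hi, hj, dif_pos]
        rw [Function.update_comm hij]
      · simp only [hi, hj, dif_pos, dif_neg, not_false_iff, GRing.mvD_X, map_zero]
        rw [derVar_apply]
        simp only [Function.update_of_ne hij.symm, hj, dif_neg, not_false_iff]
      · simp only [hi, hj, dif_pos, dif_neg, not_false_iff, GRing.mvD_X, map_zero]
        rw [derVar_apply]
        simp only [Function.update_of_ne hij, hi, dif_neg, not_false_iff]
      · simp [hi, hj])
    (fun i ⟨j, (α, g)⟩ => by rw [mvD_derVar_iterate, dif_neg (by omega)])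
    (fun g i ⟨j, (α, h)⟩ => by
      change S.mvσ _ g (derVar K i (j, (α, h))) =
        derVar K i (j, (α, g * h))
      rw [derVar_apply, derVar_apply]
      split_ifs
      · rw [GRing.mvσ_X]; rfl
      · exact map_zero _)

/-- The universal property of K{X}: the elements ∂_θ r_j obey the same rules (`D_op`, `σ_op`) as
were imposed on the variables ∂_θ X_j. In particular the kernel of such an evaluation is a 𝔤-ideal.
-/
theorem polyRing_eval {R : Type*} [CommRing R] {T : GRing p e G R} {φ : K →+* R}
    (hφ : GRing.IsHom S T φ) (r : ι → R) :
    GRing.IsHom (polyRing S ι) T (eval₂Hom φ (fun v => T.op v.2 (r v.1))) :=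
  GRing.mvPoly_eval₂ S _ _ hφ _
    (fun i ⟨j, (α, g)⟩ => by
      rw [T.D_op, derVar_apply]
      split_ifs
      · exact eval₂_X ..
      · exact map_zero _)
    (fun g ⟨j, (α, h)⟩ => (T.σ_op g α h _).symm)

theorem polyRing_C : GRing.IsHom S (polyRing S ι) C := GRing.mvPoly_C S _ _

omit [Fact p.Prime] [CharP K p] in
open scoped Classical in
theorem comulPoly_X (j : ι) (α β : Fin e → Fin p) (g h : G) :
    comulPoly p e G K ι (X ((j, (α, g)), (β, h))) =
      if hlt : ∀ i, (α i : ℕ) + (β i : ℕ) < p then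
        X (j, (fun i => ⟨(α i : ℕ) + (β i : ℕ), hlt i⟩, h * g))
      else 0 := by
  rw [comulPoly, aeval_X]

/-- The addition of exponents in c matches the action of the operators on variables, including
truncation at p. Together with `comulPoly_rename`, this exhibits c as the homomorphism K{K{X}} →
K{X} which is the identity on the underlying polynomial ring. -/
theorem comulPoly_isHom :
    GRing.IsHom (polyRing S (ι × Idx p e G)) (polyRing S ι)
      (comulPoly p e G K ι : _ →+* MvPolynomial (ι × Idx p e G) K) := by
  classical
  refine GRing.mvPoly_eval₂ S _ _ (polyRing_C S) _ ?_ ?_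
  · rintro i ⟨⟨j, ⟨α, g⟩⟩, ⟨β, h⟩⟩
    change comulPoly p e G K ι _ = S.mvD _ i _
    dsimp only
    rw [derVar_apply]
    by_cases hβ : (β i : ℕ) + 1 < p
    · rw [dif_pos hβ, comulPoly_X]
      by_cases hi : ∀ k, (α k : ℕ) + (β k : ℕ) < p
      · rw [dif_pos hi, GRing.mvD_X, derVar_apply]
        by_cases hαβ : (α i : ℕ) + (β i : ℕ) + 1 < p
        · rw [dif_pos hαβ, dif_pos]
          · congr 3
            funext k
            rcases eq_or_ne k i with rfl | hk
            · simp [add_assoc]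
            · simp [Function.update_of_ne hk]
          · intro k
            rcases eq_or_ne k i with rfl | hk
            · simpa [add_assoc] using hαβ
            · simpa [Function.update_of_ne hk] using hi k
        · rw [dif_neg hαβ, dif_neg]
          intro hall
          have := hall i
          simp only [Function.update_self] at this
          omega
      · rw [dif_neg hi, map_zero, dif_neg]
        push Not at hi ⊢
        obtain ⟨k, hk⟩ := hi
        refine ⟨k, hk.trans ?_⟩
        rcases eq_or_ne k i with rfl | hk
        · simp
        · simp [Function.update_of_ne hk]
    · rw [dif_neg hβ, map_zero]
      by_cases hi : ∀ k, (α k : ℕ) + (β k : ℕ) < p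
      · rw [dif_pos hi, GRing.mvD_X, derVar_apply, dif_neg]
        simp only
        omega
      · rw [dif_neg hi, map_zero]
  · rintro k ⟨⟨j, ⟨α, g⟩⟩, ⟨β, h⟩⟩
    change dite (∀ i, (α i : ℕ) + (β i : ℕ) < p) _ _ = S.mvσ _ k (dite _ _ _)
    by_cases hi : ∀ k, (α k : ℕ) + (β k : ℕ) < p
    · rw [dif_pos hi, dif_pos hi, GRing.mvσ_X]
      simp only [actVar, mul_assoc]
    · rw [dif_neg hi, dif_neg hi]
      exact (map_zero _).symm

omit [Fact p.Prime] [CharP K p] in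
theorem comulPoly_rename (f : MvPolynomial (ι × Idx p e G) K) [NeZero p] :
    comulPoly p e G K ι (rename (fun j => (j, ((fun _ => 0, 1) : Idx p e G))) f) = f := by
  classical
  have : (comulPoly p e G K ι).comp (rename (fun j => (j, ((fun _ => 0, 1) : Idx p e G)))) =
      AlgHom.id K _ := by
    apply MvPolynomial.algHom_ext
    rintro ⟨j, ⟨α, g⟩⟩
    rw [AlgHom.comp_apply, rename_X, comulPoly_X, dif_pos (by simp)]
    simp
  exact DFunLike.congr_fun this f

end PolyRing

section Geom

variable [Fact p.Prime] {K : Type w} [Field K] (S : GFieldStructure p e G K)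

/-- This translates the geometric axioms into algebra: c_V(W) ⊆ ∇(W) holds if and only if the ideal
of W in K{X} is closed under all ∂_θ. -/
theorem comulPoly_polyOp {ι : Type*} [CharP K p] (θ : Idx p e G)
    (f : MvPolynomial (ι × Idx p e G) K) :
    comulPoly p e G K ι (S.polyOp θ f) = (polyRing S.toGRing ι).op θ f := by
  have h1 : S.polyOp θ f = (polyRing S.toGRing (ι × Idx p e G)).op θ
      (rename (fun j => (j, ((fun _ => 0, 1) : Idx p e G))) f) := rfl
  rw [h1]
  refine ((comulPoly_isHom S.toGRing).op θ _).trans ?_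
  congr 1
  exact comulPoly_rename f

/-- This justifies the notation ∂_θ X_j for the variables, and later identifies evaluation at the
classes of the X_j with the quotient map. -/
theorem polyRing_op_X {ι : Type*} {K : Type w} [Field K] (S : GRing p e G K) [CharP K p] (j : ι)
    (α : Fin e → Fin p) (g : G) :
    (polyRing S ι).op (α, g) (X (j, (fun _ => 0, 1))) = X (j, (α, g)) := by
  classical
  have hX : (polyRing S ι).σ g (X (j, (fun _ => 0, 1))) = X (j, (fun _ => 0, g)) := by
    refine (GRing.mvσ_X S actVar g _).trans ?_
    simp [actVar]
  -- After the derivations along a partial list l have been applied, exactly the exponents at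
  -- indices in l have been raised from 0 to their final values.
  have key : ∀ l : List (Fin e), l.Nodup →
      iterList (fun i => (polyRing S ι).D i) l (fun i => (α i : ℕ)) (X (j, (fun _ => 0, g))) =
        X (j, (fun i => if i ∈ l then α i else 0, g)) := by
    intro l hl
    induction l with
    | nil => simp [iterList]
    | cons i l ih =>
      rw [List.nodup_cons] at hl
      change ((polyRing S ι).D i)^[(α i : ℕ)] (iterList _ l _ _) = _
      rw [ih hl.2]
      refine (mvD_derVar_iterate S i j _ g _).trans ?_
      simp only [hl.1, if_false, Fin.val_zero, zero_add, Fin.is_lt, dif_pos, Fin.eta]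
      congr 3
      funext k
      rcases eq_or_ne k i with rfl | hk
      · simp
      · simp [hk]
  rw [GRing.op, hX, iterD_eq_iterList, key _ (List.nodup_finRange e)]
  simp

/-- In a `𝔤`-field which satisfies the geometric axioms, the equations between finitely many
elements of a `𝔤`-extension which is a domain have a solution. -/
theorem GFieldStructure.Geometric.exists_point {S : GFieldStructure p e G K} (hS : S.Geometric)
    {L : Type*} [CommRing L] [IsDomain L] {T : GRing p e G L} {φ : K →+* L}
    (hφ : GRing.IsHom S.toGRing T φ) {n : ℕ} (hn : 0 < n) (r : Fin n → L) :
    ∃ a : Fin n → K, ∀ f : MvPolynomial (Fin n × Idx p e G) K,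
      eval₂Hom φ (fun v => T.op v.2 (r v.1)) f = 0 →
        eval (fun v => S.op v.2 (a v.1)) f = 0 := by
  have := S.charP
  have hev := polyRing_eval S.toGRing hφ r
  -- Take V to be the whole affine space and W the locus of all the ∂_θ r_j over K; the ideal of W
  -- is prime because L is a domain.
  suffices h : S.nabla (⊥ : Ideal (MvPolynomial (Fin n) K)) ≤
      RingHom.ker (eval₂Hom φ (fun v => T.op v.2 (r v.1))) ∧
      S.nabla (RingHom.ker (eval₂Hom φ (fun v => T.op v.2 (r v.1)))) ≤
        (RingHom.ker (eval₂Hom φ (fun v => T.op v.2 (r v.1)))).comap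
          (comulPoly p e G K (Fin n)) by
    obtain ⟨a, -, ha⟩ := hS n hn ⊥ _ Ideal.isPrime_bot (RingHom.ker_isPrime _) h.1 h.2
    exact ⟨a, ha⟩
  constructor
  · rw [GFieldStructure.nabla, Ideal.span_le]
    rintro _ ⟨θ, f, hf, rfl⟩
    rw [Ideal.mem_bot] at hf
    have : S.polyOp θ f ∈ ({0} : Set (MvPolynomial (Fin n × Idx p e G) K)) := by
      refine iterD_induction (fun i x hx => ?_) θ.1 ?_
      · rw [Set.mem_singleton_iff] at hx
        rw [hx]
        exact map_zero ((polyRing S.toGRing (Fin n)).D i)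
      · rw [hf, map_zero, map_zero]; rfl
    rw [Set.mem_singleton_iff] at this
    rw [this]
    exact zero_mem _
  · rw [GFieldStructure.nabla, Ideal.span_le]
    rintro _ ⟨θ, f, hf, rfl⟩
    rw [SetLike.mem_coe, Ideal.mem_comap, comulPoly_polyOp, RingHom.mem_ker, hev.op,
      (RingHom.mem_ker).1 hf]
    exact iterD_induction (s := {0}) (fun i x hx => by
      rw [Set.mem_singleton_iff] at hx ⊢; rw [hx, map_zero]) θ.1 (by simp)

/-- The geometric axioms hold if every prime `𝔤`-ideal of `K{X}` has a `K`-point. -/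
theorem geometric_of_exists_point [CharP K p]
    (h : ∀ (n : ℕ) (P : Ideal (MvPolynomial (Fin n × Idx p e G) K)), P.IsPrime →
      (∀ i, ∀ f ∈ P, (polyRing S.toGRing (Fin n)).D i f ∈ P) →
      (∀ g, ∀ f ∈ P, (polyRing S.toGRing (Fin n)).σ g f ∈ P) →
      ∃ a : Fin n → K, ∀ f ∈ P, eval (fun v => S.op v.2 (a v.1)) f = 0) : S.Geometric := by
  intro n hn I P hI hP hIP hcP
  have hp : p.Prime := Fact.out
  have hop : ∀ θ, ∀ f ∈ P, (polyRing S.toGRing (Fin n)).op θ f ∈ P := by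
    intro θ f hf
    rw [← comulPoly_polyOp]
    exact hcP (Ideal.subset_span ⟨θ, f, hf, rfl⟩)
  suffices h' : (∀ i, ∀ f ∈ P, (polyRing S.toGRing (Fin n)).D i f ∈ P) ∧
      ∀ g, ∀ f ∈ P, (polyRing S.toGRing (Fin n)).σ g f ∈ P by
    obtain ⟨a, ha⟩ := h n P hP h'.1 h'.2
    refine ⟨a, fun f hf => ?_, ha⟩
    -- The index (0, 1) gives the identity operator, so the inclusion W ⊆ ∇(V) places I itself
    -- inside P and the point lies on V.
    have h1 : S.polyOp (fun _ => 0, 1) f ∈ P := hIP (Ideal.subset_span ⟨_, f, hf, rfl⟩)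
    have h2 : S.polyOp (fun _ => 0, 1) f =
        rename (fun j => (j, ((fun _ => 0, 1) : Idx p e G))) f :=
      GRing.op_one (polyRing S.toGRing (Fin n)) _
    have h3 := ha _ h1
    rw [h2, eval_rename] at h3
    have h4 : ((fun v : Fin n × Idx p e G => S.op v.2 (a v.1)) ∘
        fun j => (j, ((fun _ => 0, 1) : Idx p e G))) = a := by
      funext j
      exact GRing.op_one S.toGRing (a j)
    rwa [h4] at h3
  refine ⟨fun i f hf => ?_, fun g f hf => ?_⟩
  · have h1 := hop (Function.update (fun _ => 0) i ⟨1, hp.one_lt⟩, 1) f hf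
    have h2 : (polyRing S.toGRing (Fin n)).op (Function.update (fun _ => 0) i ⟨1, hp.one_lt⟩, 1) f
        = (polyRing S.toGRing (Fin n)).D i f := by
      have h3 := D_iterD (p := p) (D := fun i => (polyRing S.toGRing (Fin n)).D i)
        (polyRing S.toGRing (Fin n)).D_comm i (fun _ => 0) (by simpa using hp.one_lt)
        f
      rw [iterD_zero (fun _ => 0) (by simp)] at h3
      rw [GRing.op, GRing.σ_one]
      simpa using h3.symm
    rwa [h2] at h1
  · have h1 := hop (fun _ => 0, g) f hf
    have h2 : (polyRing S.toGRing (Fin n)).op (fun _ => 0, g) f =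
        (polyRing S.toGRing (Fin n)).σ g f := iterD_zero _ (by simp) _
    rwa [h2] at h1

/-- The points of a prime `𝔤`-ideal of `K{X}` in a `𝔤`-field extension. -/
theorem exists_generic_point [Finite G] [CharP K p] {n : ℕ}
    (P : Ideal (MvPolynomial (Fin n × Idx p e G) K)) (hP : P.IsPrime)
    (hD : ∀ i, ∀ f ∈ P, (polyRing S.toGRing (Fin n)).D i f ∈ P)
    (hσ : ∀ g, ∀ f ∈ P, (polyRing S.toGRing (Fin n)).σ g f ∈ P) :
    ∃ (L : Type w) (_ : Field L) (T : GFieldStructure p e G L) (φ : K →+* L) (r : Fin n → L),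
      GRing.IsHom S.toGRing T.toGRing φ ∧
        ∀ f, eval₂Hom φ (fun v => T.op v.2 (r v.1)) f = 0 ↔ f ∈ P := by
  -- Indexing the variables by `Fin m` keeps the quotient field in the universe of K, whatever the
  -- universe of G.
  obtain ⟨m, ⟨ρ⟩⟩ := Finite.exists_equiv_fin (Fin n × Idx p e G)
  let E := (renameEquiv K ρ).toRingEquiv
  let P' : Ideal (MvPolynomial (Fin m) K) := P.comap E.symm
  have hP' : P'.IsPrime := Ideal.comap_isPrime _ _
  let π : MvPolynomial (Fin n × Idx p e G) K →+* MvPolynomial (Fin m) K ⧸ P' :=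
    (Ideal.Quotient.mk P').comp E
  have hπ : ∀ f, π f = 0 ↔ f ∈ P := fun f => by
    rw [RingHom.comp_apply, Ideal.Quotient.eq_zero_iff_mem, Ideal.mem_comap]
    simp
  have hπs : Function.Surjective π := Ideal.Quotient.mk_surjective.comp E.surjective
  let T0 := (polyRing S.toGRing (Fin n)).ofSurjective π hπs
    (fun i f hf => (hπ _).2 (hD i f ((hπ _).1 hf))) (fun i f hf => (hπ _).2 (hσ i f ((hπ _).1 hf)))
  have hT0 : GRing.IsHom (polyRing S.toGRing (Fin n)) T0 π := GRing.ofSurjective_isHom ..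
  let L := FractionRing (MvPolynomial (Fin m) K ⧸ P')
  have hchar : CharP (MvPolynomial (Fin m) K ⧸ P') p :=
    charP_of_injective_ringHom (π.comp C).injective p
  have hcharL : CharP L p :=
    charP_of_injective_ringHom (IsFractionRing.injective (MvPolynomial (Fin m) K ⧸ P') L) p
  have hT1 := (GRing.frac_isHom L T0).comp hT0
  refine ⟨L, inferInstance, (T0.frac L).toGField hcharL, ((algebraMap _ L).comp π).comp C,
    fun j => algebraMap _ L (π (X (j, (fun _ => 0, 1)))), hT1.comp (polyRing_C S.toGRing), ?_⟩
  intro f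
  rw [← hπ]
  have hinj := IsFractionRing.injective (MvPolynomial (Fin m) K ⧸ P') L
  have key : eval₂Hom (((algebraMap _ L).comp π).comp C)
      (fun v => ((T0.frac L).toGField hcharL).op v.2
        (algebraMap _ L (π (X (v.1, (fun _ => 0, 1)))))) = (algebraMap _ L).comp π := by
    apply MvPolynomial.ringHom_ext
    · intro a
      simp
    · rintro ⟨j, ⟨α, g⟩⟩
      rw [eval₂Hom_X']
      refine (hT1.op (α, g) _).symm.trans ?_
      rw [polyRing_op_X, RingHom.comp_apply]
  rw [key, RingHom.comp_apply]
  exact map_eq_zero_iff _ hinj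

end Geom

end FiniteGroupSchemeDCF

namespace FiniteGroupSchemeDCF

/-! ### Consequences of the geometric axioms -/

open MvPolynomial GFieldStructure

variable {p e : ℕ} {G : Type u} [Group G]

namespace GRing

variable {R : Type*} [CommRing R] (S : GRing p e G R)

theorem op_act [NeZero p] (g : G) (x : R) : S.op (fun _ => 0, g) x = S.σ g x :=
  iterD_zero _ (by simp) _

theorem op_der [Fact p.Prime] (i : Fin e) (x : R) :
    S.op (Function.update (fun _ => 0) i ⟨1, (Fact.out : p.Prime).one_lt⟩, 1) x = S.D i x := by
  have hp : p.Prime := Fact.out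
  have h3 := D_iterD (p := p) (D := fun i => S.D i) S.D_comm i (fun _ => 0)
    (by simpa using hp.one_lt) x
  rw [iterD_zero (fun _ => 0) (by simp)] at h3
  rw [GRing.op, GRing.σ_one]
  simpa using h3.symm

/-- The elements `b_j` are `G`-invariant and satisfy `D_i b_j = δ_{ij}`. -/
def IsDual (b : Fin e → R) : Prop :=
  (∀ g j, S.σ g (b j) = b j) ∧ ∀ i j, S.D i (b j) = if i = j then 1 else 0

/-- The element `y` is killed by the `D_i`, and its conjugates are pairwise distinct. -/
def IsFreePoint (y : R) : Prop := (∀ i, S.D i y = 0) ∧ ∀ g, S.σ g y = y → g = 1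

/-- Hypersurfaces over the constants which are irreducible have dense sets of constant points. -/
def HypersurfacePoints : Prop :=
  ∀ (m : ℕ) (f h : MvPolynomial (Fin m) R), (∀ s, S.IsConst (coeff s f)) →
    (∀ s, S.IsConst (coeff s h)) → Irreducible f → ¬ f ∣ h →
      ∃ x : Fin m → R, (∀ i, S.IsConst (x i)) ∧ eval x f = 0 ∧ eval x h ≠ 0

end GRing

section Extensions

variable [Fact p.Prime] {K : Type w} [Field K] [CharP K p] (S : GRing p e G K)

/-- Take the rational function field K(b_1, …, b_e). The second iterate of D_i already kills every
b_j, and p ≥ 2. -/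
theorem GRing.exists_extension_isDual :
    ∃ (L : Type w) (_ : Field L) (T : GRing p e G L) (φ : K →+* L) (b : Fin e → L),
      GRing.IsHom S T φ ∧ T.IsDual b := by
  have hp : p.Prime := Fact.out
  obtain ⟨T, hT, hTD, hTσ⟩ := S.exists_mvPoly (fun i j => C (if i = j then 1 else 0))
    (fun _ (j : Fin e) => j) (by simp) (by simp)
    (by intro i j t; simp only [GRing.mvD_C]; split_ifs <;> simp)
    (fun i t => by
      have h : ∀ n, 2 ≤ n →
          (S.mvD (fun i j => C (if i = j then 1 else 0)) i)^[n] (X t) = 0 := fun n hn => by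
        obtain ⟨n, rfl⟩ := Nat.exists_eq_add_of_le' hn
        rw [Function.iterate_succ_apply, Function.iterate_succ_apply, GRing.mvD_X, GRing.mvD_C]
        split_ifs <;> simp [Function.iterate_fixed]
      exact h p hp.two_le)
    (by intro g i t; rw [GRing.mvσ_C]; split_ifs <;> simp)
  have hL := GRing.frac_isHom (FractionRing (MvPolynomial (Fin e) K)) T
  refine ⟨FractionRing (MvPolynomial (Fin e) K), inferInstance, T.frac _, _,
    fun j => algebraMap (MvPolynomial (Fin e) K) _ (X j), hL.comp hT, fun g j => ?_, fun i j => ?_⟩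
  · rw [← hL.σ, hTσ]
  · rw [← hL.D, hTD]
    split_ifs <;> simp

/-- Take the rational function field in variables x_g permuted by G through left translation, with
zero derivatives, and the point x_1. The variables are numbered by `Fin n` so that the universe of K
does not change. -/
theorem GRing.exists_extension_isFreePoint [Finite G] :
    ∃ (L : Type w) (_ : Field L) (T : GRing p e G L) (φ : K →+* L) (y : L),
      GRing.IsHom S T φ ∧ T.IsFreePoint y := by
  obtain ⟨n, ⟨ρ⟩⟩ := Finite.exists_equiv_fin G
  obtain ⟨T, hT, hTD, hTσ⟩ := S.exists_mvPoly (fun _ _ => 0) (fun g t => ρ (g * ρ.symm t))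
    (by simp) (by simp [mul_assoc]) (by simp)
    (fun i t => by
      have h : ∀ n, n ≠ 0 → (S.mvD (fun _ _ => 0) i)^[n] (X t) = 0 := fun n hn => by
        obtain ⟨n, rfl⟩ := Nat.exists_eq_succ_of_ne_zero hn
        rw [Function.iterate_succ_apply, GRing.mvD_X, Function.iterate_fixed (map_zero _)]
      exact h p (Fact.out : p.Prime).ne_zero)
    (by simp)
  have hL := GRing.frac_isHom (FractionRing (MvPolynomial (Fin n) K)) T
  refine ⟨FractionRing (MvPolynomial (Fin n) K), inferInstance, T.frac _, _,
    algebraMap (MvPolynomial (Fin n) K) _ (X (ρ 1)), hL.comp hT, fun i => ?_, fun g hg => ?_⟩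
  · rw [← hL.D, hTD, map_zero]
  · rw [← hL.σ, hTσ] at hg
    have h1 := ρ.injective (X_injective (IsFractionRing.injective _ _ hg))
    rwa [ρ.symm_apply_apply, mul_one] at h1

/-- Adjunction of a constant generic point of a hypersurface over the constants. -/
theorem GRing.exists_extension_hypersurface {m : ℕ} {f h : MvPolynomial (Fin m) K}
    (hf : ∀ s, S.IsConst (coeff s f)) (hirr : Irreducible f) (hfh : ¬ f ∣ h) :
    ∃ (L : Type w) (_ : Field L) (T : GRing p e G L) (φ : K →+* L) (x : Fin m → L),
      GRing.IsHom S T φ ∧ (∀ j, T.IsConst (x j)) ∧ eval₂Hom φ x f = 0 ∧ eval₂Hom φ x h ≠ 0 := by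
  let R := MvPolynomial (Fin m) K ⧸ Ideal.span {f}
  have hprime : (Ideal.span {f}).IsPrime :=
    (Ideal.span_singleton_prime hirr.ne_zero).2 hirr.prime
  have hcR : CharP R p :=
    charP_of_injective_ringHom ((Ideal.Quotient.mk (Ideal.span {f})).comp C).injective p
  let L := FractionRing R
  obtain ⟨T₁, hT₁, hX⟩ := S.exists_constPoly (Fin m)
  -- A polynomial with constant coefficients in constant variables is a constant, so the principal
  -- ideal (f) is a 𝔤-ideal.
  have hfc : T₁.IsConst f := by
    have := hT₁.isConst_eval₂ hX hf
    rwa [show eval₂Hom C X f = f from eval₂_eta f] at this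
  let T0 : GRing p e G R := T₁.quotient (Ideal.span {f})
    (fun i x hx => by
      obtain ⟨c, rfl⟩ := Ideal.mem_span_singleton.1 hx
      rw [Derivation.leibniz, hfc.1, smul_zero, add_zero]
      exact Ideal.mul_mem_right _ _ (Ideal.mem_span_singleton_self f))
    (fun g x hx => by
      obtain ⟨c, rfl⟩ := Ideal.mem_span_singleton.1 hx
      rw [map_mul, hfc.2]
      exact Ideal.mul_mem_right _ _ (Ideal.mem_span_singleton_self f))
  have hT : GRing.IsHom T₁ (T0.frac L)
      ((algebraMap R L).comp (Ideal.Quotient.mk (Ideal.span {f}))) :=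
    (GRing.frac_isHom L T0).comp (GRing.quotient_isHom ..)
  set π := (algebraMap R L).comp (Ideal.Quotient.mk (Ideal.span {f})) with hπ
  have hπ0 : ∀ q, π q = 0 ↔ f ∣ q := fun q => by
    rw [hπ, RingHom.comp_apply, map_eq_zero_iff _ (IsFractionRing.injective R L),
      Ideal.Quotient.eq_zero_iff_mem, Ideal.mem_span_singleton]
  have hev : eval₂Hom (π.comp C) (fun j => π (X j)) = π := by
    apply MvPolynomial.ringHom_ext <;> simp
  refine ⟨L, inferInstance, T0.frac L, π.comp C, fun j => π (X j), hT.comp hT₁,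
    fun j => hT.isConst (hX j), ?_, ?_⟩
  · rw [hev, hπ0]
  · rwa [hev, Ne, hπ0]

end Extensions

variable [Fact p.Prime] {K : Type w} [Field K] {S : GFieldStructure p e G K}

/-- The working form of the geometric axioms: an equation D_i r_j = f(r) or σ_g r_j = f(r) is a
relation between a variable ∂_θ X_j and the ∂_(0,1) X_k, so it survives specialisation along with
the algebraic relations. -/
theorem GFieldStructure.Geometric.exists_point' (hS : S.Geometric)
    {L : Type*} [CommRing L] [IsDomain L] {T : GRing p e G L} {φ : K →+* L}
    (hφ : GRing.IsHom S.toGRing T φ) {ι : Type*} [Finite ι] [Nonempty ι] (r : ι → L) :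
    ∃ a : ι → K,
      (∀ f : MvPolynomial ι K, eval₂Hom φ r f = 0 → eval a f = 0) ∧
      (∀ i j, ∀ f : MvPolynomial ι K, T.D i (r j) = eval₂Hom φ r f → S.D i (a j) = eval a f) ∧
      ∀ g j, ∀ f : MvPolynomial ι K, T.σ g (r j) = eval₂Hom φ r f → S.σ g (a j) = eval a f := by
  obtain ⟨n, ⟨ρ⟩⟩ := Finite.exists_equiv_fin ι
  have hn : 0 < n := by
    obtain ⟨j⟩ := ‹Nonempty ι›
    exact (ρ j).pos
  obtain ⟨a, ha⟩ := hS.exists_point hφ hn (r ∘ ρ.symm)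
  let z : Fin e → Fin p := fun _ => 0
  let base : MvPolynomial ι K →+* MvPolynomial (Fin n × Idx p e G) K :=
    (rename (fun j => (ρ j, (z, (1 : G))))).toRingHom
  have h1 : ∀ f, eval₂Hom φ (fun v : Fin n × Idx p e G => T.op v.2 ((r ∘ ρ.symm) v.1)) (base f) =
      eval₂Hom φ r f := fun f => by
    have : (eval₂Hom φ (fun v : Fin n × Idx p e G => T.op v.2 ((r ∘ ρ.symm) v.1))).comp base =
        eval₂Hom φ r := by
      apply MvPolynomial.ringHom_ext
      · intro x; simp [base]
      · intro j; simp [base, z, T.op_one]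
    exact DFunLike.congr_fun this f
  have h2 : ∀ f, eval (fun v : Fin n × Idx p e G => S.op v.2 (a v.1)) (base f) =
      eval (a ∘ ρ) f := fun f => by
    have hS1 : ∀ x, S.op (z, 1) x = x := S.toGRing.op_one
    change eval _ (rename _ f) = _
    rw [eval_rename]
    congr 2
    funext j
    simp [hS1]
  refine ⟨a ∘ ρ, fun f hf => ?_, fun i j f hf => ?_, fun g j f hf => ?_⟩
  · rw [← h2]
    exact ha _ (by rw [h1, hf])
  · have h3 := ha (X (ρ j, (Function.update z i ⟨1, (Fact.out : p.Prime).one_lt⟩, 1)) - base f) (by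
      rw [map_sub, h1, eval₂Hom_X', T.op_der, Function.comp_apply, Equiv.symm_apply_apply, hf,
        sub_self])
    rw [map_sub, h2, eval_X, sub_eq_zero] at h3
    rw [← h3]
    exact (S.toGRing.op_der i _).symm
  · have h3 := ha (X (ρ j, (z, g)) - base f) (by
      rw [map_sub, h1, eval₂Hom_X', T.op_act, Function.comp_apply, Equiv.symm_apply_apply, hf,
        sub_self])
    rw [map_sub, h2, eval_X, sub_eq_zero] at h3
    rw [← h3]
    exact (S.toGRing.op_act g _).symm

theorem GFieldStructure.Geometric.exists_isDual (hS : S.Geometric) (he : 0 < e) :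
    ∃ b : Fin e → K, S.toGRing.IsDual b := by
  have := S.charP
  have : Nonempty (Fin e) := ⟨⟨0, he⟩⟩
  obtain ⟨L, _, T, φ, b', hφ, hb⟩ := S.toGRing.exists_extension_isDual
  obtain ⟨b, -, hD, hσ⟩ := hS.exists_point' hφ b'
  refine ⟨b, fun g j => ?_, fun i j => ?_⟩
  · refine (hσ g j (X j) ?_).trans (eval_X _)
    rw [eval₂Hom_X', hb.1]
  · refine (hD i j (C (if i = j then 1 else 0)) ?_).trans (eval_C _)
    rw [eval₂Hom_C, hb.2]
    split_ifs <;> simp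

theorem GFieldStructure.Geometric.exists_isFreePoint [Finite G] (hS : S.Geometric) :
    ∃ y : K, S.toGRing.IsFreePoint y := by
  classical
  have := S.charP
  have := Fintype.ofFinite G
  obtain ⟨L, _, T, φ, y, hφ, hy⟩ := S.toGRing.exists_extension_isFreePoint
  let x : G → L := fun g => T.σ g y
  have hx : ∀ g, g ≠ 1 → x g - x 1 ≠ 0 := fun g hg h0 => by
    rw [sub_eq_zero] at h0
    exact hg (hy.2 g (h0.trans (T.σ_one y)))
  -- The coordinate `none` holds an inverse of the product of the differences, so that distinctness
  -- of the conjugates from y becomes an equation and can be specialised.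
  let r : Option G → L := fun o => o.elim (∏ g ∈ Finset.univ.erase 1, (x g - x 1))⁻¹ x
  obtain ⟨a, h1, hD, hσ⟩ := hS.exists_point' hφ r
  refine ⟨a (some 1), fun i => ?_, fun g hg => ?_⟩
  · refine (hD i (some 1) 0 ?_).trans (map_zero _)
    rw [map_zero]
    change T.D i (T.σ 1 y) = 0
    rw [T.σ_one, hy.1]
  · by_contra hg1
    have hg' : S.toGRing.σ g (a (some 1)) = a (some g) := by
      refine (hσ g (some 1) (X (some g)) ?_).trans (eval_X _)
      rw [eval₂Hom_X']
      change T.σ g (T.σ 1 y) = T.σ g y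
      rw [T.σ_one]
    have h2 := h1 (X none * ∏ g ∈ Finset.univ.erase 1, (X (some g) - X (some 1)) - 1) (by
      rw [map_sub, map_mul, map_prod, map_one, eval₂Hom_X']
      simp only [map_sub, eval₂Hom_X']
      change (∏ g ∈ Finset.univ.erase 1, (x g - x 1))⁻¹ *
        (∏ g ∈ Finset.univ.erase 1, (x g - x 1)) - 1 = 0
      rw [inv_mul_cancel₀, sub_self]
      exact Finset.prod_ne_zero_iff.2 fun g hg => hx g (Finset.ne_of_mem_erase hg))
    rw [map_sub, map_mul, map_prod, map_one, Finset.prod_eq_zero (i := g), mul_zero, zero_sub,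
      neg_eq_zero] at h2
    · exact one_ne_zero h2
    · exact Finset.mem_erase.2 ⟨hg1, Finset.mem_univ g⟩
    · rw [map_sub, eval_X, eval_X, ← hg', hg, sub_self]

/-- Specialise the generic point of the hypersurface, made constant in an extension. The inverse of
the value of h is carried as an additional coordinate in order to preserve h ≠ 0. -/
theorem GFieldStructure.Geometric.hypersurfacePoints (hS : S.Geometric) :
    S.toGRing.HypersurfacePoints := by
  intro m f h hf hh hirr hfh
  have := S.charP
  obtain ⟨L, _, T, φ, x, hφ, hx, hxf, hxh⟩ := S.toGRing.exists_extension_hypersurface hf hirr hfh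
  obtain ⟨a, h1, hD, hσ⟩ := hS.exists_point' hφ
    (fun o : Option (Fin m) => o.elim (eval₂Hom φ x h)⁻¹ x)
  have hren : ∀ q : MvPolynomial (Fin m) K, eval₂Hom φ
      (fun o : Option (Fin m) => o.elim (eval₂Hom φ x h)⁻¹ x) (rename some q) =
      eval₂Hom φ x q := by
    intro q
    rw [coe_eval₂Hom, eval₂_rename]
    rfl
  refine ⟨fun j => a (some j), fun j => ⟨fun i => ?_, fun g => ?_⟩, ?_, fun h0 => ?_⟩
  · refine (hD i (some j) 0 ?_).trans (map_zero _)
    rw [map_zero]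
    exact (hx j).1 i
  · refine (hσ g (some j) (X (some j)) ?_).trans (eval_X _)
    rw [eval₂Hom_X']
    exact (hx j).2 g
  · have := h1 (rename some f) (by rw [hren, hxf])
    rwa [eval_rename] at this
  · have := h1 (X none * rename some h - 1) (by
      rw [map_sub, map_mul, hren, map_one, eval₂Hom_X', Option.elim_none, inv_mul_cancel₀ hxh,
        sub_self])
    rw [map_sub, map_mul, eval_rename, map_one] at this
    change _ * eval (fun j => a (some j)) h - 1 = 0 at this
    rw [h0, mul_zero, zero_sub, neg_eq_zero] at this
    exact one_ne_zero this

end FiniteGroupSchemeDCF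

namespace FiniteGroupSchemeDCF

/-! ### Hypersurface models of separable extensions -/

section HypersurfaceModel

open MvPolynomial

variable {C E : Type*} [Field C] [Field E] [Algebra C E]

/-- A multiple w' of the primitive element w is integral over the polynomial ring C[t]. As this ring
is integrally closed, the minimal polynomial of w' over it divides every polynomial over C[t] which
vanishes at w'; read as a polynomial in one more variable, it is f. -/
theorem exists_option_hypersurface_model (t : Finset E)
    (ht : IsTranscendenceBasis C ((↑) : t → E))
    (w : E) (hw : IntermediateField.adjoin (IntermediateField.adjoin C (t : Set E)) {w} = ⊤) :
    ∃ (v : Option t → E) (f : MvPolynomial (Option t) C), f ≠ 0 ∧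
      (∀ q, aeval v q = 0 ↔ f ∣ q) ∧
      ∀ z, ∃ A B : MvPolynomial (Option t) C, aeval v B ≠ 0 ∧ z = aeval v A / aeval v B := by
  let R := MvPolynomial t C
  let _ : Algebra R E := (aeval ((↑) : t → E)).toAlgebra
  have hmap : ∀ r : R, algebraMap R E r = aeval ((↑) : t → E) r := fun _ => rfl
  have hinj : Function.Injective (algebraMap R E) := ht.1
  have : FaithfulSMul R E := (faithfulSMul_iff_algebraMap_injective R E).2 hinj
  have : Module.IsTorsionFree R E := inferInstance
  have halg : Algebra.IsAlgebraic (Algebra.adjoin C (Set.range ((↑) : t → E))) E := ht.isAlgebraic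
  have hwalg : IsAlgebraic R w :=
    (halg.isAlgebraic w).of_ringHom_of_comp_eq (R := R) (A := E)
      (ht.1.aevalEquiv : R →+* Algebra.adjoin C (Set.range ((↑) : t → E))) (RingHom.id E)
      ht.1.aevalEquiv.surjective Function.injective_id (by
        apply RingHom.ext
        intro r
        exact ht.1.algebraMap_aevalEquiv r)
  obtain ⟨c, hc, hcw⟩ := hwalg.exists_integral_multiple
  have hcE : algebraMap R E c ≠ 0 := by rwa [Ne, map_eq_zero_iff _ hinj]
  let w' := c • w
  let v : Option t → E := fun o => o.elim w' (fun i => (i : E))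
  have hv : ∀ q, aeval v q = Polynomial.aeval w' (optionEquivLeft C t q) := by
    intro q
    induction q using MvPolynomial.induction_on with
    | C a =>
      rw [aeval_C, optionEquivLeft_C, Polynomial.aeval_C, hmap, aeval_C]
    | add q r hq hr => rw [map_add, map_add, map_add, hq, hr]
    | mul_X q o hq =>
      rw [map_mul, map_mul, map_mul, hq, aeval_X]
      congr 1
      cases o with
      | none => rw [optionEquivLeft_X_none, Polynomial.aeval_X]; rfl
      | some i => rw [optionEquivLeft_X_some, Polynomial.aeval_C, hmap, aeval_X]; rfl
  refine ⟨v, (optionEquivLeft C t).symm (minpoly R w'), ?_, fun q => ?_, fun z => ?_⟩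
  · rw [Ne, map_eq_zero_iff _ (optionEquivLeft C t).symm.injective]
    exact minpoly.ne_zero hcw
  · rw [hv, minpoly.isIntegrallyClosed_dvd_iff hcw]
    constructor
    · rintro ⟨s, hs⟩
      refine ⟨(optionEquivLeft C t).symm s, ?_⟩
      rw [← map_mul, ← hs, AlgEquiv.symm_apply_apply]
    · rintro ⟨s, rfl⟩
      rw [map_mul, AlgEquiv.apply_symm_apply]
      exact dvd_mul_right _ _
  · have hz : z ∈ IntermediateField.adjoin C (Set.range v) := by
      have h1 : ∀ i : t, (i : E) ∈ IntermediateField.adjoin C (Set.range v) := fun i =>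
        IntermediateField.subset_adjoin _ _ ⟨some i, rfl⟩
      have h2 : w' ∈ IntermediateField.adjoin C (Set.range v) :=
        IntermediateField.subset_adjoin _ _ ⟨none, rfl⟩
      have h3 : algebraMap R E c ∈ IntermediateField.adjoin C (Set.range v) := by
        have (q : R) : aeval ((↑) : t → E) q ∈ IntermediateField.adjoin C (Set.range v) := by
          induction q using MvPolynomial.induction_on with
          | C a =>
            rw [aeval_C]
            exact algebraMap_mem _ a
          | add f g hf hg =>
            rw [map_add]
            exact add_mem hf hg
          | mul_X f i hf =>
            rw [map_mul, aeval_X]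
            exact mul_mem hf (h1 i)
        exact this c
      have h4 : w ∈ IntermediateField.adjoin C (Set.range v) := by
        have : w = w' / algebraMap R E c := by
          rw [eq_div_iff hcE, mul_comm, ← Algebra.smul_def]
        rw [this]
        exact div_mem h2 h3
      have h5 : (IntermediateField.adjoin (IntermediateField.adjoin C (t : Set E)) {w}).restrictScalars C
          ≤ IntermediateField.adjoin C (Set.range v) := by
        rw [IntermediateField.adjoin_adjoin_left, IntermediateField.adjoin_le_iff]
        rintro x (hx | hx)
        · exact h1 ⟨x, hx⟩
        · rw [Set.mem_singleton_iff] at hx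
          rwa [hx]
      exact h5 (by rw [hw]; trivial)
    rw [IntermediateField.mem_adjoin_range_iff] at hz
    obtain ⟨A, B, hAB⟩ := hz
    -- A quotient with zero denominator is 0 by convention, so z = 0 and the fraction 0/1 serves
    -- instead.
    by_cases hB : aeval v B = 0
    · exact ⟨0, 1, by simp, by rw [hAB, hB]; simp⟩
    · exact ⟨A, B, hB, hAB⟩

/-- The hypothesis is MacLane's criterion. It yields a separating transcendence basis, and the
remaining finite separable extension has a primitive element. -/
theorem exists_hypersurface_model (p : ℕ) (hp : p.Prime) [ExpChar C p]
    (H : ∀ s : Finset E, LinearIndepOn C id (s : Set E) →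
      LinearIndepOn C (fun x : E => x ^ p) (s : Set E))
    [Algebra.EssFiniteType C E] :
    ∃ (m : ℕ) (v : Fin m → E) (f : MvPolynomial (Fin m) C), f ≠ 0 ∧
      (∀ q, aeval v q = 0 ↔ f ∣ q) ∧
      ∀ z, ∃ A B : MvPolynomial (Fin m) C, aeval v B ≠ 0 ∧ z = aeval v A / aeval v B := by
  obtain ⟨t, ht, hsep⟩ :=
    exists_isTranscendenceBasis_and_isSeparable_of_linearIndepOn_pow_of_essFiniteType p hp H
  have hess : Algebra.EssFiniteType (IntermediateField.adjoin C (t : Set E)) E :=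
    Algebra.EssFiniteType.of_comp C _ E
  have hfin : Module.Finite (IntermediateField.adjoin C (t : Set E)) E :=
    Algebra.finite_of_essFiniteType_of_isAlgebraic
  obtain ⟨w, hw⟩ := Field.exists_primitive_element (IntermediateField.adjoin C (t : Set E)) E
  obtain ⟨v, f, hf0, hf, hz⟩ := exists_option_hypersurface_model t ht w hw
  obtain ⟨m, ⟨ρ⟩⟩ := Finite.exists_equiv_fin (Option t)
  have hren : ∀ q : MvPolynomial (Option t) C, aeval (v ∘ ρ.symm) (renameEquiv C ρ q) = aeval v q :=
    fun q => by
      rw [renameEquiv_apply, aeval_rename, Function.comp_assoc, Equiv.symm_comp_self,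
        Function.comp_id]
  refine ⟨m, v ∘ ρ.symm, renameEquiv C ρ f, ?_, fun q => ?_, fun z => ?_⟩
  · rwa [Ne, map_eq_zero_iff _ (renameEquiv C ρ).injective]
  · obtain ⟨q, rfl⟩ := (renameEquiv C ρ).surjective q
    rw [hren, hf, map_dvd_iff]
  · obtain ⟨A, B, hB, hAB⟩ := hz z
    exact ⟨renameEquiv C ρ A, renameEquiv C ρ B, by rwa [hren], by rw [hren, hren, hAB]⟩

end HypersurfaceModel

/-! ### Constants of `𝔤`-fields -/

namespace GRing

variable {p e : ℕ} {G : Type u} [Group G] {K : Type*} [Field K] {L : Type*} [Field L]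

/-- The subfield of constants. -/
def constField (S : GRing p e G K) : Subfield K where
  toSubring := S.constants
  inv_mem' := fun x hx =>
    ⟨fun i => by rw [Derivation.leibniz_inv, hx.1, smul_zero], fun g => by rw [map_inv₀, hx.2]⟩

variable [Algebra K L] {S : GRing p e G K} {T : GRing p e G L}

/-- Constants which are linearly independent over the constants of a smaller `𝔤`-field `K`
are linearly independent over `K`. -/
theorem eq_zero_of_sum_const_eq_zero (hφ : IsHom S T (algebraMap K L)) {ι : Type*} [Fintype ι]
    {s : ι → L} (hs : ∀ i, T.IsConst (s i))
    (h : ∀ c : ι → K, (∀ i, S.IsConst (c i)) → ∑ i, algebraMap K L (c i) * s i = 0 → c = 0)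
    {d : ι → K} (hd : ∑ i, algebraMap K L (d i) * s i = 0) : d = 0 := by
  classical
  -- The shortest-relation argument: normalise one coefficient to 1. Applying D_j, or σ_g minus the
  -- identity, to the relation kills that coefficient and gives a shorter relation, which must be
  -- trivial; hence all normalised coefficients are constants.
  suffices ∀ (n : ℕ) (d : ι → K), (Finset.univ.filter fun i => d i ≠ 0).card < n →
      ∑ i, algebraMap K L (d i) * s i = 0 → d = 0 from this _ d (Nat.lt_succ_self _) hd
  intro n
  induction n with
  | zero => exact fun d hn => absurd hn (Nat.not_lt_zero _)
  | succ n ih =>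
    intro d hn hd
    by_contra hd0
    obtain ⟨k, hk⟩ := Function.ne_iff.1 hd0
    rw [Pi.zero_apply] at hk
    obtain ⟨d', hd'⟩ : ∃ d' : ι → K, d' = fun i => (d k)⁻¹ * d i := ⟨_, rfl⟩
    have hd'k : d' k = 1 := by rw [hd']; exact inv_mul_cancel₀ hk
    have hsum : ∑ i, algebraMap K L (d' i) * s i = 0 := by
      have : ∑ i, algebraMap K L (d' i) * s i =
          algebraMap K L (d k)⁻¹ * ∑ i, algebraMap K L (d i) * s i := by
        rw [Finset.mul_sum]
        exact Finset.sum_congr rfl fun i _ => by rw [hd', map_mul, mul_assoc]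
      rw [this, hd, mul_zero]
    have hd'0 : ∀ i, d i = 0 → d' i = 0 := fun i hi => by rw [hd']; simp [hi]
    have hlt : ∀ d'' : ι → K, (∀ i, d' i = 0 → d'' i = 0) → d'' k = 0 →
        (Finset.univ.filter fun i => d'' i ≠ 0).card < n := fun d'' h1 h2 => by
      refine lt_of_lt_of_le (Finset.card_lt_card ?_) (Nat.lt_succ_iff.1 hn)
      rw [Finset.ssubset_iff_of_subset]
      · exact ⟨k, by simpa using hk, by simpa using h2⟩
      · intro i hi
        simp only [Finset.mem_filter, Finset.mem_univ, true_and] at hi ⊢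
        exact fun h0 => hi (h1 i (hd'0 i h0))
    have hD : ∀ j i, S.D j (d' i) = 0 := fun j i => by
      refine congrFun (ih (fun i => S.D j (d' i)) (hlt _ (fun i hi => by simp [hi])
        (by simp [hd'k])) ?_) i
      have := congrArg (T.D j) hsum
      rw [map_sum, map_zero] at this
      rw [← this]
      refine Finset.sum_congr rfl fun i _ => ?_
      rw [Derivation.leibniz, (hs i).1, smul_zero, zero_add, hφ.D, smul_eq_mul, mul_comm]
    have hσ : ∀ g i, S.σ g (d' i) = d' i := fun g i => by
      have := congrFun (ih (fun i => S.σ g (d' i) - d' i) (hlt _ (fun i hi => by simp [hi])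
        (by simp [hd'k])) ?_) i
      · exact sub_eq_zero.1 this
      have := congrArg (T.σ g) hsum
      rw [map_sum, map_zero] at this
      have h2 : ∑ i, algebraMap K L (S.σ g (d' i) - d' i) * s i =
          ∑ i, T.σ g (algebraMap K L (d' i) * s i) - ∑ i, algebraMap K L (d' i) * s i := by
        rw [← Finset.sum_sub_distrib]
        refine Finset.sum_congr rfl fun i _ => ?_
        rw [map_mul, (hs i).2, map_sub, hφ.σ, sub_mul]
      rw [h2, this, hsum, sub_zero]
    have := congrFun (h d' (fun i => ⟨fun j => hD j i, fun g => hσ g i⟩) hsum) k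
    rw [hd'k] at this
    exact one_ne_zero this

end GRing

end FiniteGroupSchemeDCF

/-! ### Linear disjointness and specialisation of constants -/

namespace FiniteGroupSchemeDCF

open MvPolynomial GFieldStructure

namespace GRing

variable {p e : ℕ} {G : Type u} [Group G] {K : Type*} [Field K] {L : Type*} [Field L]
  [Algebra K L] {S : GRing p e G K} {T : GRing p e G L}

theorem constField_smul (c : S.constField) (x : L) : c • x = algebraMap K L c * x :=
  Algebra.smul_def (c : K) x

/-- Constants of a `𝔤`-extension are linearly disjoint from the smaller field. -/
theorem sum_linear_eq_zero (hφ : IsHom S T (algebraMap K L)) {ι : Type*} [Fintype ι]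
    {x : ι → L} (hx : ∀ i, T.IsConst (x i)) {d : ι → K} (hd : ∑ i, algebraMap K L (d i) * x i = 0)
    (l : K →ₗ[S.constField] S.constField) : ∑ i, algebraMap K L (l (d i)) * x i = 0 := by
  classical
  let E : Submodule S.constField L :=
    { carrier := {x | T.IsConst x}
      add_mem' := fun hx hy => T.constants.add_mem hx hy
      zero_mem' := T.constants.zero_mem
      smul_mem' := fun c x hx => by
        rw [constField_smul]
        exact T.constants.mul_mem (hφ.isConst c.2) hx }
  -- Expand the x_i in a basis of the constants of L over the constants of K. The basis stays
  -- independent over K, so each of its coefficients in the relation vanishes in K, and the linear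
  -- form l can be applied to it there.
  let B := Module.Basis.ofVectorSpace S.constField E
  let y : ι → E := fun i => ⟨x i, hx i⟩
  let F := Finset.univ.biUnion fun i => (B.repr (y i)).support
  have hsum : ∀ i, x i = ∑ b : F, algebraMap K L (B.repr (y i) b) * (B b : L) := fun i => by
    have h1 := congrArg (Subtype.val : E → L) (B.linearCombination_repr (y i))
    rw [Finsupp.linearCombination_apply, Finsupp.sum_of_support_subset (s := F) _
      (fun b hb => Finset.mem_biUnion.2 ⟨i, Finset.mem_univ i, hb⟩) _ (by simp)] at h1
    rw [← Finset.sum_coe_sort] at h1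
    rw [show x i = (y i : L) from rfl, ← h1, Submodule.coe_sum]
    exact Finset.sum_congr rfl fun b _ => by rw [Submodule.coe_smul, constField_smul]
  have hswap : ∀ d : ι → K, ∑ i, algebraMap K L (d i) * x i =
      ∑ b : F, algebraMap K L (∑ i, d i * (B.repr (y i) b : K)) * (B b : L) := fun d => by
    simp_rw [map_sum, Finset.sum_mul]
    rw [Finset.sum_comm]
    refine Finset.sum_congr rfl fun i _ => ?_
    rw [hsum i, Finset.mul_sum]
    exact Finset.sum_congr rfl fun b _ => by rw [map_mul, mul_assoc]
  rw [hswap] at hd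
  have h0 := eq_zero_of_sum_const_eq_zero hφ (s := fun b : F => (B b : L)) (fun b => (B b).2)
    (fun c hc hc0 => by
      have hli := (B.linearIndependent.comp (Subtype.val : F → _) Subtype.val_injective)
      rw [Fintype.linearIndependent_iff] at hli
      funext b
      have := hli (fun b => ⟨c b, hc b⟩) (by
        apply Subtype.ext
        rw [Submodule.coe_sum]
        refine Eq.trans (Finset.sum_congr rfl fun b _ => ?_) hc0
        rw [Submodule.coe_smul, constField_smul, Function.comp_apply]) b
      exact congrArg Subtype.val this) hd
  rw [hswap]
  refine Finset.sum_eq_zero fun b _ => ?_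
  have h1 := congrArg l (congrFun h0 b)
  rw [map_sum, Pi.zero_apply, map_zero] at h1
  have h2 : ∑ i, ((l (d i) : S.constField) : K) * (B.repr (y i) b : K) = 0 := by
    have h3 := congrArg (Subtype.val : S.constField → K) h1
    rw [AddSubmonoidClass.coe_finsetSum] at h3
    refine Eq.trans (Finset.sum_congr rfl fun i _ => ?_) h3
    rw [mul_comm (d i), show ((B.repr (y i) b : S.constField) : K) * d i =
      (B.repr (y i) b : S.constField) • d i from rfl, map_smul, smul_eq_mul, mul_comm]
    rfl
  rw [h2, map_zero, zero_mul]

/-- Decompose q along a basis of K over its constants. By linear disjointness each component, a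
polynomial with constant coefficients, vanishes at v and is therefore divisible by f. So passing
from constant coefficients to K creates no new relations. -/
theorem map_dvd_of_aeval_eq_zero (hφ : IsHom S T (algebraMap K L)) {τ : Type*} {v : τ → L}
    (hv : ∀ t, T.IsConst (v t)) {f : MvPolynomial τ S.constField}
    (hf : ∀ q : MvPolynomial τ S.constField, aeval v q = 0 → f ∣ q) {q : MvPolynomial τ K}
    (hq : aeval v q = 0) : map (algebraMap S.constField K) f ∣ q := by
  classical
  let ql : (K →ₗ[S.constField] S.constField) → MvPolynomial τ S.constField := fun l =>
    ∑ s ∈ q.support, monomial s (l (coeff s q))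
  have hcoeff : ∀ l s, coeff s (ql l) = l (coeff s q) := fun l s => by
    rw [coeff_sum]
    simp only [coeff_monomial]
    rw [Finset.sum_ite_eq' q.support s]
    split_ifs with h
    · rfl
    · rw [notMem_support_iff.1 h, map_zero]
  have hmon : ∀ s : τ →₀ ℕ, T.IsConst (s.prod fun i k => v i ^ k) := fun s =>
    T.constants.prod_mem fun i _ => T.constants.pow_mem (hv i) _
  have hql : ∀ l, f ∣ ql l := fun l => by
    apply hf
    have h1 : ∑ s : q.support, algebraMap K L (coeff s.1 q) * (s.1.prod fun i k => v i ^ k) = 0 := by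
      rw [Finset.sum_coe_sort q.support fun s => algebraMap K L (coeff s q) *
        (s.prod fun i k => v i ^ k), ← hq]
      conv_rhs => rw [q.as_sum, map_sum]
      exact Finset.sum_congr rfl fun s _ => by rw [aeval_monomial]
    have h2 := sum_linear_eq_zero hφ (fun s : q.support => hmon s.1) h1 l
    rw [Finset.sum_coe_sort q.support fun s => algebraMap K L (l (coeff s q)) *
        (s.prod fun i k => v i ^ k)] at h2
    rw [map_sum, ← h2]
    exact Finset.sum_congr rfl fun s _ => by rw [aeval_monomial]; rfl
  let B := Module.Basis.ofVectorSpace S.constField K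
  let F := q.support.biUnion fun s => (B.repr (coeff s q)).support
  have hq : q = ∑ b ∈ F, C (B b) * map (algebraMap S.constField K) (ql (B.coord b)) := by
    ext s
    rw [coeff_sum]
    simp only [coeff_C_mul, coeff_map, hcoeff]
    by_cases hs : s ∈ q.support
    · conv_lhs => rw [← B.linearCombination_repr (coeff s q)]
      rw [Finsupp.linearCombination_apply, Finsupp.sum_of_support_subset (s := F) _
        (fun b hb => Finset.mem_biUnion.2 ⟨s, hs, hb⟩) _ (by simp)]
      refine Finset.sum_congr rfl fun b _ => ?_
      rw [mul_comm]
      rfl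
    · rw [notMem_support_iff.1 hs]
      simp
  rw [hq]
  exact Finset.dvd_sum fun b _ => Dvd.dvd.mul_left (map_dvd _ (hql _)) _

/-- Otherwise X^p - c would be irreducible over K, and its zero set, as a hypersurface in the line,
would have a point in K. -/
theorem HypersurfacePoints.exists_pow_eq [Fact p.Prime] (H : S.HypersurfacePoints) {c : K}
    (hc : S.IsConst c) : ∃ z, z ^ p = c := by
  by_contra hne
  push Not at hne
  have hp : p.Prime := Fact.out
  have hirr := X_pow_sub_C_irreducible_of_prime hp hne
  let E := (uniqueAlgEquiv K (Fin 1))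
  have hf : E (X 0 ^ p - C c) = Polynomial.X ^ p - Polynomial.C c := by
    simp [E]
  have hirr' : Irreducible (X 0 ^ p - C c : MvPolynomial (Fin 1) K) := by
    rw [← MulEquiv.irreducible_iff E, hf]
    exact hirr
  obtain ⟨x, hx, hx0, -⟩ := H 1 (X 0 ^ p - C c) 1
    (fun s => by
      classical
      rw [coeff_sub, coeff_X_pow, coeff_C]
      refine S.constants.sub_mem ?_ ?_ <;> split_ifs
      exacts [S.constants.one_mem, S.constants.zero_mem, hc, S.constants.zero_mem])
    (fun s => by
      classical
      rw [coeff_one]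
      split_ifs
      exacts [S.constants.one_mem, S.constants.zero_mem]) hirr'
    (fun h => hirr'.not_isUnit (isUnit_of_dvd_one h))
  rw [map_sub, map_pow, eval_X, eval_C, sub_eq_zero] at hx0
  exact hne _ hx0

/-- Constants of a `𝔤`-extension can be specialized to constants. -/
theorem HypersurfacePoints.exists_specialization [Fact p.Prime] [CharP K p]
    (H : S.HypersurfacePoints)
    (hφ : IsHom S T (algebraMap K L)) {ι : Type*} [Finite ι] {y : ι → L}
    (hy : ∀ i, T.IsConst (y i)) : ∃ ε : ι → K, (∀ i, S.IsConst (ε i)) ∧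
      ∀ q : MvPolynomial ι K, aeval y q = 0 → aeval ε q = 0 := by
  classical
  have := Fintype.ofFinite ι
  have hp : p.Prime := Fact.out
  have hcL : CharP L p := charP_of_injective_algebraMap (algebraMap K L).injective p
  let C₀ := S.constField
  have hcC : CharP C₀ p := (RingHom.charP_iff (algebraMap C₀ K) (algebraMap C₀ K).injective p).2 inferInstance
  have : ExpChar C₀ p := ExpChar.prime hp
  let E₁ : IntermediateField C₀ L :=
    T.constField.toIntermediateField fun c => hφ.isConst c.2
  let E := IntermediateField.adjoin C₀ (Set.range y)
  have hE : ∀ x : E, T.IsConst (x : L) := by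
    have : E ≤ E₁ := by
      rw [IntermediateField.adjoin_le_iff]
      rintro _ ⟨i, rfl⟩
      exact hy i
    exact fun x => this x.2
  have hess : Algebra.EssFiniteType C₀ E := by
    rw [IntermediateField.essFiniteType_iff]
    exact ⟨Finset.univ.image y, by rw [Finset.coe_image, Finset.coe_univ, Set.image_univ]⟩
  -- MacLane's criterion: write the coefficients of a relation between the x^p as p-th powers of
  -- elements d_x of K and extract the p-th root. The resulting relation between the x has
  -- coefficients in K, which vanish since constants independent over the constants of K are
  -- independent over K.
  obtain ⟨m, v, f, hf0, hf, hAB⟩ := exists_hypersurface_model (C := C₀) (E := E) p hp (by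
    intro s hs
    rw [linearIndepOn_finset_iff] at hs ⊢
    intro c hc
    choose d hd using fun x => H.exists_pow_eq (c x).2
    have h1 : (∑ x : s, algebraMap K L (d x) * ((x : E) : L)) = 0 := by
      have h2 : (∑ x : s, algebraMap K L (d x) * ((x : E) : L)) ^ p = 0 := by
        rw [sum_pow_char]
        have h3 := congrArg (Subtype.val : E → L) hc
        rw [AddSubmonoidClass.coe_finsetSum, ← Finset.sum_coe_sort] at h3
        refine Eq.trans (Finset.sum_congr rfl fun x _ => ?_) h3
        rw [mul_pow, ← map_pow, hd, IntermediateField.coe_smul, constField_smul]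
        rfl
      exact pow_eq_zero_iff hp.ne_zero |>.1 h2
    have h4 := eq_zero_of_sum_const_eq_zero hφ (s := fun x : s => ((x : E) : L)) (fun x => hE x.1)
      (fun c' hc' hc0 => by
        funext x
        have := hs (fun z => if hz : z ∈ s then ⟨c' ⟨z, hz⟩, hc' ⟨z, hz⟩⟩ else 0) (by
          apply Subtype.ext
          rw [AddSubmonoidClass.coe_finsetSum, ← Finset.sum_coe_sort]
          refine Eq.trans (Finset.sum_congr rfl fun z _ => ?_) hc0
          rw [dif_pos z.2, IntermediateField.coe_smul, constField_smul]
          rfl) x.1 x.2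
        rw [dif_pos x.2] at this
        exact congrArg Subtype.val this) h1
    intro x hx
    apply Subtype.ext
    rw [← hd x, show d x = 0 from congrFun h4 ⟨x, hx⟩, zero_pow hp.ne_zero]
    rfl)
  let vL : Fin m → L := fun i => (v i : L)
  have hvL : ∀ q : MvPolynomial (Fin m) C₀, aeval vL q = ((aeval v q : E) : L) := fun q =>
    aeval_algebraMap_apply L v q
  let P : MvPolynomial (Fin m) C₀ →+* MvPolynomial (Fin m) K := map (algebraMap C₀ K)
  have hP : ∀ q, aeval vL (P q) = ((aeval v q : E) : L) := fun q => by
    rw [← hvL]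
    exact aeval_map_algebraMap K vL q
  have hker : ∀ q, aeval vL q = 0 ↔ P f ∣ q := fun q => by
    constructor
    · exact map_dvd_of_aeval_eq_zero hφ (fun i => hE (v i)) (fun q hq => (hf q).1 (by
        rw [hvL] at hq
        exact Subtype.ext hq))
    · rintro ⟨q, rfl⟩
      rw [map_mul, hP, (hf f).2 dvd_rfl]
      exact zero_mul _
  -- Irreducibility over K, not only over the constants: by `hker` the ideal generated by `P f` is
  -- the kernel of a map to a field.
  have hirr : Irreducible (P f) := by
    apply Prime.irreducible
    refine ⟨?_, fun hu => ?_, fun a b hab => ?_⟩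
    · rwa [Ne, map_eq_zero_iff _ (map_injective _ (algebraMap C₀ K).injective)]
    · have := hu.map (aeval vL)
      rw [(hker _).2 dvd_rfl] at this
      exact not_isUnit_zero this
    · rw [← hker, map_mul, mul_eq_zero, hker, hker] at hab
      exact hab
  choose A B hB hA using fun i => hAB ⟨y i, IntermediateField.subset_adjoin _ _ ⟨i, rfl⟩⟩
  have hconst : ∀ q s, S.IsConst (coeff s (P q)) := fun q s => by
    rw [coeff_map]
    exact (coeff s q).2
  -- The point has to avoid the denominators of all the y_i, expressed as rational functions on the
  -- hypersurface.
  obtain ⟨x, hx, hxf, hxB⟩ := H m (P f) (P (∏ i, B i)) (hconst _) (hconst _) hirr (by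
    rw [← hker, hP, map_prod]
    have : ∏ i, aeval v (B i) ≠ 0 := Finset.prod_ne_zero_iff.2 fun i _ => hB i
    exact fun h0 => this (Subtype.ext h0))
  have hxB' : ∀ i, eval x (P (B i)) ≠ 0 := fun i h0 => hxB (by
    rw [map_prod, map_prod]
    exact Finset.prod_eq_zero (Finset.mem_univ i) h0)
  let ε : ι → K := fun i => eval x (P (A i)) / eval x (P (B i))
  have hev : ∀ q, S.IsConst (eval x (P q)) := fun q => by
    rw [eval_map, eval₂_eq]
    exact S.constants.sum_mem fun s _ => S.constants.mul_mem (coeff s q).2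
      (S.constants.prod_mem fun i _ => S.constants.pow_mem (hx i) _)
  refine ⟨ε, fun i => S.constField.div_mem (hev _) (hev _), fun q hq => ?_⟩
  -- Clear denominators in q: the same g/s represents its value both at y and at ε. Then q(y) = 0
  -- forces f to divide g, and g vanishes at the chosen point.
  obtain ⟨g, s, hs, hs', hg, hg'⟩ : ∃ g s : MvPolynomial (Fin m) K, aeval vL s ≠ 0 ∧
      eval x s ≠ 0 ∧ aeval vL g = aeval vL s * aeval y q ∧
      eval x g = eval x s * aeval ε q := by
    clear hq
    induction q using MvPolynomial.induction_on with
    | C a =>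
      refine ⟨C a, 1, by simp, by simp, by simp, by simp⟩
    | add q₁ q₂ h₁ h₂ =>
      obtain ⟨g₁, s₁, a₁, b₁, c₁, d₁⟩ := h₁
      obtain ⟨g₂, s₂, a₂, b₂, c₂, d₂⟩ := h₂
      refine ⟨g₁ * s₂ + s₁ * g₂, s₁ * s₂, ?_, ?_, ?_, ?_⟩
      · rw [map_mul]; exact mul_ne_zero a₁ a₂
      · rw [map_mul]; exact mul_ne_zero b₁ b₂
      · simp only [map_add, map_mul, c₁, c₂]; ring
      · simp only [map_add, map_mul, d₁, d₂]; ring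
    | mul_X q i h =>
      obtain ⟨g, s, a, b, c, d⟩ := h
      have hBL : aeval vL (P (B i)) ≠ 0 := fun h0 => hB i (Subtype.ext (by rw [← hP, h0]; rfl))
      have hy : y i = aeval vL (P (A i)) / aeval vL (P (B i)) := by
        rw [hP, hP]
        exact congrArg (Subtype.val : E → L) (hA i)
      refine ⟨g * P (A i), s * P (B i), ?_, ?_, ?_, ?_⟩
      · rw [map_mul]; exact mul_ne_zero a hBL
      · rw [map_mul]; exact mul_ne_zero b (hxB' i)
      · simp only [map_mul, aeval_X, c, hy]
        field_simp
      · have := hxB' i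
        simp only [map_mul, aeval_X, d, ε]
        field_simp
  rw [hq, mul_zero, hker] at hg
  obtain ⟨u, rfl⟩ := hg
  rw [map_mul, hxf, zero_mul] at hg'
  exact (mul_eq_zero.1 hg'.symm).resolve_left hs'

end GRing

end FiniteGroupSchemeDCF

/-! ### Generation by constants, and the criterion for the geometric axioms -/

namespace FiniteGroupSchemeDCF

open MvPolynomial GFieldStructure

theorem iterate_derivation_pow {R : Type*} [CommRing R] (D : Derivation ℤ R R) {b : R}
    (hb : D b = 1) (n : ℕ) : D^[n] (b ^ n) = (n.factorial : R) := by
  induction n with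
  | zero => simp
  | succ n ih =>
    rw [Function.iterate_succ_apply, Derivation.leibniz_pow, hb, Nat.add_sub_cancel, smul_eq_mul,
      mul_one, nsmul_eq_mul, iterate_mul_of_eq_zero D (by simp), ih, Nat.factorial_succ,
      Nat.cast_mul]

namespace GRing

variable {p e : ℕ} {G : Type u} [Group G] {L : Type*} [Field L] {T : GRing p e G L}

/-- Taylor expansion: `L` is generated by dual elements over the elements killed by the `D_i`. -/
theorem IsDual.mem_subring [Fact p.Prime] [CharP L p] {b : Fin e → L} (hb : T.IsDual b)
    (A : Subring L) (hA : ∀ x, (∀ i, T.D i x = 0) → x ∈ A) (hbA : ∀ i, b i ∈ A) (x : L) :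
    x ∈ A := by
  classical
  suffices h : ∀ (s : Finset (Fin e)) (x : L), (∀ i ∉ s, T.D i x = 0) → x ∈ A from
    h Finset.univ x fun i hi => absurd (Finset.mem_univ i) hi
  have hiter : ∀ i k n x, T.D i ((T.D k)^[n] x) = (T.D k)^[n] (T.D i x) := fun i k n x => by
    induction n generalizing x with
    | zero => rfl
    | succ n ih => rw [Function.iterate_succ_apply, Function.iterate_succ_apply, ih, T.D_comm i k]
  intro s
  induction s using Finset.induction_on with
  | empty => exact fun x hx => hA x fun i => hx i (Finset.notMem_empty i)
  | insert k s hk ih =>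
    -- Inner induction on the order of nilpotency of D_k at x: subtracting the top Taylor term c
    -- b_k^n / n!, with c = D_k^n x, lowers this order.
    suffices h : ∀ n, n ≤ p → ∀ x, (∀ i ∉ insert k s, T.D i x = 0) → (T.D k)^[n] x = 0 → x ∈ A from
      fun x hx => h p le_rfl x hx (T.D_pow k x)
    intro n
    induction n with
    | zero => exact fun _ x _ h0 => by rw [Function.iterate_zero, id] at h0; rw [h0]; exact A.zero_mem
    | succ n ihn =>
      intro hn x hx hx0
      let c := (T.D k)^[n] x
      have hcD : T.D k c = 0 := by rw [← hx0, Function.iterate_succ_apply']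
      have hcD' : ∀ i ∉ insert k s, T.D i c = 0 := fun i hi => by
        rw [hiter, hx i hi, Function.iterate_fixed (map_zero _)]
      have hcA : c ∈ A := ih c fun i hi => by
        rcases eq_or_ne i k with rfl | hik
        · exact hcD
        · exact hcD' i (by simp [hik, hi])
      -- Here n < p, so n! is invertible.
      have hfact : (n.factorial : L) ≠ 0 := by
        rw [Ne, CharP.cast_eq_zero_iff L p, (Fact.out : p.Prime).dvd_factorial]
        omega
      have hcast : ∀ i, T.D i ((n.factorial : L)⁻¹) = 0 := fun i => by
        rw [Derivation.leibniz_inv]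
        simp
      let z := (c * (n.factorial : L)⁻¹) * b k ^ n
      have hzA : z ∈ A := A.mul_mem (A.mul_mem hcA (hA _ hcast)) (A.pow_mem (hbA k) n)
      have hz0 : ∀ i, T.D i c = 0 → T.D i (c * (n.factorial : L)⁻¹) = 0 := fun i hi => by
        rw [Derivation.leibniz, hi, hcast]
        simp
      have hxz : x - z ∈ A := by
        refine ihn (by omega) _ (fun i hi => ?_) ?_
        · rw [map_sub, hx i hi, Derivation.leibniz, hz0 i (hcD' i hi), Derivation.leibniz_pow,
            hb.2, if_neg (fun h => hi (by rw [h]; exact Finset.mem_insert_self _ _))]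
          simp
        · rw [sub_eq_add_neg, iterate_map_add, ← neg_one_mul, iterate_mul_of_eq_zero _ (by simp),
            iterate_mul_of_eq_zero _ (hz0 k hcD),
            iterate_derivation_pow _ (by rw [hb.2, if_pos rfl]), inv_mul_cancel_right₀ hfact]
          ring
      rw [← sub_add_cancel x z]
      exact A.add_mem hxz hzA

/-- The elements killed by the `D_i` are generated by a free point over the constants. -/
theorem IsFreePoint.mem_subring [Finite G] {y : L} (hy : T.IsFreePoint y) (A : Subring L)
    (hA : ∀ x, T.IsConst x → x ∈ A) (hyA : y ∈ A) {x : L} (hx : ∀ i, T.D i x = 0) : x ∈ A := by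
  classical
  obtain ⟨n, ⟨ρ⟩⟩ := Finite.exists_equiv_fin G
  let z : Fin n → L := fun j => T.σ (ρ.symm j) y
  have hz : Function.Injective z := fun i j hij => by
    have h1 := congrArg (T.σ (ρ.symm i)⁻¹) hij
    simp only [z] at h1
    rw [← T.σ_mul, ← T.σ_mul, inv_mul_cancel, T.σ_one] at h1
    have h2 := hy.2 _ h1.symm
    rw [inv_mul_eq_one] at h2
    exact ρ.symm.injective h2
  have hdet := Matrix.det_vandermonde_ne_zero_iff.2 hz
  -- Galois descent by hand: x should be ∑ c_i y^i with constant c_i, so all the conjugate equations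
  -- are imposed at once. Their matrix is Vandermonde with distinct nodes.
  obtain ⟨c, hc⟩ : ∃ c : Fin n → L, ∀ g, ∑ i : Fin n, T.σ g y ^ (i : ℕ) * c i = T.σ g x := by
    refine ⟨(Matrix.vandermonde z)⁻¹.mulVec fun j => T.σ (ρ.symm j) x, fun g => ?_⟩
    have h1 : (Matrix.vandermonde z).mulVec ((Matrix.vandermonde z)⁻¹.mulVec
        fun j => T.σ (ρ.symm j) x) = fun j => T.σ (ρ.symm j) x := by
      rw [Matrix.mulVec_mulVec, Matrix.mul_nonsing_inv _ (isUnit_iff_ne_zero.2 hdet),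
        Matrix.one_mulVec]
    have h2 := congrFun h1 (ρ g)
    simp only [ρ.symm_apply_apply] at h2
    rw [← h2]
    simp [Matrix.mulVec, dotProduct, z]
  have huniq : ∀ d : Fin n → L, (∀ g, ∑ i : Fin n, T.σ g y ^ (i : ℕ) * d i = 0) → d = 0 := fun d hd =>
    Matrix.eq_zero_of_forall_index_sum_pow_mul_eq_zero hz fun j => hd (ρ.symm j)
  -- Differentiating the system gives a homogeneous one, and σ_h merely permutes the equations;
  -- uniqueness of the solution then shows that the c_i are constants.
  have hconst : ∀ i, T.IsConst (c i) := by
    refine fun i => ⟨fun k => congrFun (huniq (fun i => T.D k (c i)) fun g => ?_) i, fun h => ?_⟩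
    · have h1 := congrArg (T.D k) (hc g)
      rw [← T.σ_D, hx, map_zero, map_sum] at h1
      rw [← h1]
      refine Finset.sum_congr rfl fun i _ => ?_
      rw [Derivation.leibniz, Derivation.leibniz_pow, ← T.σ_D, hy.1]
      simp
    · refine sub_eq_zero.1 (congrFun (huniq (fun i => T.σ h (c i) - c i) fun g => ?_) i)
      simp_rw [mul_sub, Finset.sum_sub_distrib]
      rw [hc, sub_eq_zero]
      have h1 := congrArg (T.σ h) (hc (h⁻¹ * g))
      rw [map_sum, ← T.σ_mul, mul_inv_cancel_left] at h1
      rw [← h1]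
      refine Finset.sum_congr rfl fun i _ => ?_
      rw [map_mul, map_pow, ← T.σ_mul, mul_inv_cancel_left]
  have h1 := hc 1
  simp only [T.σ_one] at h1
  rw [← h1]
  refine A.sum_mem fun i _ => ?_
  exact A.mul_mem (A.pow_mem hyA _) (hA _ (hconst i))

variable {K : Type*} [Field K] {S : GRing p e G K}

theorem IsHom.isDual {φ : K →+* L} (hφ : IsHom S T φ) {b : Fin e → K} (hb : S.IsDual b) :
    T.IsDual fun i => φ (b i) :=
  ⟨fun g j => by rw [← hφ.σ, hb.1], fun i j => by rw [← hφ.D, hb.2]; split_ifs <;> simp⟩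

theorem IsHom.isFreePoint {φ : K →+* L} (hφ : IsHom S T φ) {y : K} (hy : S.IsFreePoint y) :
    T.IsFreePoint (φ y) :=
  ⟨fun i => by rw [← hφ.D, hy.1, map_zero], fun g h => hy.2 g (φ.injective (by rw [hφ.σ, h]))⟩

/-- The dual elements and the free point of K keep their properties in L. The free point generates
the elements killed by the D_i over the constants, and the dual elements generate L over those. -/
theorem IsHom.adjoin_const_eq_top [Algebra K L] [Fact p.Prime] [CharP L p] [Finite G]
    (hφ : IsHom S T (algebraMap K L)) {b : Fin e → K} (hb : S.IsDual b) {y : K}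
    (hy : S.IsFreePoint y) : Algebra.adjoin K {x : L | T.IsConst x} = ⊤ := by
  let A := (Algebra.adjoin K {x : L | T.IsConst x}).toSubring
  have hK : ∀ z, algebraMap K L z ∈ A := fun z => Subalgebra.algebraMap_mem _ z
  have hc : ∀ x, T.IsConst x → x ∈ A := fun x hx => Algebra.subset_adjoin hx
  rw [eq_top_iff]
  exact fun x _ => (hφ.isDual hb).mem_subring A
    (fun x hx => (hφ.isFreePoint hy).mem_subring A hc (hK y) hx) (fun i => hK _) x

end GRing

/-- The coordinates of a generic point of W are polynomials Q_j over K in constants Y of L.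
Specialising Y to constants ε of K sends this generic point to the required point of K. -/
theorem GFieldStructure.geometric_of_hypersurfacePoints {p e : ℕ} {G : Type u} [Group G] [Finite G]
    [Fact p.Prime] {K : Type w} [Field K] (S : GFieldStructure p e G K) {b : Fin e → K}
    (hb : S.toGRing.IsDual b) {y : K} (hy : S.toGRing.IsFreePoint y)
    (H : S.toGRing.HypersurfacePoints) : S.Geometric := by
  have := S.charP
  refine geometric_of_exists_point S fun n P hP hD hσ => ?_
  obtain ⟨L, _, T, φ, r, hφ, hr⟩ := exists_generic_point S P hP hD hσ
  have := T.charP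
  let _ : Algebra K L := φ.toAlgebra
  have hφ : GRing.IsHom S.toGRing T.toGRing (algebraMap K L) := hφ
  have htop := hφ.adjoin_const_eq_top hb hy
  have hq : ∀ j, ∃ q : MvPolynomial {x : L | T.toGRing.IsConst x} K,
      aeval (Subtype.val : {x : L | T.toGRing.IsConst x} → L) q = r j := fun j => by
    have : r j ∈ Algebra.adjoin K {x : L | T.toGRing.IsConst x} := htop ▸ Algebra.mem_top
    rwa [Algebra.adjoin_eq_range] at this
  choose q hq using hq
  choose s q' hq' using fun j => exists_finset_rename (q j)
  let ι := Σ j, s j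
  let Y : ι → L := fun i => i.2.1.1
  let Q : Fin n → MvPolynomial ι K := fun j => rename (fun x => (⟨j, x⟩ : ι)) (q' j)
  have hQ : ∀ j, aeval Y (Q j) = r j := fun j => by
    rw [← hq, hq', aeval_rename, aeval_rename]
    rfl
  have hY : ∀ i, T.toGRing.IsConst (Y i) := fun i => i.2.1.2
  obtain ⟨ε, hε, hspec⟩ := H.exists_specialization hφ hY
  obtain ⟨T₁, hT₁, hX⟩ := S.toGRing.exists_constPoly ι
  refine ⟨fun j => aeval ε (Q j), fun f hf => ?_⟩
  -- F is f with ∂_θ X_j replaced by ∂_θ Q_j, computed with constant variables. Evaluation at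
  -- constants commutes with ∂_θ, so the values of F at Y and at ε are those of f at the generic
  -- point and at its specialisation.
  let F : MvPolynomial ι K := eval₂Hom C (fun v => T₁.op v.2 (Q v.1)) f
  have hF : aeval Y F = 0 := by
    have h1 := GRing.IsHom.eval₂ hT₁ hX hφ hY
    rw [← (hr f).2 hf]
    change eval₂Hom (algebraMap K L) Y F = _
    simp only [F, coe_eval₂Hom]
    rw [← coe_eval₂Hom, hom_eval₂]
    congr 1
    · ext a; exact eval₂Hom_C _ _ _
    · funext v
      refine (h1.op v.2 _).trans ?_
      rw [← hQ]
      rfl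
  have h2 := hspec F hF
  have h1 := GRing.IsHom.eval₂ hT₁ hX (GRing.IsHom.id S.toGRing) hε
  rw [← h2]
  change _ = eval₂Hom (RingHom.id K) ε F
  simp only [F, coe_eval₂Hom]
  rw [← coe_eval₂Hom, hom_eval₂, eval, coe_eval₂Hom]
  congr 1
  · ext a; exact (eval₂Hom_C _ _ _).symm
  · funext v
    exact (h1.op v.2 (Q v.1)).symm

end FiniteGroupSchemeDCF

/-! ### Existence of extensions satisfying the geometric axioms -/

namespace FiniteGroupSchemeDCF

open MvPolynomial GFieldStructure

namespace GRing

variable {p e : ℕ} {G : Type u} [Group G]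

/-- Ultraproducts of `𝔤`-fields. -/
theorem exists_ultraproduct {ι : Type w} (𝒰 : Ultrafilter ι) (L : ι → Type w) [∀ i, Field (L i)]
    (T : ∀ i, GRing p e G (L i)) :
    ∃ (U : Type w) (_ : Field U) (V : GRing p e G U) (π : (∀ i, L i) →+* U),
      IsHom (GRing.pi T) V π ∧ ∀ x, π x = 0 ↔ ∀ᶠ i in 𝒰, x i = 0 := by
  classical
  let I : Ideal (∀ i, L i) :=
    { carrier := {x | ∀ᶠ i in 𝒰, x i = 0}
      add_mem' := fun hx hy => by
        filter_upwards [hx, hy] with i hx hy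
        rw [Pi.add_apply, hx, hy, add_zero]
      zero_mem' := Filter.Eventually.of_forall fun i => rfl
      smul_mem' := fun c x hx => by
        filter_upwards [hx] with i hx
        rw [smul_eq_mul, Pi.mul_apply, hx, mul_zero] }
  have hI : ∀ x, x ∈ I ↔ ∀ᶠ i in 𝒰, x i = 0 := fun x => Iff.rfl
  have hmax : I.IsMaximal := by
    refine Ideal.isMaximal_iff.2 ⟨fun h => ?_, fun J x hIJ hx hxJ => ?_⟩
    · obtain ⟨i, hi⟩ := ((hI 1).1 h).exists
      exact one_ne_zero hi
    · rw [hI, Ultrafilter.eventually_not.symm] at hx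
      have h1 : 1 - x * (fun i => (x i)⁻¹) ∈ J := hIJ ((hI _).2 (by
        filter_upwards [hx] with i hi
        rw [Pi.sub_apply, Pi.mul_apply, mul_inv_cancel₀ hi, Pi.one_apply, sub_self]))
      rw [← sub_add_cancel 1 (x * fun i => (x i)⁻¹)]
      exact J.add_mem h1 (J.mul_mem_right _ hxJ)
  refine ⟨_, Ideal.Quotient.field I, (GRing.pi T).quotient I (fun i x hx => ?_) (fun g x hx => ?_),
    Ideal.Quotient.mk I, quotient_isHom .., fun x => ?_⟩
  · rw [hI] at hx ⊢
    filter_upwards [hx] with s hs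
    rw [pi_D_apply, hs, map_zero]
  · rw [hI] at hx ⊢
    filter_upwards [hx] with s hs
    rw [pi_σ_apply, hs, map_zero]
  · rw [Ideal.Quotient.eq_zero_iff_mem, hI]

section DirectLimit

variable {X : ℕ → Type w} [∀ n, Field (X n)] (g : ∀ n, X n →+* X (n + 1))

/-- The transition maps of a sequence of field extensions. -/
def transition (i j : ℕ) (h : i ≤ j) : X i →+* X j :=
  Nat.leRec (motive := fun j _ => X i →+* X j) (RingHom.id _) (fun k _ φ => (g k).comp φ) h

theorem transition_self (i : ℕ) : transition g i i le_rfl = RingHom.id _ := Nat.leRec_self ..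

theorem transition_succ (i j : ℕ) (h : i ≤ j) :
    transition g i (j + 1) (h.trans j.le_succ) = (g j).comp (transition g i j h) :=
  Nat.leRec_succ ..

theorem transition_transition {i j k : ℕ} (hij : i ≤ j) (hjk : j ≤ k) (x : X i) :
    transition g j k hjk (transition g i j hij x) = transition g i k (hij.trans hjk) x := by
  induction k, hjk using Nat.le_induction with
  | base => rw [transition_self]; rfl
  | succ k hjk ih =>
    rw [transition_succ g j k hjk, transition_succ g i k (hij.trans hjk), RingHom.comp_apply, ih]
    rfl

theorem isHom_transition {T : ∀ n, GRing p e G (X n)} (hg : ∀ n, IsHom (T n) (T (n + 1)) (g n))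
    (i j : ℕ) (h : i ≤ j) : IsHom (T i) (T j) (transition g i j h) := by
  induction j, h using Nat.le_induction with
  | base => rw [transition_self]; exact IsHom.id _
  | succ j h ih => rw [transition_succ g i j h]; exact (hg j).comp ih

/-- Unions of chains of `𝔤`-fields. -/
theorem exists_directLimit {T : ∀ n, GRing p e G (X n)}
    (hg : ∀ n, IsHom (T n) (T (n + 1)) (g n)) :
    ∃ (L : Type w) (_ : Field L) (U : GRing p e G L) (φ : ∀ n, X n →+* L),
      (∀ n, IsHom (T n) U (φ n)) ∧ (∀ n x, φ (n + 1) (g n x) = φ n x) ∧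
        ∀ x, ∃ n y, φ n y = x := by
  let f := transition g
  have hf := isHom_transition g hg
  have : DirectedSystem X (f · · ·) :=
    ⟨fun i x => by change transition g i i _ x = x; rw [transition_self]; rfl,
      fun k j i hij hjk x => transition_transition g hij hjk x⟩
  let L := DirectLimit X f
  let φ : ∀ n, X n →+* L := fun n =>
    { toFun := fun x => ⟦⟨n, x⟩⟧
      map_one' := (DirectLimit.one_def n).symm
      map_mul' := fun x y => (DirectLimit.mul_def n x y).symm
      map_zero' := (DirectLimit.zero_def n).symm
      map_add' := fun x y => (DirectLimit.add_def n x y).symm }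
  have hφ : ∀ z : L, ∃ n x, z = φ n x := fun z => DirectLimit.exists_eq_mk f z
  have hφ₂ : ∀ z t : L, ∃ n x y, z = φ n x ∧ t = φ n y := fun z t => DirectLimit.exists_eq_mk₂ f z t
  let D : Fin e → L → L := fun i => DirectLimit.map f f (fun n => (T n).D i)
    fun m n h x => (hf m n h).D i x
  let σ : G → L → L := fun i => DirectLimit.map f f (fun n => (T n).σ i)
    fun m n h x => (hf m n h).σ i x
  have hD : ∀ i n x, D i (φ n x) = φ n ((T n).D i x) := fun i n x => rfl
  have hσ : ∀ i n x, σ i (φ n x) = φ n ((T n).σ i x) := fun i n x => rfl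
  let D' : Fin e → Derivation ℤ L L := fun i => Derivation.mk'
    ({ toFun := D i
       map_zero' := by rw [← map_zero (φ 0), hD, map_zero]
       map_add' := fun z t => by
        obtain ⟨n, x, y, rfl, rfl⟩ := hφ₂ z t
        rw [← map_add, hD, hD, hD, map_add, map_add] } : L →+ L).toIntLinearMap
    (fun z t => by
      obtain ⟨n, x, y, rfl, rfl⟩ := hφ₂ z t
      change D i (φ n x * φ n y) = φ n x * D i (φ n y) + φ n y * D i (φ n x)
      rw [← map_mul, hD, hD, hD, Derivation.leibniz, map_add, smul_eq_mul, smul_eq_mul, map_mul,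
        map_mul])
  have hD' : ∀ i n x, D' i (φ n x) = φ n ((T n).D i x) := fun i n x => rfl
  let σ' : G → L →+* L := fun g =>
    { toFun := σ g
      map_one' := by rw [← map_one (φ 0), hσ, map_one]
      map_mul' := fun z t => by
        obtain ⟨n, x, y, rfl, rfl⟩ := hφ₂ z t
        rw [← map_mul, hσ, hσ, hσ, map_mul, map_mul]
      map_zero' := by rw [← map_zero (φ 0), hσ, map_zero]
      map_add' := fun z t => by
        obtain ⟨n, x, y, rfl, rfl⟩ := hφ₂ z t
        rw [← map_add, hσ, hσ, hσ, map_add, map_add] }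
  have hσ' : ∀ g n x, σ' g (φ n x) = φ n ((T n).σ g x) := fun i n x => rfl
  refine ⟨L, inferInstance,
    { D := D'
      σ := σ'
      σ_one := fun z => by
        obtain ⟨n, x, rfl⟩ := hφ z
        rw [hσ', (T n).σ_one]
      σ_mul := fun g h z => by
        obtain ⟨n, x, rfl⟩ := hφ z
        rw [hσ', hσ', hσ', (T n).σ_mul]
      D_comm := fun i j z => by
        obtain ⟨n, x, rfl⟩ := hφ z
        rw [hD', hD', hD', hD', (T n).D_comm]
      D_pow := fun i z => by
        obtain ⟨n, x, rfl⟩ := hφ z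
        have h : ∀ k, (D' i)^[k] (φ n x) = φ n (((T n).D i)^[k] x) := fun k => by
          induction k with
          | zero => rfl
          | succ k ih => rw [Function.iterate_succ_apply', Function.iterate_succ_apply', ih, hD']
        rw [h, (T n).D_pow, map_zero]
      σ_D := fun g i z => by
        obtain ⟨n, x, rfl⟩ := hφ z
        rw [hD', hσ', hσ', hD', (T n).σ_D] }, φ, fun n => ⟨fun i x => rfl, fun g x => rfl⟩,
    fun n x => ?_, fun z => ?_⟩
  · have h := DirectLimit.mk_apply (f := f) n (n + 1) x n.le_succ
    rw [show f n (n + 1) n.le_succ x = g n x by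
      change transition g n (n + 1) (le_rfl.trans n.le_succ) x = _
      rw [transition_succ g n n le_rfl, transition_self]
      rfl] at h
    exact h
  · obtain ⟨n, x, rfl⟩ := hφ z
    exact ⟨n, x, rfl⟩

end DirectLimit

/-- The constants of `T` contain a point of `f = 0`, `h ≠ 0`. -/
def Solves {K L : Type*} [Field K] [Field L] (T : GRing p e G L) (φ : K →+* L)
    (q : Σ m, MvPolynomial (Fin m) K × MvPolynomial (Fin m) K) : Prop :=
  ∃ x : Fin q.1 → L, (∀ j, T.IsConst (x j)) ∧ eval₂Hom φ x q.2.1 = 0 ∧ eval₂Hom φ x q.2.2 ≠ 0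

theorem Solves.map {K L L' : Type*} [Field K] [Field L] [Field L'] {T : GRing p e G L}
    {T' : GRing p e G L'} {φ : K →+* L} {ψ : L →+* L'} (hψ : IsHom T T' ψ)
    {q : Σ m, MvPolynomial (Fin m) K × MvPolynomial (Fin m) K} (h : T.Solves φ q) :
    T'.Solves (ψ.comp φ) q := by
  obtain ⟨x, hx, h0, h1⟩ := h
  have hev : ∀ f, eval₂Hom (ψ.comp φ) (fun j => ψ (x j)) f = ψ (eval₂Hom φ x f) := fun f => by
    rw [← map_eval₂Hom]
  exact ⟨fun j => ψ (x j), fun j => hψ.isConst (hx j), by rw [hev, h0, map_zero],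
    by rwa [hev, Ne, map_eq_zero]⟩

/-- An extension which solves every problem over `K` that is solved in a further extension. -/
theorem exists_maximal_extension {K : Type w} [Field K] (S : GRing p e G K) :
    ∃ (L : Type w) (_ : Field L) (T : GRing p e G L) (φ : K →+* L), IsHom S T φ ∧
      ∀ (L' : Type w) (_ : Field L') (T' : GRing p e G L') (ψ : L →+* L'), IsHom T T' ψ →
        ∀ q, T'.Solves (ψ.comp φ) q → T.Solves φ q := by
  let Q := Σ m, MvPolynomial (Fin m) K × MvPolynomial (Fin m) K
  -- Zorn's lemma is applied to sets of problems solvable in one common extension, rather than to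
  -- extensions. A maximal such set contains every problem which becomes solvable above its
  -- extension.
  let 𝒮 : Set (Set Q) := {s | ∃ (L : Type w) (_ : Field L) (T : GRing p e G L) (φ : K →+* L),
    IsHom S T φ ∧ ∀ q ∈ s, T.Solves φ q}
  obtain ⟨s, hs⟩ := zorn_subset 𝒮 (fun c hc hchain => by
    refine ⟨⋃₀ c, ?_, fun s hs => Set.subset_sUnion_of_mem hs⟩
    rcases c.eq_empty_or_nonempty with rfl | hne
    · exact ⟨K, inferInstance, S, RingHom.id K, IsHom.id S, by simp⟩
    have : Nonempty c := hne.to_subtype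
    have : IsDirectedOrder c := ⟨fun s t => by
      rcases hchain.total s.2 t.2 with h | h
      · exact ⟨t, h, le_rfl⟩
      · exact ⟨s, le_rfl, h⟩⟩
    choose L F T φ hφ hsol using fun s : c => hc s.2
    -- The extensions chosen along the chain come without maps between them, so an ultraproduct
    -- replaces the union. A problem in s is solved at every t ⊇ s, hence almost everywhere.
    let 𝒰 : Ultrafilter c := Ultrafilter.of Filter.atTop
    obtain ⟨U, _, V, π, hπ, hπ0⟩ := exists_ultraproduct 𝒰 L T
    have hdiag : IsHom S (GRing.pi T) (RingHom.pi φ) :=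
      ⟨fun i x => funext fun s => (hφ s).D i x, fun g x => funext fun s => (hφ s).σ g x⟩
    refine ⟨U, inferInstance, V, π.comp (RingHom.pi φ), hπ.comp hdiag, ?_⟩
    rintro q ⟨s, hs, hq⟩
    have hsol' : ∀ t : c, ∃ x : Fin q.1 → L t, (∀ j, (T t).IsConst (x j)) ∧
        (s ⊆ t.1 → eval₂Hom (φ t) x q.2.1 = 0 ∧ eval₂Hom (φ t) x q.2.2 ≠ 0) := fun t => by
      by_cases hst : s ⊆ t.1
      · obtain ⟨x, h1, h2⟩ := hsol t q (hst hq)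
        exact ⟨x, h1, fun _ => h2⟩
      · exact ⟨fun _ => 0, fun _ => (T t).constants.zero_mem, fun h => absurd h hst⟩
    choose x hx hx' using hsol'
    have htail : ∀ᶠ t : c in 𝒰, s ⊆ t.1 :=
      Ultrafilter.of_le _ (Filter.eventually_ge_atTop (⟨s, hs⟩ : c))
    have hev : ∀ f, eval₂Hom (π.comp (RingHom.pi φ)) (fun j => π fun t => x t j) f =
        π fun t => eval₂Hom (φ t) (x t) f := fun f => by
      rw [← map_eval₂Hom]
      congr 1
      funext t
      exact map_eval₂Hom (RingHom.pi φ) (fun j t => x t j) (Pi.evalRingHom L t) f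
    refine ⟨fun j => π fun t => x t j, fun j => hπ.isConst ⟨fun i => funext fun t => (hx t j).1 i,
      fun g => funext fun t => (hx t j).2 g⟩, ?_, ?_⟩
    · rw [hev, hπ0]
      filter_upwards [htail] with t ht using (hx' t ht).1
    · rw [hev, Ne, hπ0, ← Ultrafilter.eventually_not]
      filter_upwards [htail] with t ht using (hx' t ht).2)
  obtain ⟨L, _, T, φ, hφ, hsol⟩ := hs.prop
  refine ⟨L, inferInstance, T, φ, hφ, fun L' _ T' ψ hψ q hq => hsol q ?_⟩
  have h1 : insert q s ∈ 𝒮 := ⟨L', inferInstance, T', ψ.comp φ, hψ.comp hφ, fun r hr => by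
    rcases hr with rfl | hr
    · exact hq
    · exact (hsol r hr).map hψ⟩
  exact hs.le_of_ge h1 (Set.subset_insert q s) (Set.mem_insert q s)

/-- Every `𝔤`-field has an extension in which irreducible hypersurfaces over the constants have
dense sets of constant points. -/
theorem exists_extension_hypersurfacePoints [Fact p.Prime] {K : Type w} [Field K] [CharP K p]
    (S : GRing p e G K) :
    ∃ (L : Type w) (_ : Field L) (T : GRing p e G L) (φ : K →+* L), IsHom S T φ ∧
      T.HypersurfacePoints := by
  let A := Σ (X : Type w) (_ : Field X), GRing p e G X
  let _ : ∀ a : A, Field a.1 := fun a => a.2.1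
  have hnext : ∀ a : A, ∃ (b : A) (φ : a.1 →+* b.1), IsHom a.2.2 b.2.2 φ ∧
      ∀ (L' : Type w) (_ : Field L') (T' : GRing p e G L') (ψ : b.1 →+* L'), IsHom b.2.2 T' ψ →
        ∀ q, T'.Solves (ψ.comp φ) q → b.2.2.Solves φ q := fun a => by
    obtain ⟨L, hL, T, φ, hφ, h⟩ := exists_maximal_extension a.2.2
    exact ⟨⟨L, hL, T⟩, φ, hφ, h⟩
  choose next g hg hmax using hnext
  -- Each stage handles the problems with coefficients in the previous one, so countably many stages
  -- close the process off.
  let Z : ℕ → A := fun n => next^[n] ⟨K, inferInstance, S⟩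
  have hZ : ∀ n, Z (n + 1) = next (Z n) := fun n => Function.iterate_succ_apply' ..
  have hstep : ∀ n, ∃ φ : (Z n).1 →+* (Z (n + 1)).1, IsHom (Z n).2.2 (Z (n + 1)).2.2 φ ∧
      ∀ (L' : Type w) (_ : Field L') (T' : GRing p e G L') (ψ : (Z (n + 1)).1 →+* L'),
        IsHom (Z (n + 1)).2.2 T' ψ →
        ∀ q, T'.Solves (ψ.comp φ) q → (Z (n + 1)).2.2.Solves φ q := fun n => by
    rw [hZ]
    exact ⟨g _, hg _, hmax _⟩
  choose γ hγ hγmax using hstep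
  obtain ⟨L, _, T, φ, hφ, hcomp, hsurj⟩ := exists_directLimit γ hγ
  have hchar₀ : CharP (Z 0).1 p := inferInstanceAs (CharP K p)
  have hchar : CharP L p := charP_of_injective_ringHom (φ 0).injective p
  have hle : ∀ m n, m ≤ n → ∀ x, ∃ y, φ n y = φ m x := fun m n h x => by
    induction n, h using Nat.le_induction with
    | base => exact ⟨x, rfl⟩
    | succ n h ih =>
      obtain ⟨y, hy⟩ := ih
      exact ⟨γ n y, by rw [hcomp, hy]⟩
  refine ⟨L, inferInstance, T, φ 0, hφ 0, fun m f h hf hh hirr hfh => ?_⟩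
  obtain ⟨L', _, T', ψ, x, hψ, hx, hxf, hxh⟩ := T.exists_extension_hypersurface hf hirr hfh
  have hlift : ∀ q : MvPolynomial (Fin m) L, ∃ n, ∀ k, n ≤ k → ∃ q', MvPolynomial.map (φ k) q' = q := by
    intro q
    induction q using MvPolynomial.induction_on with
    | C a =>
      obtain ⟨n, y, rfl⟩ := hsurj a
      refine ⟨n, fun k hk => ?_⟩
      obtain ⟨z, hz⟩ := hle n k hk y
      exact ⟨C z, by rw [map_C, hz]⟩
    | add q r hq hr =>
      obtain ⟨n, hn⟩ := hq
      obtain ⟨m, hm⟩ := hr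
      refine ⟨max n m, fun k hk => ?_⟩
      obtain ⟨q', rfl⟩ := hn k ((le_max_left n m).trans hk)
      obtain ⟨r', rfl⟩ := hm k ((le_max_right n m).trans hk)
      exact ⟨q' + r', map_add ..⟩
    | mul_X q i hq =>
      obtain ⟨n, hn⟩ := hq
      refine ⟨n, fun k hk => ?_⟩
      obtain ⟨q', rfl⟩ := hn k hk
      exact ⟨q' * X i, by rw [map_mul, map_X]⟩
  obtain ⟨n₁, hn₁⟩ := hlift f
  obtain ⟨n₂, hn₂⟩ := hlift h
  obtain ⟨n, hn₁', hn₂'⟩ : ∃ n, n₁ ≤ n ∧ n₂ ≤ n := ⟨_, le_max_left n₁ n₂, le_max_right n₁ n₂⟩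
  obtain ⟨f', rfl⟩ := hn₁ n hn₁'
  obtain ⟨h', rfl⟩ := hn₂ n hn₂'
  have hcomp' : (φ (n + 1)).comp (γ n) = φ n := RingHom.ext (hcomp n)
  -- The coefficients live at stage n and the problem is solved in L', which lies above stage n + 1;
  -- by maximality it was already solved at stage n + 1.
  have h1 := hγmax n L' inferInstance T' (ψ.comp (φ (n + 1))) (hψ.comp (hφ (n + 1))) ⟨m, f', h'⟩
    ⟨x, hx, by
      rw [RingHom.comp_assoc, hcomp']
      simpa [eval₂_map] using hxf, by
      rw [RingHom.comp_assoc, hcomp']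
      simpa [eval₂_map] using hxh⟩
  obtain ⟨y, hy, hy0, hy1⟩ := h1.map (hφ (n + 1))
  rw [hcomp'] at hy0 hy1
  exact ⟨y, hy, by rw [eval_map]; exact hy0, by rw [eval_map]; exact hy1⟩

end GRing

/-- Dual elements and free points persist in extensions, whereas `HypersurfacePoints` refers to all
polynomials over the field itself and has to be arranged last. -/
theorem GFieldStructure.exists_geometric_extension {p e : ℕ} {G : Type u} [Group G] [Finite G]
    [Fact p.Prime] {K : Type w} [Field K] (S : GFieldStructure p e G K) :
    ∃ (L : Type w) (_ : Field L) (T : GFieldStructure p e G L) (φ : K →+* L),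
      GRing.IsHom S.toGRing T.toGRing φ ∧ T.Geometric := by
  have := S.charP
  obtain ⟨L₁, _, T₁, φ₁, b, hφ₁, hb⟩ := S.toGRing.exists_extension_isDual
  have := charP_of_injective_ringHom φ₁.injective p
  obtain ⟨L₂, _, T₂, φ₂, y, hφ₂, hy⟩ := T₁.exists_extension_isFreePoint
  have := charP_of_injective_ringHom φ₂.injective p
  obtain ⟨L, _, T, φ, hφ, hT⟩ := T₂.exists_extension_hypersurfacePoints
  have hc := charP_of_injective_ringHom φ.injective p
  exact ⟨L, inferInstance, T.toGField hc, _, hφ.comp (hφ₂.comp hφ₁),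
    geometric_of_hypersurfacePoints (T.toGField hc) (hφ.isDual (hφ₂.isDual hb)) (hφ.isFreePoint hy)
      hT⟩

end FiniteGroupSchemeDCF

/-! ### Models of 𝔤-DF as 𝔤-fields -/

namespace FiniteGroupSchemeDCF

section Realize

variable {p e : ℕ} {G : Type u} [Group G] {K : Type w} [(gLang e G).Structure K] {α : Type*}

section

variable [Field K] {S : GFieldStructure p e G K}

theorem Interprets.realize_tAdd (h : Interprets K S) (t s : (gLang e G).Term α) (v : α → K) :
    (tAdd t s).realize v = t.realize v + s.realize v := by
  simp [tAdd, h.add]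

theorem Interprets.realize_tMul (h : Interprets K S) (t s : (gLang e G).Term α) (v : α → K) :
    (tMul t s).realize v = t.realize v * s.realize v := by
  simp [tMul, h.mul]

theorem Interprets.realize_tZero (h : Interprets K S) (v : α → K) :
    (tZero : (gLang e G).Term α).realize v = 0 := h.zero _

theorem Interprets.realize_tOne (h : Interprets K S) (v : α → K) :
    (tOne : (gLang e G).Term α).realize v = 1 := h.one _

theorem Interprets.realize_tDer (h : Interprets K S) (i : Fin e) (t : (gLang e G).Term α)
    (v : α → K) : (tDer i t).realize v = S.D i (t.realize v) := by
  simp [tDer, h.der]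

theorem Interprets.realize_tAct (h : Interprets K S) (g : G) (t : (gLang e G).Term α)
    (v : α → K) : (tAct g t).realize v = S.σ g (t.realize v) := by
  simp [tAct, h.act]

theorem Interprets.realize_iterate_tDer (h : Interprets K S) (i : Fin e) (n : ℕ)
    (t : (gLang e G).Term α) (v : α → K) :
    ((tDer i)^[n] t).realize v = (S.D i)^[n] (t.realize v) := by
  induction n with
  | zero => rfl
  | succ n ih => rw [Function.iterate_succ_apply', Function.iterate_succ_apply', h.realize_tDer, ih]

variable (K) in
/-- The ring structure underlying a `𝔤`-field. -/
@[reducible]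
def Interprets.compatibleRing (h : Interprets K S) : Ring.CompatibleRing K :=
  { (LHom.sumInl : FirstOrder.Language.ring →ᴸ gLang e G).reduct K with
    funMap_add := h.add
    funMap_mul := h.mul
    funMap_neg := h.neg
    funMap_zero := h.zero
    funMap_one := h.one }

theorem Interprets.model_gDF (h : Interprets K S) : K ⊨ gDF p e G := by
  have := S.charP
  let _ := h.compatibleRing K
  have hexp : (LHom.sumInl : FirstOrder.Language.ring →ᴸ gLang e G).IsExpansionOn K :=
    ⟨fun _ _ => rfl, fun _ _ => rfl⟩
  refine Theory.model_union_iff.2 ⟨?_, ?_⟩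
  · rw [LHom.onTheory_model]
    infer_instance
  · rw [Theory.model_iff]
    rintro _ (_ | _ | _ | _ | _ | _ | _ | _ | _ | _) <;>
      simp [Sentence.Realize, Formula.Realize, h.realize_tAdd, h.realize_tMul, h.realize_tZero,
        h.realize_tOne, h.realize_tDer, h.realize_tAct, h.realize_iterate_tDer, S.D_pow, S.σ_D]
    exact fun x => S.D_comm _ _ x

end

theorem exists_interprets (h : K ⊨ gDF p e G) :
    ∃ (_ : Field K) (S : GFieldStructure p e G K), Interprets K S := by
  obtain ⟨h1, h2⟩ := Theory.model_union_iff.1 h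
  let _ : FirstOrder.Language.ring.Structure K :=
    (LHom.sumInl : FirstOrder.Language.ring →ᴸ gLang e G).reduct K
  have hexp : (LHom.sumInl : FirstOrder.Language.ring →ᴸ gLang e G).IsExpansionOn K :=
    ⟨fun _ _ => rfl, fun _ _ => rfl⟩
  rw [LHom.onTheory_model] at h1
  have hf : Theory.field.Model K := (Theory.model_union_iff.1 h1).1
  let _ : Field K := Field.fieldOfModelField K
  let cr : Ring.CompatibleRing K := Field.compatibleRingOfModelField K
  have hchar : CharP K p := Field.charP_of_model_fieldOfChar p K
  let d : Fin e → K → K := fun i x => Structure.funMap (derSym i : (gLang e G).Functions 1) ![x]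
  let s : G → K → K := fun g x => Structure.funMap (actSym g : (gLang e G).Functions 1) ![x]
  have hadd : ∀ x : Fin 2 → K, Structure.funMap (addSym : (gLang e G).Functions 2) x = x 0 + x 1 :=
    cr.funMap_add
  have hmul : ∀ x : Fin 2 → K, Structure.funMap (mulSym : (gLang e G).Functions 2) x = x 0 * x 1 :=
    cr.funMap_mul
  have hder : ∀ i (x : Fin 1 → K),
      Structure.funMap (derSym i : (gLang e G).Functions 1) x = d i (x 0) := fun i x => by
    rw [show x = ![x 0] from funext fun j => by rw [Subsingleton.elim j 0]; rfl]
    rfl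
  have hact : ∀ g (x : Fin 1 → K),
      Structure.funMap (actSym g : (gLang e G).Functions 1) x = s g (x 0) := fun i x => by
    rw [show x = ![x 0] from funext fun j => by rw [Subsingleton.elim j 0]; rfl]
    rfl
  have rA : ∀ {n} (t₁ t₂ : (gLang e G).Term (Empty ⊕ Fin n)) (v : Empty ⊕ Fin n → K),
      (tAdd t₁ t₂).realize v = t₁.realize v + t₂.realize v := fun t₁ t₂ v => by simp [tAdd, hadd]
  have rM : ∀ {n} (t₁ t₂ : (gLang e G).Term (Empty ⊕ Fin n)) (v : Empty ⊕ Fin n → K),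
      (tMul t₁ t₂).realize v = t₁.realize v * t₂.realize v := fun t₁ t₂ v => by simp [tMul, hmul]
  have r0 : ∀ {n} (v : Empty ⊕ Fin n → K), (tZero : (gLang e G).Term _).realize v = 0 :=
    fun v => cr.funMap_zero _
  have r1 : ∀ {n} (v : Empty ⊕ Fin n → K), (tOne : (gLang e G).Term _).realize v = 1 :=
    fun v => cr.funMap_one _
  have rD : ∀ {n} i (t : (gLang e G).Term (Empty ⊕ Fin n)) (v : Empty ⊕ Fin n → K),
      (tDer i t).realize v = d i (t.realize v) := fun i t v => by simp [tDer, hder]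
  have rS : ∀ {n} g (t : (gLang e G).Term (Empty ⊕ Fin n)) (v : Empty ⊕ Fin n → K),
      (tAct g t).realize v = s g (t.realize v) := fun i t v => by simp [tAct, hact]
  have rI : ∀ {n} i m (t : (gLang e G).Term (Empty ⊕ Fin n)) (v : Empty ⊕ Fin n → K),
      ((tDer i)^[m] t).realize v = (d i)^[m] (t.realize v) := fun i m t v => by
    induction m with
    | zero => rfl
    | succ m ih => rw [Function.iterate_succ_apply', Function.iterate_succ_apply', rD, ih]
  have hax : ∀ φ, OpAxiom p e G φ → K ⊨ φ := fun φ hφ => (Theory.model_iff _).1 h2 φ hφ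
  have d_add : ∀ i x y, d i (x + y) = d i x + d i y := fun i x y => by
    have := hax _ (.der_add i)
    simp only [Sentence.Realize, Formula.Realize, BoundedFormula.realize_all,
      BoundedFormula.realize_bdEqual, rA, rD] at this
    exact this x y
  have d_mul : ∀ i x y, d i (x * y) = x * d i y + y * d i x := fun i x y => by
    have := hax _ (.der_mul i)
    simp only [Sentence.Realize, Formula.Realize, BoundedFormula.realize_all,
      BoundedFormula.realize_bdEqual, rA, rM, rD] at this
    exact this x y
  have d_comm : ∀ i j x, d i (d j x) = d j (d i x) := fun i j x => by
    have := hax _ (.der_comm i j)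
    simp only [Sentence.Realize, Formula.Realize, BoundedFormula.realize_all,
      BoundedFormula.realize_bdEqual, rD] at this
    exact this x
  have d_pow : ∀ i x, (d i)^[p] x = 0 := fun i x => by
    have := hax _ (.der_pow i)
    simp only [Sentence.Realize, Formula.Realize, BoundedFormula.realize_all,
      BoundedFormula.realize_bdEqual, rI, r0] at this
    exact this x
  have s_add : ∀ g x y, s g (x + y) = s g x + s g y := fun g x y => by
    have := hax _ (.act_add g)
    simp only [Sentence.Realize, Formula.Realize, BoundedFormula.realize_all,
      BoundedFormula.realize_bdEqual, rA, rS] at this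
    exact this x y
  have s_mul : ∀ g x y, s g (x * y) = s g x * s g y := fun g x y => by
    have := hax _ (.act_mul g)
    simp only [Sentence.Realize, Formula.Realize, BoundedFormula.realize_all,
      BoundedFormula.realize_bdEqual, rM, rS] at this
    exact this x y
  have s_one : ∀ g, s g 1 = 1 := fun g => by
    have := hax _ (.act_one g)
    simp only [Sentence.Realize, Formula.Realize, BoundedFormula.realize_bdEqual, rS, r1] at this
    exact this
  have one_s : ∀ x, s 1 x = x := fun x => by
    have := hax _ .one_act
    simp only [Sentence.Realize, Formula.Realize, BoundedFormula.realize_all,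
      BoundedFormula.realize_bdEqual, rS] at this
    exact this x
  have mul_s : ∀ g h x, s (g * h) x = s g (s h x) := fun g h x => by
    have := hax _ (.mul_act g h)
    simp only [Sentence.Realize, Formula.Realize, BoundedFormula.realize_all,
      BoundedFormula.realize_bdEqual, rS] at this
    exact this x
  have s_d : ∀ g i x, s g (d i x) = d i (s g x) := fun g i x => by
    have := hax _ (.act_der g i)
    simp only [Sentence.Realize, Formula.Realize, BoundedFormula.realize_all,
      BoundedFormula.realize_bdEqual, rS, rD] at this
    exact this x
  let T : GRing p e G K :=
    { D := fun i => Derivation.mk' (AddMonoidHom.mk' (d i) (d_add i)).toIntLinearMap (d_mul i)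
      σ := fun g => RingHom.mk' ⟨⟨s g, s_one g⟩, s_mul g⟩ (s_add g)
      σ_one := one_s
      σ_mul := mul_s
      D_comm := d_comm
      D_pow := d_pow
      σ_D := s_d }
  exact ⟨inferInstance, T.toGField hchar,
    { add := hadd
      mul := hmul
      neg := cr.funMap_neg
      zero := cr.funMap_zero
      one := cr.funMap_one
      der := hder
      act := hact }⟩

end Realize
end FiniteGroupSchemeDCF

/-! ### First-order definability of properties of 𝔤-fields -/

namespace FiniteGroupSchemeDCF

open MvPolynomial

section Definability

variable {p e : ℕ} {G : Type u} [Group G] {α β : Type*}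

/-- The function `t` is given by the same term in all `𝔤`-fields. -/
def IsTerm (t : ∀ (K : Type w) [Field K], GFieldStructure p e G K → (α → K) → K) : Prop :=
  ∃ τ : (gLang e G).Term α, ∀ (K : Type w) [(gLang e G).Structure K] [Field K]
    (S : GFieldStructure p e G K), Interprets K S → ∀ v : α → K, τ.realize v = t K S v

/-- The property `R` is given by the same formula in all `𝔤`-fields. -/
def IsFormula (R : ∀ (K : Type w) [Field K], GFieldStructure p e G K → (α → K) → Prop) : Prop :=
  ∃ φ : (gLang e G).Formula α, ∀ (K : Type w) [(gLang e G).Structure K] [Field K]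
    (S : GFieldStructure p e G K), Interprets K S → ∀ v : α → K, φ.Realize v ↔ R K S v

section Term

variable {t s : ∀ (K : Type w) [Field K], GFieldStructure p e G K → (α → K) → K}

theorem IsTerm.var (a : α) :
    IsTerm (p := p) (G := G) (e := e) fun (K : Type w) _ _ (v : α → K) => v a :=
  ⟨Term.var a, fun _ _ _ _ _ _ => rfl⟩

theorem IsTerm.zero : IsTerm (p := p) (G := G) (e := e) fun (K : Type w) _ _ (_ : α → K) => 0 :=
  ⟨tZero, fun _ _ _ _ h v => h.realize_tZero v⟩

theorem IsTerm.one : IsTerm (p := p) (G := G) (e := e) fun (K : Type w) _ _ (_ : α → K) => 1 :=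
  ⟨tOne, fun _ _ _ _ h v => h.realize_tOne v⟩

theorem IsTerm.add (ht : IsTerm t) (hs : IsTerm s) :
    IsTerm fun K _ S v => t K S v + s K S v := by
  obtain ⟨τ, hτ⟩ := ht
  obtain ⟨ρ, hρ⟩ := hs
  exact ⟨tAdd τ ρ, fun K _ _ S h v => by rw [h.realize_tAdd, hτ K S h, hρ K S h]⟩

theorem IsTerm.mul (ht : IsTerm t) (hs : IsTerm s) :
    IsTerm fun K _ S v => t K S v * s K S v := by
  obtain ⟨τ, hτ⟩ := ht
  obtain ⟨ρ, hρ⟩ := hs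
  exact ⟨tMul τ ρ, fun K _ _ S h v => by rw [h.realize_tMul, hτ K S h, hρ K S h]⟩

theorem IsTerm.D (i : Fin e) (ht : IsTerm t) : IsTerm fun K _ S v => S.D i (t K S v) := by
  obtain ⟨τ, hτ⟩ := ht
  exact ⟨tDer i τ, fun K _ _ S h v => by rw [h.realize_tDer, hτ K S h]⟩

theorem IsTerm.σ (g : G) (ht : IsTerm t) : IsTerm fun K _ S v => S.σ g (t K S v) := by
  obtain ⟨τ, hτ⟩ := ht
  exact ⟨tAct g τ, fun K _ _ S h v => by rw [h.realize_tAct, hτ K S h]⟩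

theorem IsTerm.pow (ht : IsTerm t) (n : ℕ) : IsTerm fun K _ S v => t K S v ^ n := by
  induction n with
  | zero => simpa only [pow_zero] using IsTerm.one
  | succ n ih => simpa only [pow_succ] using ih.mul ht

theorem IsTerm.sum {ι : Type*} (A : Finset ι)
    {t : ι → ∀ (K : Type w) [Field K], GFieldStructure p e G K → (α → K) → K}
    (ht : ∀ i, IsTerm (t i)) : IsTerm fun K _ S v => ∑ i ∈ A, t i K S v := by
  classical
  induction A using Finset.induction_on with
  | empty => simpa only [Finset.sum_empty] using IsTerm.zero
  | insert i A hi ih => simpa only [Finset.sum_insert hi] using (ht i).add ih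

theorem IsTerm.prod {ι : Type*} (A : Finset ι)
    {t : ι → ∀ (K : Type w) [Field K], GFieldStructure p e G K → (α → K) → K}
    (ht : ∀ i, IsTerm (t i)) : IsTerm fun K _ S v => ∏ i ∈ A, t i K S v := by
  classical
  induction A using Finset.induction_on with
  | empty => simpa only [Finset.prod_empty] using IsTerm.one
  | insert i A hi ih => simpa only [Finset.prod_insert hi] using (ht i).mul ih

theorem IsTerm.eq (ht : IsTerm t) (hs : IsTerm s) :
    IsFormula fun K _ S v => t K S v = s K S v := by
  obtain ⟨τ, hτ⟩ := ht
  obtain ⟨ρ, hρ⟩ := hs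
  exact ⟨Term.equal τ ρ, fun K _ _ S h v => by rw [Formula.realize_equal, hτ K S h, hρ K S h]⟩

end Term

variable {R Q : ∀ (K : Type w) [Field K], GFieldStructure p e G K → (α → K) → Prop}

theorem IsFormula.const (P : Prop) :
    IsFormula (p := p) (G := G) (e := e) fun (K : Type w) _ _ (_ : α → K) => P := by
  by_cases hP : P
  · exact ⟨⊤, fun K _ _ S h v => by simp [hP]⟩
  · exact ⟨⊥, fun K _ _ S h v => by simp [hP]⟩

theorem IsFormula.imp (hR : IsFormula R) (hQ : IsFormula Q) :
    IsFormula fun K _ S v => R K S v → Q K S v := by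
  obtain ⟨φ, hφ⟩ := hR
  obtain ⟨ψ, hψ⟩ := hQ
  exact ⟨φ.imp ψ, fun K _ _ S h v => by rw [Formula.realize_imp, hφ K S h, hψ K S h]⟩

theorem IsFormula.not (hR : IsFormula R) : IsFormula fun K _ S v => ¬ R K S v :=
  hR.imp (IsFormula.const False)

theorem IsFormula.and (hR : IsFormula R) (hQ : IsFormula Q) :
    IsFormula fun K _ S v => R K S v ∧ Q K S v := by
  obtain ⟨φ, hφ⟩ := hR
  obtain ⟨ψ, hψ⟩ := hQ
  exact ⟨φ ⊓ ψ, fun K _ _ S h v => by rw [Formula.realize_inf, hφ K S h, hψ K S h]⟩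

theorem IsFormula.or (hR : IsFormula R) (hQ : IsFormula Q) :
    IsFormula fun K _ S v => R K S v ∨ Q K S v := by
  obtain ⟨φ, hφ⟩ := hR
  obtain ⟨ψ, hψ⟩ := hQ
  exact ⟨φ ⊔ ψ, fun K _ _ S h v => by rw [Formula.realize_sup, hφ K S h, hψ K S h]⟩

theorem IsFormula.forall_index {ι : Type*} [Finite ι]
    {R : ι → ∀ (K : Type w) [Field K], GFieldStructure p e G K → (α → K) → Prop}
    (hR : ∀ i, IsFormula (R i)) : IsFormula fun K _ S v => ∀ i, R i K S v := by
  choose φ hφ using hR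
  exact ⟨Formula.iInf φ, fun K _ _ S h v => by
    rw [Formula.realize_iInf]
    exact forall_congr' fun i => hφ i K S h v⟩

theorem IsFormula.all [Finite β]
    {R : ∀ (K : Type w) [Field K], GFieldStructure p e G K → (α ⊕ β → K) → Prop}
    (hR : IsFormula R) : IsFormula fun K _ S v => ∀ x : β → K, R K S (Sum.elim v x) := by
  obtain ⟨φ, hφ⟩ := hR
  exact ⟨φ.iAlls β, fun K _ _ S h v => by
    rw [Formula.realize_iAlls]
    exact forall_congr' fun x => hφ K S h _⟩

theorem IsFormula.ex [Finite β]
    {R : ∀ (K : Type w) [Field K], GFieldStructure p e G K → (α ⊕ β → K) → Prop}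
    (hR : IsFormula R) : IsFormula fun K _ S v => ∃ x : β → K, R K S (Sum.elim v x) := by
  obtain ⟨φ, hφ⟩ := hR
  exact ⟨φ.iExs β, fun K _ _ S h v => by
    rw [Formula.realize_iExs]
    exact exists_congr fun x => hφ K S h _⟩

theorem IsFormula.congr (hR : IsFormula R) (h : ∀ (K : Type w) [Field K]
    (S : GFieldStructure p e G K) (v : α → K), R K S v ↔ Q K S v) : IsFormula Q := by
  obtain ⟨φ, hφ⟩ := hR
  exact ⟨φ, fun K _ _ S hK v => (hφ K S hK v).trans (h K S v)⟩

/-- A first-order property of geometric `𝔤`-fields holds in all models of `𝔤-DCF`. -/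
theorem IsFormula.of_model_gDCF [NeZero p]
    {R : ∀ (K : Type w) [Field K], GFieldStructure p e G K → (Empty → K) → Prop}
    (hR : IsFormula R) (h : ∀ (K : Type w) [Field K] (S : GFieldStructure p e G K) (v : Empty → K),
      S.Geometric → R K S v) (K : Type w) [(gLang e G).Structure K] [Field K]
    (S : GFieldStructure p e G K) (hKS : Interprets K S) (hK : K ⊨ gDCF.{u, w} p e G)
    (v : Empty → K) : R K S v := by
  obtain ⟨φ, hφ⟩ := hR
  -- The sentence is itself a member of `gDCF`, which contains everything true in all geometric
  -- 𝔤-fields.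
  have h1 : K ⊨ (φ : (gLang e G).Sentence) := (Theory.model_iff _).1 hK φ
    fun L _ ⟨_, T, hT, hgeo⟩ => (hφ L T hT _).2 (h L T _ hgeo)
  rw [Subsingleton.elim v default]
  exact (hφ K S hKS _).1 h1

/-- The coefficients of the polynomial `P` are given by the same terms in all `𝔤`-fields. -/
def IsPoly {m : ℕ} (P : ∀ (K : Type w) [Field K], GFieldStructure p e G K → (α → K) →
    MvPolynomial (Fin m) K) : Prop :=
  ∃ F : Finset (Fin m →₀ ℕ), (∀ K [Field K] S v, (P K S v).support ⊆ F) ∧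
    ∀ s, IsTerm fun K _ S v => coeff s (P K S v)

variable {m : ℕ} {P P' : ∀ (K : Type w) [Field K], GFieldStructure p e G K → (α → K) →
  MvPolynomial (Fin m) K}

theorem IsPoly.zero : IsPoly (p := p) (G := G) (e := e)
    fun (K : Type w) _ _ (_ : α → K) => (0 : MvPolynomial (Fin m) K) :=
  ⟨∅, fun K _ S v => by simp, fun s => by simpa using IsTerm.zero⟩

theorem IsPoly.one : IsPoly (p := p) (G := G) (e := e)
    fun (K : Type w) _ _ (_ : α → K) => (1 : MvPolynomial (Fin m) K) := by
  classical
  refine ⟨{0}, fun K _ S v => by simp, fun s => ?_⟩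
  simp only [coeff_one]
  split_ifs
  exacts [IsTerm.one, IsTerm.zero]

theorem IsPoly.mul (hP : IsPoly P) (hP' : IsPoly P') :
    IsPoly fun K _ S v => P K S v * P' K S v := by
  classical
  obtain ⟨F, hF, hc⟩ := hP
  obtain ⟨F', hF', hc'⟩ := hP'
  open scoped Pointwise in
  refine ⟨F + F', fun K _ S v => (support_mul _ _).trans (Finset.add_subset_add (hF ..) (hF' ..)),
    fun s => ?_⟩
  simp only [coeff_mul]
  exact IsTerm.sum _ fun ab => (hc _).mul (hc' _)

theorem IsPoly.eq (hP : IsPoly P) (hP' : IsPoly P') :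
    IsFormula fun K _ S v => P K S v = P' K S v := by
  classical
  obtain ⟨F, hF, hc⟩ := hP
  obtain ⟨F', hF', hc'⟩ := hP'
  refine (IsFormula.forall_index fun s : ↥(F ∪ F') => (hc s).eq (hc' s)).congr
    fun K _ S v => ⟨fun h => ?_, fun h s => by rw [h]⟩
  ext s
  by_cases hs : s ∈ F ∪ F'
  · exact h ⟨s, hs⟩
  · rw [Finset.mem_union, not_or] at hs
    rw [notMem_support_iff.1 fun h => hs.1 (hF _ _ _ h),
      notMem_support_iff.1 fun h => hs.2 (hF' _ _ _ h)]

theorem IsPoly.eval (hP : IsPoly P)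
    {x : Fin m → ∀ (K : Type w) [Field K], GFieldStructure p e G K → (α → K) → K}
    (hx : ∀ j, IsTerm (x j)) :
    IsTerm fun K _ S v => MvPolynomial.eval (fun j => x j K S v) (P K S v) := by
  obtain ⟨F, hF, hc⟩ := hP
  have h : ∀ (K : Type w) [Field K] (S : GFieldStructure p e G K) (v : α → K),
      MvPolynomial.eval (fun j => x j K S v) (P K S v) =
        ∑ s ∈ F, coeff s (P K S v) * ∏ j, x j K S v ^ s j := fun K _ S v => by
    rw [eval_eq', Finset.sum_subset (hF K S v)]
    intro s _ hs
    rw [notMem_support_iff.1 hs, zero_mul]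
  simp only [h]
  exact IsTerm.sum _ fun s => (hc s).mul (IsTerm.prod _ fun j => (hx j).pow _)

end Definability

section Poly

variable (m N : ℕ)

theorem finite_degree_le : {s : Fin m →₀ ℕ | s.degree ≤ N}.Finite :=
  (Set.finite_Iic (Finsupp.equivFunOnFinite.symm fun _ => N)).subset fun s hs i =>
    (Finsupp.le_degree i s).trans hs

/-- The exponents of total degree at most `N`. -/
noncomputable def exps : Finset (Fin m →₀ ℕ) := (finite_degree_le m N).toFinset

variable {m N}

theorem mem_exps {s : Fin m →₀ ℕ} : s ∈ exps m N ↔ s.degree ≤ N := by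
  simp [exps]

/-- The polynomial of total degree at most `N` with the given coefficients. -/
noncomputable def ofCoeffs {K : Type*} [CommSemiring K] (c : exps m N → K) :
    MvPolynomial (Fin m) K :=
  ∑ s, monomial s.1 (c s)

theorem coeff_ofCoeffs {K : Type*} [CommSemiring K] (c : exps m N → K) (s : Fin m →₀ ℕ) :
    coeff s (ofCoeffs c) = if h : s ∈ exps m N then c ⟨s, h⟩ else 0 := by
  classical
  simp only [ofCoeffs, coeff_sum, coeff_monomial]
  split_ifs with h
  · rw [Finset.sum_eq_single ⟨s, h⟩]
    · simp
    · intro b _ hb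
      rw [if_neg fun h => hb (Subtype.ext h)]
    · simp
  · exact Finset.sum_eq_zero fun b _ => if_neg fun hb : b.1 = s => h (hb ▸ b.2)

theorem exists_ofCoeffs {K : Type*} [CommSemiring K] {f : MvPolynomial (Fin m) K}
    (hf : f.totalDegree ≤ N) : ∃ c : exps m N → K, ofCoeffs c = f := by
  refine ⟨fun s => coeff s.1 f, ?_⟩
  ext s
  rw [coeff_ofCoeffs]
  split_ifs with h
  · rfl
  · rw [mem_exps, not_le] at h
    exact (coeff_eq_zero_of_totalDegree_lt (hf.trans_lt h)).symm

theorem totalDegree_ofCoeffs {K : Type*} [CommSemiring K] (c : exps m N → K) :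
    (ofCoeffs c).totalDegree ≤ N := by
  refine Finset.sup_le fun s hs => ?_
  by_contra h
  rw [mem_support_iff, coeff_ofCoeffs, dif_neg fun h' => h (mem_exps.1 h')] at hs
  exact hs rfl

variable {K : Type*} [Field K]

/-- Degrees add over a field. This bound turns divisibility and irreducibility into quantification
over finitely many coefficients. -/
theorem totalDegree_le_of_mul {f u w : MvPolynomial (Fin m) K} (h : u * w = f) (hf : f ≠ 0)
    (hN : f.totalDegree ≤ N) : u.totalDegree ≤ N ∧ w.totalDegree ≤ N := by
  rw [← h] at hf
  rw [← h, totalDegree_mul_of_isDomain (left_ne_zero_of_mul hf) (right_ne_zero_of_mul hf)] at hN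
  omega

theorem dvd_iff_exists_ofCoeffs {f h : MvPolynomial (Fin m) K} (hh : h.totalDegree ≤ N) :
    f ∣ h ↔ ∃ c : exps m N → K, f * ofCoeffs c = h := by
  refine ⟨fun ⟨q, hq⟩ => ?_, fun ⟨c, hc⟩ => ⟨_, hc.symm⟩⟩
  rcases eq_or_ne h 0 with rfl | h0
  · obtain ⟨c, hc⟩ := exists_ofCoeffs (K := K) (m := m) (N := N) (f := 0) (by simp)
    exact ⟨c, by rw [hc, mul_zero]⟩
  · obtain ⟨c, rfl⟩ := exists_ofCoeffs (totalDegree_le_of_mul hq.symm h0 hh).2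
    exact ⟨c, hq.symm⟩

theorem irreducible_iff_ofCoeffs {f : MvPolynomial (Fin m) K} (hf : f.totalDegree ≤ N) :
    Irreducible f ↔ f ≠ 0 ∧ ¬ IsUnit f ∧ ∀ u w : exps m N → K, ofCoeffs u * ofCoeffs w = f →
      IsUnit (ofCoeffs u) ∨ IsUnit (ofCoeffs w) := by
  refine ⟨fun h => ⟨h.ne_zero, h.not_isUnit, fun u w huw => h.isUnit_or_isUnit huw.symm⟩,
    fun ⟨h0, hu, h⟩ => ⟨hu, fun a b hab => ?_⟩⟩
  obtain ⟨ha, hb⟩ := totalDegree_le_of_mul hab.symm h0 hf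
  obtain ⟨u, rfl⟩ := exists_ofCoeffs ha
  obtain ⟨w, rfl⟩ := exists_ofCoeffs hb
  exact h u w hab.symm

end Poly

section Definability

variable {p e : ℕ} {G : Type u} [Group G] {α : Type*} {m N : ℕ}

theorem IsPoly.ofCoeffs {t : exps m N → ∀ (K : Type w) [Field K], GFieldStructure p e G K →
      (α → K) → K} (ht : ∀ s, IsTerm (t s)) :
    IsPoly fun K _ S v => FiniteGroupSchemeDCF.ofCoeffs fun s => t s K S v := by
  classical
  refine ⟨exps m N, fun K _ S v s hs => ?_, fun s => ?_⟩
  · by_contra h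
    rw [mem_support_iff, coeff_ofCoeffs, dif_neg h] at hs
    exact hs rfl
  · simp only [coeff_ofCoeffs]
    split_ifs
    exacts [ht _, IsTerm.zero]

theorem IsTerm.comp {β : Type*} (f : α → β)
    {t : ∀ (K : Type w) [Field K], GFieldStructure p e G K → (α → K) → K} (ht : IsTerm t) :
    IsTerm fun K _ S (v : β → K) => t K S (v ∘ f) := by
  obtain ⟨τ, hτ⟩ := ht
  exact ⟨τ.relabel f, fun K _ _ S h v => by rw [Term.realize_relabel, hτ K S h]⟩

theorem IsPoly.comp {β : Type*} (f : α → β) {P : ∀ (K : Type w) [Field K],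
    GFieldStructure p e G K → (α → K) → MvPolynomial (Fin m) K} (hP : IsPoly P) :
    IsPoly fun K _ S (v : β → K) => P K S (v ∘ f) := by
  obtain ⟨F, hF, hc⟩ := hP
  exact ⟨F, fun K _ S v => hF K S _, fun s => (hc s).comp f⟩

theorem IsPoly.dvd {P P' : ∀ (K : Type w) [Field K], GFieldStructure p e G K → (α → K) →
      MvPolynomial (Fin m) K} (N : ℕ) (hP : IsPoly P) (hP' : IsPoly P')
    (hN : ∀ (K : Type w) [Field K] (S : GFieldStructure p e G K) (v : α → K),
      (P' K S v).totalDegree ≤ N) :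
    IsFormula fun K _ S v => P K S v ∣ P' K S v := by
  have h1 : IsPoly fun (K : Type w) _ (_ : GFieldStructure p e G K) (v : α ⊕ exps m N → K) =>
      FiniteGroupSchemeDCF.ofCoeffs fun s => v (Sum.inr s) :=
    IsPoly.ofCoeffs fun s => IsTerm.var (Sum.inr s)
  have h2 := (((hP.comp (Sum.inl : α → α ⊕ exps m N)).mul h1).eq (hP'.comp Sum.inl)).ex
  refine h2.congr fun K _ S v => ?_
  rw [dvd_iff_exists_ofCoeffs (hN K S v)]
  exact Iff.rfl

theorem IsPoly.isUnit {P : ∀ (K : Type w) [Field K], GFieldStructure p e G K → (α → K) →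
      MvPolynomial (Fin m) K} (hP : IsPoly P) : IsFormula fun K _ S v => IsUnit (P K S v) :=
  (hP.dvd 0 IsPoly.one fun K _ S v => by simp).congr fun K _ S v => isUnit_iff_dvd_one.symm

theorem IsPoly.irreducible {P : ∀ (K : Type w) [Field K], GFieldStructure p e G K → (α → K) →
      MvPolynomial (Fin m) K} (N : ℕ) (hP : IsPoly P)
    (hN : ∀ (K : Type w) [Field K] (S : GFieldStructure p e G K) (v : α → K),
      (P K S v).totalDegree ≤ N) :
    IsFormula fun K _ S v => Irreducible (P K S v) := by
  -- The index in `Bool` packs the coefficients of both factors into one tuple, so that a single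
  -- block of quantifiers suffices.
  have h1 : ∀ i : Bool, IsPoly fun (K : Type w) _ (_ : GFieldStructure p e G K)
      (v : α ⊕ (Bool × exps m N) → K) =>
      FiniteGroupSchemeDCF.ofCoeffs fun s => v (Sum.inr (i, s)) := fun i =>
    IsPoly.ofCoeffs fun s => IsTerm.var (Sum.inr (i, s))
  have h2 := ((((h1 true).mul (h1 false)).eq (hP.comp Sum.inl)).imp
    ((h1 true).isUnit.or (h1 false).isUnit)).all
  refine ((hP.eq IsPoly.zero).not.and (hP.isUnit.not.and h2)).congr fun K _ S v => ?_
  rw [irreducible_iff_ofCoeffs (hN K S v)]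
  refine and_congr_right fun _ => and_congr_right fun _ => ⟨fun h u w => ?_, fun h x => ?_⟩
  · exact h fun i => if i.1 then u i.2 else w i.2
  · exact h (fun s => x (true, s)) (fun s => x (false, s))

theorem IsTerm.isConst [Finite G] {t : ∀ (K : Type w) [Field K], GFieldStructure p e G K →
      (α → K) → K} (ht : IsTerm t) : IsFormula fun K _ S v => S.toGRing.IsConst (t K S v) :=
  (IsFormula.forall_index fun i => (ht.D i).eq IsTerm.zero).and
    (IsFormula.forall_index fun g => (ht.σ g).eq ht)

end Definability

/-! ### Models of 𝔤-DCF satisfy the geometric axioms -/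

section Transfer

variable {p e : ℕ} {G : Type u} [Group G] [Finite G] [Fact p.Prime] {K : Type w}
  [(gLang e G).Structure K] [Field K] {S : GFieldStructure p e G K}

/-- Once the number of variables and a degree bound N are fixed, the condition is one sentence
quantifying over all coefficients. It holds in all geometric 𝔤-fields, hence in all models of their
common theory. -/
theorem hypersurfacePoints_of_model_gDCF (hKS : Interprets K S) (hK : K ⊨ gDCF.{u, w} p e G) :
    S.toGRing.HypersurfacePoints := by
  intro m f h hf hh hirr hfh
  obtain ⟨N, hN₁, hN₂⟩ : ∃ N, f.totalDegree ≤ N ∧ h.totalDegree ≤ N :=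
    ⟨_, le_max_left _ _, le_max_right _ _⟩
  obtain ⟨c, rfl⟩ := exists_ofCoeffs hN₁
  obtain ⟨d, rfl⟩ := exists_ofCoeffs hN₂
  let R : ∀ (K : Type w) [Field K], GFieldStructure p e G K →
      ((Empty ⊕ (Bool × exps m N)) → K) → Prop := fun K _ S v =>
    (∀ i, S.toGRing.IsConst (v (Sum.inr i))) →
      Irreducible (ofCoeffs fun s => v (Sum.inr (true, s))) →
      ¬ (ofCoeffs fun s => v (Sum.inr (true, s))) ∣ (ofCoeffs fun s => v (Sum.inr (false, s))) →
      ∃ x : Fin m → K, (∀ j, S.toGRing.IsConst (x j)) ∧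
        eval x (ofCoeffs fun s => v (Sum.inr (true, s))) = 0 ∧
        ¬ eval x (ofCoeffs fun s => v (Sum.inr (false, s))) = 0
  have hpoly : ∀ i : Bool, IsPoly fun (K : Type w) _ (_ : GFieldStructure p e G K)
      (v : Empty ⊕ (Bool × exps m N) → K) => ofCoeffs fun s => v (Sum.inr (i, s)) := fun i =>
    IsPoly.ofCoeffs fun s => IsTerm.var (Sum.inr (i, s))
  have hR : IsFormula R := by
    refine (IsFormula.forall_index fun i => (IsTerm.var _).isConst).imp
      (((hpoly true).irreducible N fun K _ S v => totalDegree_ofCoeffs _).imp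
        (((hpoly true).dvd N (hpoly false) fun K _ S v => totalDegree_ofCoeffs _).not.imp ?_))
    have hx : ∀ j : Fin m, IsTerm fun (K : Type w) _ (_ : GFieldStructure p e G K)
      (v : (Empty ⊕ (Bool × exps m N)) ⊕ Fin m → K) => v (Sum.inr j) := fun j => IsTerm.var _
    exact ((IsFormula.forall_index fun j => (hx j).isConst).and
      (((((hpoly true).comp Sum.inl).eval hx).eq IsTerm.zero).and
        ((((hpoly false).comp Sum.inl).eval hx).eq IsTerm.zero).not)).ex
  have hcoeff : ∀ {K : Type w} [Field K] (S : GFieldStructure p e G K) (c : exps m N → K),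
      (∀ s, S.toGRing.IsConst (c s)) ↔ ∀ s, S.toGRing.IsConst (coeff s (ofCoeffs c)) := by
    intro K _ S c
    refine ⟨fun h s => ?_, fun h s => ?_⟩
    · rw [coeff_ofCoeffs]
      split_ifs
      exacts [h _, S.toGRing.constants.zero_mem]
    · have := h s.1
      rwa [coeff_ofCoeffs, dif_pos s.2] at this
  have h1 := hR.all.of_model_gDCF (fun L _ T v hT x hx hirr hdvd => hT.hypersurfacePoints m _ _
    ((hcoeff T _).1 fun s => hx _) ((hcoeff T _).1 fun s => hx _) hirr hdvd) K S hKS hK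
    (fun i => i.elim) (fun i => if i.1 then c i.2 else d i.2)
  rw [← hcoeff] at hf hh
  refine h1 (fun i => ?_) hirr hfh
  rcases i with ⟨_ | _, s⟩
  exacts [hh s, hf s]

theorem exists_isDual_of_model_gDCF (he : 0 < e) (hKS : Interprets K S)
    (hK : K ⊨ gDCF.{u, w} p e G) : ∃ b : Fin e → K, S.toGRing.IsDual b := by
  have h1 : IsFormula fun (K : Type w) _ (S : GFieldStructure p e G K) (v : Empty ⊕ Fin e → K) =>
      (∀ (g : G) (j : Fin e), S.σ g (v (Sum.inr j)) = v (Sum.inr j)) ∧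
        ∀ i j : Fin e, S.D i (v (Sum.inr j)) = if i = j then 1 else 0 :=
    (IsFormula.forall_index fun g => IsFormula.forall_index fun j =>
      ((IsTerm.var _).σ g).eq (IsTerm.var _)).and
    (IsFormula.forall_index fun i => IsFormula.forall_index fun j =>
      ((IsTerm.var _).D i).eq (by split_ifs; exacts [IsTerm.one, IsTerm.zero]))
  exact h1.ex.of_model_gDCF (fun L _ T v hT => hT.exists_isDual he) K S hKS hK fun i => i.elim

theorem exists_isFreePoint_of_model_gDCF (hKS : Interprets K S)
    (hK : K ⊨ gDCF.{u, w} p e G) : ∃ y : K, S.toGRing.IsFreePoint y := by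
  have h1 : IsFormula fun (K : Type w) _ (S : GFieldStructure p e G K) (v : Empty ⊕ Unit → K) =>
      (∀ i, S.D i (v (Sum.inr ())) = 0) ∧ ∀ g, S.σ g (v (Sum.inr ())) = v (Sum.inr ()) → g = 1 :=
    (IsFormula.forall_index fun i => ((IsTerm.var _).D i).eq IsTerm.zero).and
    (IsFormula.forall_index fun g => (((IsTerm.var _).σ g).eq (IsTerm.var _)).imp
      (IsFormula.const _))
  obtain ⟨y, hy⟩ := h1.ex.of_model_gDCF (fun L _ T v hT => by
    obtain ⟨y, hy⟩ := hT.exists_isFreePoint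
    exact ⟨fun _ => y, hy⟩) K S hKS hK fun i => i.elim
  exact ⟨y (), hy⟩

theorem geometric_of_model_gDCF (he : 0 < e) (hKS : Interprets K S)
    (hK : K ⊨ gDCF.{u, w} p e G) : S.Geometric := by
  obtain ⟨b, hb⟩ := exists_isDual_of_model_gDCF he hKS hK
  obtain ⟨y, hy⟩ := exists_isFreePoint_of_model_gDCF hKS hK
  exact S.geometric_of_hypersurfacePoints hb hy (hypersurfacePoints_of_model_gDCF hKS hK)

end Transfer

theorem model_gDF_of_model_gDCF {p e : ℕ} [NeZero p] {G : Type u} [Group G] {K : Type w}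
    [(gLang e G).Structure K] (hK : K ⊨ gDCF.{u, w} p e G) : K ⊨ gDF p e G :=
  (Theory.model_iff _).2 fun φ hφ => (Theory.model_iff _).1 hK φ fun _ _ ⟨_, _, hT, _⟩ =>
    (Theory.model_iff _).1 hT.model_gDF φ hφ

theorem model_gDCF_iff {p : ℕ} [Fact p.Prime] {e : ℕ} (he : 0 < e) {G : Type u} [Group G]
    [Finite G] {K : Type w} [(gLang e G).Structure K] :
    K ⊨ gDCF.{u, w} p e G ↔ IsGeometricGField p e G K := by
  refine ⟨fun hK => ?_, fun hK => (Theory.model_iff _).2 fun φ hφ => hφ K hK⟩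
  obtain ⟨F, S, hS⟩ := exists_interprets (model_gDF_of_model_gDCF hK)
  exact ⟨F, S, hS, geometric_of_model_gDCF he hS hK⟩

end FiniteGroupSchemeDCF

/-! ### Dual elements form a p-basis -/

namespace FiniteGroupSchemeDCF

open MvPolynomial

namespace GRing

variable {p e : ℕ} {G : Type u} [Group G] {L : Type*} [Field L] {T : GRing p e G L}

/-- The subring of elements which are killed by the derivations. -/
def derConstants (T : GRing p e G L) : Subring L where
  carrier := {x | ∀ i, T.D i x = 0}
  mul_mem' := fun {x y} hx hy i => by rw [Derivation.leibniz, hx, hy, smul_zero, smul_zero, add_zero]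
  one_mem' := fun i => Derivation.map_one_eq_zero _
  add_mem' := fun {x y} hx hy i => by rw [map_add, hx, hy, add_zero]
  zero_mem' := fun i => map_zero _
  neg_mem' := fun {x} hx i => by rw [map_neg, hx, neg_zero]

theorem D_aeval {b : Fin e → L} (hb : T.IsDual b) (i : Fin e)
    (P : MvPolynomial (Fin e) T.derConstants) : T.D i (aeval b P) = aeval b (pderiv i P) := by
  induction P using MvPolynomial.induction_on with
  | C a => rw [pderiv_C, map_zero, aeval_C]; exact a.2 i
  | add P Q hP hQ => simp only [map_add, hP, hQ]
  | mul_X P j hP =>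
    classical
    rw [map_mul, Derivation.leibniz, hP, Derivation.leibniz, aeval_X, hb.2, pderiv_X]
    simp only [smul_eq_mul, map_add, map_mul, aeval_X]
    rcases eq_or_ne i j with rfl | h
    · simp
    · simp [h]

/-- The monomials in dual elements with exponents less than `p` are linearly independent over
the elements killed by the derivations. -/
theorem IsDual.eq_zero_of_aeval_eq_zero [Fact p.Prime] [CharP L p] {b : Fin e → L}
    (hb : T.IsDual b) (P : MvPolynomial (Fin e) T.derConstants)
    (hP : ∀ s ∈ P.support, ∀ i, s i < p) (h0 : aeval b P = 0) : P = 0 := by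
  have hchar : CharP T.derConstants p :=
    (RingHom.charP_iff T.derConstants.subtype Subtype.val_injective p).2 inferInstance
  suffices h : ∀ (N : ℕ) (P : MvPolynomial (Fin e) T.derConstants),
      (∀ s ∈ P.support, ∀ i, s i < p) → (∀ s ∈ P.support, s.degree < N) → aeval b P = 0 → P = 0 from
    h ((P.support.sup fun s => s.degree) + 1) P hP
      (fun s hs => Nat.lt_succ_of_le (Finset.le_sup (f := fun s => s.degree) hs)) h0
  intro N
  induction N with
  | zero =>
    intro P _ hN _
    ext s
    by_contra hs
    exact absurd (hN s (mem_support_iff.2 fun h => hs (by rw [h, coeff_zero]))) (Nat.not_lt_zero _)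
  | succ N ih =>
    intro P hP hN h0
    -- D_i acts on polynomials in b as the i-th partial derivative, so each partial derivative of P
    -- is again a relation, of smaller degree.
    have hd : ∀ i, pderiv i P = 0 := fun i => by
      have hs : ∀ s ∈ (pderiv i P).support, s + Finsupp.single i 1 ∈ P.support := fun s hs => by
        rw [mem_support_iff, coeff_pderiv] at hs
        exact mem_support_iff.2 (left_ne_zero_of_mul hs)
      refine ih _ (fun s h j => ?_) (fun s h => ?_) (by rw [← D_aeval hb, h0, map_zero])
      · exact lt_of_le_of_lt (by simp) (hP _ (hs s h) j)
      · have := hN _ (hs s h)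
        rw [map_add, Finsupp.degree_single] at this
        omega
    -- All exponents are below p, so a positive exponent is invertible, and a polynomial with
    -- vanishing partial derivatives is constant.
    have hC : P = C (coeff 0 P) := by
      ext s : 1
      rw [coeff_C]
      split_ifs with hs
      · rw [hs]
      · by_contra hne
        obtain ⟨i, hi⟩ : ∃ i, s i ≠ 0 := by
          by_contra h
          push Not at h
          exact hs (Finsupp.ext fun i => (h i).symm)
        have h1 := congrArg (coeff (s - Finsupp.single i 1)) (hd i)
        rw [coeff_pderiv, coeff_zero, tsub_add_cancel_of_le
          (by rw [Finsupp.single_le_iff]; exact Nat.one_le_iff_ne_zero.2 hi)] at h1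
        have h2 : ((s - Finsupp.single i 1 : Fin e →₀ ℕ) i : T.derConstants) + 1 = (s i : ℕ) := by
          rw [Finsupp.tsub_apply, Finsupp.single_eq_same, ← Nat.cast_add_one, Nat.sub_add_cancel
            (Nat.one_le_iff_ne_zero.2 hi)]
        rw [h2, mul_eq_zero, or_iff_right hne, CharP.cast_eq_zero_iff _ p] at h1
        exact absurd (Nat.le_of_dvd (Nat.pos_of_ne_zero hi) h1)
          (not_le.2 (hP s (mem_support_iff.2 hne) i))
    rw [hC, aeval_C] at h0
    rw [hC, show coeff 0 P = 0 from Subtype.ext h0, C_0]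

/-- Frobenius is injective and commutes with G. This provides a free point which is itself a p-th
power. -/
theorem IsFreePoint.pow [Fact p.Prime] [CharP L p] {y : L} (hy : T.IsFreePoint y) :
    T.IsFreePoint (y ^ p) :=
  ⟨fun i => derivation_pow_charP p (T.D i) y, fun g h => hy.2 g (frobenius_inj L p (by
    rw [map_pow] at h
    exact h))⟩

/-- The span of the monomials b^α over the p-th powers is a subring, because b_i^p is a p-th power.
It contains the constants, the free point y^p and the b_i, and these generate L. -/
theorem IsDual.exists_pBasis [Finite G] [Fact p.Prime] [CharP L p] {b : Fin e → L}
    (hb : T.IsDual b) {y : L} (hy : T.IsFreePoint y) (hC : ∀ c, T.IsConst c → ∃ z, z ^ p = c)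
    (x : L) : ∃ z : (Fin e → Fin p) → L, x = ∑ α, z α ^ p * ∏ i, b i ^ (α i : ℕ) := by
  classical
  have hp : p.Prime := Fact.out
  have : NeZero p := ⟨hp.ne_zero⟩
  let M : AddSubgroup L :=
    { carrier := {x | ∃ z : (Fin e → Fin p) → L, x = ∑ α, z α ^ p * ∏ i, b i ^ (α i : ℕ)}
      zero_mem' := ⟨0, by simp [hp.ne_zero]⟩
      add_mem' := by
        rintro _ _ ⟨z, rfl⟩ ⟨t, rfl⟩
        exact ⟨z + t, by simp [add_pow_char, add_mul, Finset.sum_add_distrib]⟩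
      neg_mem' := by
        rintro _ ⟨z, rfl⟩
        refine ⟨-z, ?_⟩
        rw [← Finset.sum_neg_distrib]
        refine Finset.sum_congr rfl fun α _ => ?_
        rw [← neg_mul, Pi.neg_apply]
        congr 1
        rw [eq_comm, eq_neg_iff_add_eq_zero, ← add_pow_char, neg_add_cancel, zero_pow hp.ne_zero] }
  have hmon : ∀ (z : L) (s : Fin e → ℕ), z ^ p * ∏ i, b i ^ s i ∈ M := fun z s => by
    -- Divide each exponent by p: the remainders select the monomial, and the quotients are absorbed
    -- into the p-th power.
    refine ⟨fun α => if α = fun i => Fin.ofNat p (s i) then z * ∏ i, b i ^ (s i / p) else 0, ?_⟩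
    rw [Finset.sum_eq_single fun i => Fin.ofNat p (s i)]
    · dsimp only
      rw [if_pos rfl, mul_pow, ← Finset.prod_pow, mul_assoc, ← Finset.prod_mul_distrib]
      congr 1
      refine Finset.prod_congr rfl fun i _ => ?_
      rw [← pow_mul, ← pow_add]
      congr 1
      rw [mul_comm]
      exact (Nat.div_add_mod (s i) p).symm
    · intro α _ hα
      dsimp only
      rw [if_neg hα, zero_pow hp.ne_zero, zero_mul]
    · simp
  let A : Subring L :=
    { M with
      one_mem' := by
        have := hmon 1 0
        simpa using this
      mul_mem' := by
        rintro _ _ ⟨z, rfl⟩ ⟨t, rfl⟩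
        rw [Finset.sum_mul_sum]
        refine M.sum_mem fun α _ => M.sum_mem fun β _ => ?_
        have := hmon (z α * t β) (fun i => α i + β i)
        rw [mul_pow] at this
        simp_rw [pow_add, Finset.prod_mul_distrib] at this
        convert this using 1
        ring }
  have hpow : ∀ z : L, z ^ p ∈ A := fun z => by simpa using! hmon z 0
  refine hb.mem_subring A (fun x hx => hy.pow.mem_subring A (fun c hc => ?_) (hpow y) hx)
    (fun i => ?_) x
  · obtain ⟨z, rfl⟩ := hC c hc
    exact hpow z
  · have := hmon 1 (Pi.single i 1)
    rw [one_pow, one_mul, Finset.prod_eq_single i (fun j _ hj => by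
      rw [Pi.single_eq_of_ne hj, pow_zero]) (by simp), Pi.single_eq_same, pow_one] at this
    exact this

/-- The difference of two expansions has coefficients (z_α - t_α)^p, which are killed by the D_i, so
the independence of the monomials b^α over such elements applies. -/
theorem IsDual.pBasis_unique [Fact p.Prime] [CharP L p] {b : Fin e → L} (hb : T.IsDual b)
    {z t : (Fin e → Fin p) → L}
    (h : ∑ α, z α ^ p * ∏ i, b i ^ (α i : ℕ) = ∑ α, t α ^ p * ∏ i, b i ^ (α i : ℕ)) : z = t := by
  classical
  have hp : p.Prime := Fact.out
  let d : (Fin e → Fin p) → T.derConstants := fun α =>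
    ⟨(z α - t α) ^ p, fun i => derivation_pow_charP p (T.D i) _⟩
  let ν : (Fin e → Fin p) → (Fin e →₀ ℕ) := fun α =>
    Finsupp.equivFunOnFinite.symm fun i => (α i : ℕ)
  have hν : Function.Injective ν := fun α β h => funext fun i => Fin.ext (DFunLike.congr_fun h i)
  let P : MvPolynomial (Fin e) T.derConstants := ∑ α, monomial (ν α) (d α)
  have hcoeff : ∀ α, coeff (ν α) P = d α := fun α => by
    simp only [P, coeff_sum, coeff_monomial]
    rw [Finset.sum_eq_single α (fun β _ hβ => if_neg fun h => hβ (hν h)) (by simp), if_pos rfl]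
  have hP : P = 0 := by
    refine hb.eq_zero_of_aeval_eq_zero P (fun s hs i => ?_) ?_
    · obtain ⟨α, -, hα⟩ := Finset.mem_biUnion.1 (support_sum hs)
      rw [Finset.mem_singleton.1 (support_monomial_subset hα)]
      exact (α i).2
    · rw [map_sum]
      rw [← sub_eq_zero, ← Finset.sum_sub_distrib] at h
      refine Eq.trans (Finset.sum_congr rfl fun α _ => ?_) h
      rw [aeval_monomial, ← sub_mul, ← sub_pow_char]
      congr 1
      exact Finsupp.prod_fintype _ _ fun i => pow_zero _
  funext α
  have h1 := hcoeff α
  rw [hP, coeff_zero] at h1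
  exact sub_eq_zero.1 (pow_eq_zero_iff hp.ne_zero |>.1 (congrArg Subtype.val h1).symm)

end GRing

theorem realize_pBasisFormula {p e : ℕ} {K : Type*} [Field K] [Ring.CompatibleRing K]
    (b : Fin e → K) : (pBasisFormula p e).Realize b ↔
      ∀ x, ∃! z : (Fin e → Fin p) → K, x = ∑ α, z α ^ p * ∏ i, b i ^ (α i : ℕ) := by
  rw [pBasisFormula, Formula.realize_iAlls]
  simp only [Formula.realize_iExsUnique, Formula.realize_equal, Term.realize_var,
    Ring.realize_termOfFreeCommRing, map_sum, map_mul, map_pow, map_prod, FreeCommRing.lift_of,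
    Sum.elim_inl, Sum.elim_inr]
  exact ⟨fun h x => h fun _ => x, fun h x => h (x ())⟩

end FiniteGroupSchemeDCF

/-! ### Structures and embeddings in the language with constants -/

namespace FiniteGroupSchemeDCF

open MvPolynomial

section Models

variable {p e : ℕ} {G : Type u}

section

variable [Group G] {K : Type w} [(gLang e G).Structure K] [Field K] {S : GFieldStructure p e G K}

theorem Interprets.isDual_of_realize (h : Interprets K S) {b : Fin e → K}
    (hb : ∀ ψ, BasisAxiom p e G ψ → ψ.Realize b) : S.toGRing.IsDual b := by
  refine ⟨fun g j => ?_, fun i j => ?_⟩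
  · have := hb _ (.invariant g j)
    rw [Formula.realize_equal, h.realize_tAct, Term.realize_var] at this
    exact this
  · have := hb _ (.delta i j)
    rw [Formula.realize_equal, h.realize_tDer, Term.realize_var] at this
    refine this.trans ?_
    split_ifs
    exacts [h.realize_tOne b, h.realize_tZero b]

/-- In a geometric 𝔤-field duality alone suffices: a free point exists and constants are p-th
powers, so the p-basis axiom follows. -/
theorem Interprets.realize_basisAxiom [Finite G] [Fact p.Prime] (h : Interprets K S)
    (hS : S.Geometric) {b : Fin e → K} (hb : S.toGRing.IsDual b)
    {ψ : (gLang e G).Formula (Fin e)} (hψ : BasisAxiom p e G ψ) : ψ.Realize b := by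
  rcases hψ with _ | ⟨g, j⟩ | ⟨i, j⟩
  · have := S.charP
    let _ := h.compatibleRing K
    have hexp : (LHom.sumInl : FirstOrder.Language.ring →ᴸ gLang e G).IsExpansionOn K :=
      ⟨fun _ _ => rfl, fun _ _ => rfl⟩
    rw [LHom.realize_onFormula, realize_pBasisFormula]
    obtain ⟨y, hy⟩ := hS.exists_isFreePoint
    intro x
    obtain ⟨z, hz⟩ := hb.exists_pBasis hy (fun c hc => hS.hypersurfacePoints.exists_pow_eq hc) x
    exact ⟨z, hz, fun t ht => hb.pBasis_unique (ht.symm.trans hz)⟩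
  · rw [Formula.realize_equal, h.realize_tAct, Term.realize_var]
    exact hb.1 g j
  · rw [Formula.realize_equal, h.realize_tDer, Term.realize_var]
    refine (hb.2 i j).trans ?_
    split_ifs
    exacts [(h.realize_tOne b).symm, (h.realize_tZero b).symm]

end

section

variable [Group G] {K : Type w} [Field K] (S : GFieldStructure p e G K)

/-- The `gLang e G`-structure of a `𝔤`-field. -/
@[reducible]
def GFieldStructure.toStructure : (gLang e G).Structure K where
  funMap := fun {n} f =>
    match n, f with
    | _, Sum.inl .add => fun x => x 0 + x 1
    | _, Sum.inl .mul => fun x => x 0 * x 1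
    | _, Sum.inl .neg => fun x => -x 0
    | _, Sum.inl .zero => fun _ => 0
    | _, Sum.inl .one => fun _ => 1
    | _, Sum.inr (OpFunc.der i) => fun x => S.D i (x 0)
    | _, Sum.inr (OpFunc.act g) => fun x => S.σ g (x 0)
  RelMap := fun {_} r => nomatch r

theorem GFieldStructure.interprets_toStructure :
    @Interprets p e G _ K S.toStructure _ S :=
  let _ := S.toStructure
  { add := fun _ => rfl
    mul := fun _ => rfl
    neg := fun _ => rfl
    zero := fun _ => rfl
    one := fun _ => rfl
    der := fun _ _ => rfl
    act := fun _ _ => rfl }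

end

/-- A symbol of `gLang e G` as a symbol of `gLangB e G`. -/
def liftSym {e : ℕ} {G : Type u} {n : ℕ} (F : (gLang e G).Functions n) :
    (gLangB e G).Functions n :=
  ((gLang e G).lhomWithConstants (Fin e)).onFunction F

/-- The symbols of `gLangB e G`. -/
theorem gLangB_functions_cases {P : ∀ n, (gLangB e G).Functions n → Prop}
    (add : P 2 (liftSym addSym)) (mul : P 2 (liftSym mulSym)) (neg : P 1 (liftSym negSym))
    (zero : P 0 (liftSym zeroSym)) (one : P 0 (liftSym oneSym))
    (der : ∀ i, P 1 (liftSym (derSym i))) (act : ∀ g, P 1 (liftSym (actSym g)))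
    (con : ∀ j, P 0 ((gLang e G).con j)) (n : ℕ) (F : (gLangB e G).Functions n) : P n F := by
  rcases F with (F | F) | F
  · cases F
    exacts [add, mul, neg, zero, one]
  · cases F
    exacts [der _, act _]
  · cases n with
    | zero => exact con F
    | succ n => exact isEmptyElim F

instance (n : ℕ) : IsEmpty ((gLangB e G).Relations n) :=
  ⟨fun r => by rcases r with (r | r) | r <;> cases r⟩

variable {K : Type w} [(gLangB e G).Structure K]

/-- The reduct which forgets the constants. -/
@[reducible]
def reductB (e : ℕ) (G : Type u) (K : Type w) [(gLangB e G).Structure K] :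
    (gLang e G).Structure K :=
  ((gLang e G).lhomWithConstants (Fin e)).reduct K

theorem isExpansionOn_reductB : @LHom.IsExpansionOn _ _ ((gLang e G).lhomWithConstants (Fin e)) K
    (reductB e G K) _ :=
  let _ := reductB e G K
  ⟨fun _ _ => rfl, fun _ _ => rfl⟩

theorem model_withBasis_iff [(gLang e G).Structure K]
    [((gLang e G).lhomWithConstants (Fin e)).IsExpansionOn K] {T : (gLang e G).Theory} :
    K ⊨ withBasis p e G T ↔ K ⊨ T ∧ ∀ ψ, BasisAxiom p e G ψ →
      ψ.Realize fun j => ((gLang e G).con j : K) := by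
  rw [withBasis, Theory.model_union_iff, LHom.onTheory_model]
  refine and_congr_right fun _ => (Theory.model_iff _).trans ⟨fun h ψ hψ => ?_, ?_⟩
  · rw [← Formula.realize_equivSentence]
    exact h _ ⟨ψ, hψ, rfl⟩
  · rintro h _ ⟨ψ, hψ, rfl⟩
    exact (Formula.realize_equivSentence K ψ).2 (h ψ hψ)

theorem funMap_con (j : Fin e) (x : Fin 0 → K) :
    Structure.funMap ((gLang e G).con j : (gLangB e G).Functions 0) x = ((gLang e G).con j : K) := by
  rw [Subsingleton.elim x default]
  rfl

end Models

section Embeddings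

variable {p e : ℕ} {G : Type u} [Group G] {K L : Type w} [(gLangB e G).Structure K]
  [(gLangB e G).Structure L] [Field K] [Field L] {S : GFieldStructure p e G K}
  {T : GFieldStructure p e G L}

/-- The field `K` with its `𝔤`-structure `S` underlies the given structure with constants. -/
def InterpretsB (K : Type w) [(gLangB e G).Structure K] [Field K] (S : GFieldStructure p e G K) :
    Prop :=
  @Interprets p e G _ K (reductB e G K) _ S

theorem InterpretsB.add (h : InterpretsB K S) (x : Fin 2 → K) :
    Structure.funMap (liftSym (addSym : (gLang e G).Functions 2)) x = x 0 + x 1 :=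
  @Interprets.add p e G _ K (reductB e G K) _ S h x

theorem InterpretsB.mul (h : InterpretsB K S) (x : Fin 2 → K) :
    Structure.funMap (liftSym (mulSym : (gLang e G).Functions 2)) x = x 0 * x 1 :=
  @Interprets.mul p e G _ K (reductB e G K) _ S h x

theorem InterpretsB.neg (h : InterpretsB K S) (x : Fin 1 → K) :
    Structure.funMap (liftSym (negSym : (gLang e G).Functions 1)) x = -x 0 :=
  @Interprets.neg p e G _ K (reductB e G K) _ S h x

theorem InterpretsB.zero (h : InterpretsB K S) (x : Fin 0 → K) :
    Structure.funMap (liftSym (zeroSym : (gLang e G).Functions 0)) x = 0 :=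
  @Interprets.zero p e G _ K (reductB e G K) _ S h x

theorem InterpretsB.one (h : InterpretsB K S) (x : Fin 0 → K) :
    Structure.funMap (liftSym (oneSym : (gLang e G).Functions 0)) x = 1 :=
  @Interprets.one p e G _ K (reductB e G K) _ S h x

theorem InterpretsB.der (h : InterpretsB K S) (i : Fin e) (x : Fin 1 → K) :
    Structure.funMap (liftSym (derSym i : (gLang e G).Functions 1)) x = S.D i (x 0) :=
  @Interprets.der p e G _ K (reductB e G K) _ S h i x

theorem InterpretsB.act (h : InterpretsB K S) (g : G) (x : Fin 1 → K) :
    Structure.funMap (liftSym (actSym g : (gLang e G).Functions 1)) x = S.σ g (x 0) :=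
  @Interprets.act p e G _ K (reductB e G K) _ S h g x

/-- Homomorphisms of `𝔤`-fields which preserve the constants are embeddings. -/
def InterpretsB.embedding (hS : InterpretsB K S) (hT : InterpretsB L T) (φ : K →+* L)
    (hφ : GRing.IsHom S.toGRing T.toGRing φ)
    (hcon : ∀ j : Fin e, φ ((gLang e G).con j : K) = ((gLang e G).con j : L)) : K ↪[gLangB e G] L where
  toFun := φ
  inj' := φ.injective
  map_fun' := fun {n} F x => by
    revert x
    induction n, F using gLangB_functions_cases with
    | add => intro x; rw [hS.add, hT.add, map_add]; rfl
    | mul => intro x; rw [hS.mul, hT.mul, map_mul]; rfl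
    | neg => intro x; rw [hS.neg, hT.neg, map_neg]; rfl
    | zero => intro x; rw [hS.zero, hT.zero, map_zero]
    | one => intro x; rw [hS.one, hT.one, map_one]
    | der i => intro x; rw [hS.der, hT.der]; exact hφ.D i _
    | act g => intro x; rw [hS.act, hT.act]; exact hφ.σ g _
    | con j => intro x; rw [funMap_con, funMap_con, hcon]
  map_rel' := fun r => isEmptyElim r

theorem InterpretsB.exists_ringHom (hS : InterpretsB K S) (hT : InterpretsB L T)
    (f : K ↪[gLangB e G] L) : ∃ φ : K →+* L, GRing.IsHom S.toGRing T.toGRing φ ∧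
      (∀ x, φ x = f x) ∧ ∀ j : Fin e, φ ((gLang e G).con j : K) = ((gLang e G).con j : L) := by
  let φ : K →+* L :=
    { toFun := f
      map_one' := by
        have := f.map_fun (liftSym (oneSym : (gLang e G).Functions 0)) ![]
        rwa [hS.one, hT.one] at this
      map_mul' := fun x y => by
        have := f.map_fun (liftSym (mulSym : (gLang e G).Functions 2)) ![x, y]
        rwa [hS.mul, hT.mul] at this
      map_zero' := by
        have := f.map_fun (liftSym (zeroSym : (gLang e G).Functions 0)) ![]
        rwa [hS.zero, hT.zero] at this
      map_add' := fun x y => by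
        have := f.map_fun (liftSym (addSym : (gLang e G).Functions 2)) ![x, y]
        rwa [hS.add, hT.add] at this }
  refine ⟨φ, ⟨fun i x => ?_, fun g x => ?_⟩, fun x => rfl, fun j => ?_⟩
  · have := f.map_fun (liftSym (derSym i : (gLang e G).Functions 1)) ![x]
    rwa [hS.der, hT.der] at this
  · have := f.map_fun (liftSym (actSym g : (gLang e G).Functions 1)) ![x]
    rwa [hS.act, hT.act] at this
  · have := f.map_fun ((gLang e G).con j : (gLangB e G).Functions 0) ![]
    rwa [funMap_con, funMap_con] at this

end Embeddings

end FiniteGroupSchemeDCF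

/-! ### Robinson's test and embeddings into ultrapowers -/

namespace FiniteGroupSchemeDCF

section Robinson

variable {L : FirstOrder.Language.{u, v}}

/-- Robinson's test: if every embedding `M → N` of models can be prolonged to an embedding of `N`
such that the composite `M → M'` is elementary, then the theory is model complete. -/
theorem realize_iff_of_amalgamation {T : L.Theory}
    (hT : ∀ (M N : Theory.ModelType.{u, v, w} T) (f : M ↪[L] N),
      ∃ (M' : Theory.ModelType.{u, v, w} T) (g : M ↪ₑ[L] M') (h : N ↪[L] M'), ∀ x, h (f x) = g x)
    {α : Type*} {n : ℕ} (φ : L.BoundedFormula α n) (M N : Theory.ModelType.{u, v, w} T)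
    (f : M ↪[L] N) (v : α → M) (x : Fin n → M) :
    φ.Realize (f ∘ v) (f ∘ x) ↔ φ.Realize v x := by
  induction φ generalizing M N with
  | falsum => exact Iff.rfl
  | equal t s =>
    simp only [BoundedFormula.Realize, ← Sum.comp_elim, HomClass.realize_term]
    exact f.injective.eq_iff
  | rel R t =>
    simp only [BoundedFormula.Realize, ← Sum.comp_elim, HomClass.realize_term]
    exact f.map_rel R _
  | imp _ _ h1 h2 =>
    simp only [BoundedFormula.Realize]
    rw [h1, h2]
  | all φ ih =>
    simp only [BoundedFormula.Realize]
    refine ⟨fun h m => ?_, fun h m => ?_⟩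
    · rw [← ih M N f, Fin.comp_snoc]
      exact h (f m)
    -- A universal statement true in M passes to M' by elementarity. An element m of N is tested at
    -- its image in M', where the induction hypothesis for N → M' brings the instance back.
    · obtain ⟨M', g, k, hk⟩ := hT M N f
      have h1 : φ.all.Realize (g ∘ v) (g ∘ x) := (g.map_boundedFormula φ.all v x).2 h
      have hk' : (k : N → M') ∘ f = g := funext hk
      rw [← ih N M' k, Fin.comp_snoc, ← Function.comp_assoc, ← Function.comp_assoc, hk']
      exact h1 (k m)

theorem isModelComplete_of_amalgamation {T : L.Theory}
    (hT : ∀ (M N : Theory.ModelType.{u, v, w} T) (f : M ↪[L] N),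
      ∃ (M' : Theory.ModelType.{u, v, w} T) (g : M ↪ₑ[L] M') (h : N ↪[L] M'), ∀ x, h (f x) = g x) :
    IsModelComplete.{u, v, w} T := fun M N f n φ x => by
  have := realize_iff_of_amalgamation hT φ M N f x default
  rwa [Subsingleton.elim (f ∘ default) default] at this

/-- If finite parts of an extension `N` of `M` can be mapped to `M` over `M`, then `N` embeds
over `M` into an ultrapower of `M`. -/
theorem exists_amalgamation {T : L.Theory} [∀ n, IsEmpty (L.Relations n)]
    (M N : Theory.ModelType.{u, v, w} T) (f : M ↪[L] N)
    (H : ∀ A : Finset N, ∃ a : N → M,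
      (∀ (n : ℕ) (F : L.Functions n) (x : Fin n → N), (∀ i, x i ∈ A) → Structure.funMap F x ∈ A →
        a (Structure.funMap F x) = Structure.funMap F (a ∘ x)) ∧
      (∀ m, f m ∈ A → a (f m) = m) ∧ ∀ x ∈ A, ∀ y ∈ A, a x = a y → x = y) :
    ∃ (M' : Theory.ModelType.{u, v, w} T) (g : M ↪ₑ[L] M') (h : N ↪[L] M'),
      ∀ x, h (f x) = g x := by
  classical
  choose a hfun hf hinj using H
  -- Every finite part of N is contained in almost all A, so sending y to the class of the family `a
  -- A y` preserves functions and is injective, since each such condition involves only finitely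
  -- many elements.
  let U : Ultrafilter (Finset N) := Ultrafilter.of Filter.atTop
  have hU : ∀ s : Finset N, ∀ᶠ A in (U : Filter (Finset N)), s ⊆ A := fun s =>
    Ultrafilter.of_le (Filter.atTop : Filter (Finset N)) (Filter.eventually_ge_atTop s)
  let P := (U : Filter (Finset N)).Product fun _ => (M : Type w)
  let mk : (Finset N → M) → P := fun y => (y : (U : Filter (Finset N)).Product fun _ => (M : Type w))
  have hmk : ∀ {y z : Finset N → M}, mk y = mk z ↔ ∀ᶠ A in (U : Filter (Finset N)), y A = z A :=
    fun {_ _} => Quotient.eq''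
  have hP : P ⊨ T := (Theory.model_iff _).2 fun φ hφ =>
    (Ultraproduct.sentence_realize φ).2 (Filter.Eventually.of_forall fun _ =>
      (Theory.model_iff _).1 M.is_model φ hφ)
  let g : M ↪ₑ[L] P :=
    { toFun := fun m => mk fun _ => m
      map_formula' := fun n φ x => by
        refine (Ultraproduct.realize_formula_cast φ fun i _ => x i).trans ?_
        exact Filter.eventually_const }
  let h : N ↪[L] P :=
    { toFun := fun y => mk fun A => a A y
      inj' := fun y z hyz => by
        obtain ⟨A, hA, hs⟩ := ((hmk.1 hyz).and (hU {y, z})).exists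
        exact hinj A y (hs (by simp)) z (hs (by simp)) hA
      map_fun' := fun {n} F x => by
        refine Eq.trans ?_ (Ultraproduct.funMap_cast F fun i A => a A (x i)).symm
        refine hmk.2 ((hU (insert (Structure.funMap F x) (Finset.univ.image x))).mono fun A hA => ?_)
        exact hfun A n F x
          (fun i => hA (Finset.mem_insert_of_mem (Finset.mem_image_of_mem _ (Finset.mem_univ i))))
          (hA (Finset.mem_insert_self _ _))
      map_rel' := fun r => isEmptyElim r }
  refine ⟨Theory.ModelType.of T P, g, h, fun x => ?_⟩
  exact hmk.2 ((hU {f x}).mono fun A hA => hf A x (hA (Finset.mem_singleton_self _)))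

end Robinson

/-! ### The model companion -/

section

variable {p e : ℕ} {G : Type u} [Group G]

theorem exists_interpretsB {K : Type w} [(gLangB e G).Structure K] (hK : K ⊨ gDFb p e G) :
    ∃ (_ : Field K) (S : GFieldStructure p e G K), InterpretsB K S ∧
      S.toGRing.IsDual fun j => ((gLang e G).con j : K) := by
  let _ := reductB e G K
  have := isExpansionOn_reductB (e := e) (G := G) (K := K)
  obtain ⟨h1, h2⟩ := model_withBasis_iff.1 hK
  obtain ⟨F, S, hS⟩ := exists_interprets h1
  exact ⟨F, S, hS, hS.isDual_of_realize h2⟩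

variable [Fact p.Prime]

theorem model_gDFb_of_model_gDCFb {K : Type w} [(gLangB e G).Structure K]
    (hK : K ⊨ gDCFb.{u, w} p e G) : K ⊨ gDFb p e G := by
  let _ := reductB e G K
  have := isExpansionOn_reductB (e := e) (G := G) (K := K)
  obtain ⟨h1, h2⟩ := model_withBasis_iff.1 hK
  exact model_withBasis_iff.2 ⟨model_gDF_of_model_gDCF h1, h2⟩

theorem embedsIntoModels_gDCFb_gDFb :
    EmbedsIntoModels.{u, 0, w} (gDCFb.{u, w} p e G) (gDFb p e G) := fun M =>
  have := model_gDFb_of_model_gDCFb M.is_model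
  ⟨Theory.ModelType.of _ M, ⟨Embedding.refl _ _⟩⟩

open MvPolynomial in
/-- Finite parts of an extension of a `𝔤`-field satisfying the geometric axioms can be mapped to
the `𝔤`-field. -/
theorem InterpretsB.exists_partial {K L : Type w} [(gLangB e G).Structure K]
    [(gLangB e G).Structure L] [Field K] [Field L] {S : GFieldStructure p e G K}
    {T : GFieldStructure p e G L} (hS : InterpretsB K S) (hT : InterpretsB L T) (hK : S.Geometric)
    (f : K ↪[gLangB e G] L) (A : Finset L) : ∃ a : L → K,
      (∀ (n : ℕ) (F : (gLangB e G).Functions n) (x : Fin n → L), (∀ i, x i ∈ A) →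
        Structure.funMap F x ∈ A → a (Structure.funMap F x) = Structure.funMap F (a ∘ x)) ∧
      (∀ m, f m ∈ A → a (f m) = m) ∧ ∀ x ∈ A, ∀ y ∈ A, a x = a y → x = y := by
  classical
  obtain ⟨φ, hφ, hφf, hcon⟩ := hS.exists_ringHom hT f
  -- The inverses of differences are included so that distinct elements of A keep distinct images; 0
  -- makes the set nonempty, as the geometric axioms require n ≥ 1.
  let B : Finset L := insert 0 (A ∪ (A ×ˢ A).image fun z => (z.1 - z.2)⁻¹)
  have hAB : ∀ {x}, x ∈ A → x ∈ B := fun hx =>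
    Finset.mem_insert_of_mem (Finset.mem_union_left _ hx)
  have : Nonempty B := ⟨⟨0, Finset.mem_insert_self _ _⟩⟩
  obtain ⟨a, h0, hD, hσ⟩ := hK.exists_point' hφ (fun x : B => (x : L))
  let a' : L → K := fun x => if hx : x ∈ B then a ⟨x, hx⟩ else 0
  have ha' : ∀ {x} (hx : x ∈ A), a' x = a ⟨x, hAB hx⟩ := fun hx => dif_pos (hAB hx)
  have hev : ∀ {z} (hz : z ∈ A) (q : MvPolynomial B K),
      z = eval₂Hom φ (fun x : B => (x : L)) q → a' z = eval a q := fun {z} hz q hq => by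
    have := h0 (X ⟨z, hAB hz⟩ - q) (by rw [map_sub, eval₂Hom_X', ← hq, sub_self])
    rw [map_sub, eval_X, sub_eq_zero] at this
    rw [ha' hz, this]
  have hfix : ∀ m, φ m ∈ A → a' (φ m) = m := fun m hm =>
    (hev hm (C m) (eval₂Hom_C _ _ _).symm).trans (eval_C _)
  have hD' : ∀ i {x} (_ : x ∈ A) (_ : T.D i x ∈ A), a' (T.D i x) = S.D i (a' x) :=
    fun i {x} hx hz => by
      have := hD i ⟨x, hAB hx⟩ (X ⟨T.D i x, hAB hz⟩) (by rw [eval₂Hom_X']; rfl)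
      rw [eval_X] at this
      rw [ha' hx, ha' hz]
      exact this.symm
  have hσ' : ∀ g {x} (_ : x ∈ A) (_ : T.σ g x ∈ A), a' (T.σ g x) = S.σ g (a' x) :=
    fun g {x} hx hz => by
      have := hσ g ⟨x, hAB hx⟩ (X ⟨T.σ g x, hAB hz⟩) (by rw [eval₂Hom_X']; rfl)
      rw [eval_X] at this
      rw [ha' hx, ha' hz]
      exact this.symm
  refine ⟨a', fun n F => ?_, fun m hm => ?_, fun x hx y hy hxy => ?_⟩
  · induction n, F using gLangB_functions_cases with
    | add =>
      intro x hx hz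
      rw [hT.add] at hz ⊢
      rw [hS.add, hev hz (X ⟨_, hAB (hx 0)⟩ + X ⟨_, hAB (hx 1)⟩) (by simp), map_add, eval_X, eval_X,
        Function.comp_apply, Function.comp_apply, ha' (hx 0), ha' (hx 1)]
    | mul =>
      intro x hx hz
      rw [hT.mul] at hz ⊢
      rw [hS.mul, hev hz (X ⟨_, hAB (hx 0)⟩ * X ⟨_, hAB (hx 1)⟩) (by simp), map_mul, eval_X, eval_X,
        Function.comp_apply, Function.comp_apply, ha' (hx 0), ha' (hx 1)]
    | neg =>
      intro x hx hz
      rw [hT.neg] at hz ⊢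
      rw [hS.neg, hev hz (-X ⟨_, hAB (hx 0)⟩) (by simp), map_neg, eval_X,
        Function.comp_apply, ha' (hx 0)]
    | zero =>
      intro x hx hz
      rw [hT.zero] at hz ⊢
      rw [hS.zero, hev hz 0 (map_zero _).symm, map_zero]
    | one =>
      intro x hx hz
      rw [hT.one] at hz ⊢
      rw [hS.one, hev hz 1 (map_one _).symm, map_one]
    | der i =>
      intro x hx hz
      rw [hT.der] at hz ⊢
      exact (hD' i (hx 0) hz).trans (hS.der i (a' ∘ x)).symm
    | act g =>
      intro x hx hz
      rw [hT.act] at hz ⊢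
      exact (hσ' g (hx 0) hz).trans (hS.act g (a' ∘ x)).symm
    | con j =>
      intro x hx hz
      rw [funMap_con, ← hcon] at hz ⊢
      rw [funMap_con, hfix _ hz]
  · rw [← hφf] at hm ⊢
    exact hfix m hm
  · by_contra hne
    have hB : (x - y)⁻¹ ∈ B := Finset.mem_insert_of_mem (Finset.mem_union_right _
      (Finset.mem_image.2 ⟨(x, y), Finset.mem_product.2 ⟨hx, hy⟩, rfl⟩))
    have := h0 ((X ⟨x, hAB hx⟩ - X ⟨y, hAB hy⟩) * X ⟨_, hB⟩ - 1) (by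
      rw [map_sub, map_mul, map_sub, eval₂Hom_X', eval₂Hom_X', eval₂Hom_X', map_one,
        mul_inv_cancel₀ (sub_ne_zero.2 hne), sub_self])
    rw [map_sub, map_mul, map_sub, eval_X, eval_X, ← ha' hx, ← ha' hy, hxy, sub_self, zero_mul,
      map_one, zero_sub, neg_eq_zero] at this
    exact one_ne_zero this

variable [Finite G]

theorem exists_interpretsB_geometric (he : 0 < e) {K : Type w} [(gLangB e G).Structure K]
    (hK : K ⊨ gDCFb.{u, w} p e G) :
    ∃ (_ : Field K) (S : GFieldStructure p e G K), InterpretsB K S ∧ S.Geometric := by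
  let _ := reductB e G K
  have := isExpansionOn_reductB (e := e) (G := G) (K := K)
  obtain ⟨F, S, hS, hg⟩ := (model_gDCF_iff he).1 (model_withBasis_iff.1 hK).1
  exact ⟨F, S, hS, hg⟩

/-- The geometric axioms make M existentially closed in N, in the form of partial maps back to M on
finite sets; these assemble to an embedding of N over M into an ultrapower of M. -/
theorem isModelComplete_gDCFb (he : 0 < e) :
    IsModelComplete.{u, 0, w} (gDCFb.{u, w} p e G) :=
  isModelComplete_of_amalgamation fun M N f => by
    obtain ⟨_, S, hS, hK⟩ := exists_interpretsB_geometric he M.is_model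
    obtain ⟨_, T, hT, -⟩ := exists_interpretsB_geometric he N.is_model
    exact exists_amalgamation M N f (hS.exists_partial hT hK f)

/-- Interpret the constants in a geometric extension by the images of the b_j. They remain dual, and
the p-basis axiom comes from `realize_basisAxiom` rather than from preservation of p-bases. -/
theorem embedsIntoModels_gDFb_gDCFb (he : 0 < e) :
    EmbedsIntoModels.{u, 0, w} (gDFb p e G) (gDCFb.{u, w} p e G) := fun M => by
  obtain ⟨_, S, hS, hb⟩ := exists_interpretsB M.is_model
  obtain ⟨L, _, T, φ, hφ, hT⟩ := S.exists_geometric_extension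
  let _ := T.toStructure
  let _ : (constantsOn (Fin e)).Structure L :=
    constantsOn.structure fun j => φ ((gLang e G).con j : M)
  have hi := T.interprets_toStructure
  have hcon : ∀ j : Fin e, ((gLang e G).con j : L) = φ ((gLang e G).con j : M) := fun j => rfl
  have hL : L ⊨ gDCFb.{u, w} p e G := by
    refine model_withBasis_iff.2 ⟨(model_gDCF_iff he).2 ⟨_, T, hi, hT⟩, fun ψ hψ => ?_⟩
    refine hi.realize_basisAxiom hT ?_ hψ
    exact hφ.isDual hb
  exact ⟨Theory.ModelType.of _ L, ⟨show M ↪[gLangB e G] L from hS.embedding (T := T) hi φ hφ fun j => (hcon j).symm⟩⟩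

end

end FiniteGroupSchemeDCF

theorem proposition5p5 (p : ℕ) [Fact p.Prime] (e : ℕ) (he : 0 < e)
    (G : Type u) [Group G] [Finite G] :
    (∀ (K : Type w) [(FiniteGroupSchemeDCF.gLang e G).Structure K],
        K ⊨ FiniteGroupSchemeDCF.gDCF.{u, w} p e G ↔
          FiniteGroupSchemeDCF.IsGeometricGField p e G K) ∧
    FiniteGroupSchemeDCF.IsModelCompanion.{u, 0, w}
      (FiniteGroupSchemeDCF.gDCFb.{u, w} p e G) (FiniteGroupSchemeDCF.gDFb p e G) :=
  ⟨fun _ _ => FiniteGroupSchemeDCF.model_gDCF_iff he,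
    FiniteGroupSchemeDCF.embedsIntoModels_gDFb_gDCFb he,
    FiniteGroupSchemeDCF.embedsIntoModels_gDCFb_gDFb,
    FiniteGroupSchemeDCF.isModelComplete_gDCFb he⟩
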